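/- **Theorem 1.1.** Let $\varpi_0(r)=(1+r^2)^{-1}$ and, for $0<\delta<1$, let $$\varpi_\delta(r)=\begin{cases}\varpi_0(r)+\varpi_0(1+\delta/2)-\varpi_0(1-\delta/2), & 0\le r\le 1-\delta/2,\\ \varpi_0(1+\delta/2), & 1-\delta/2<r<1+\delta/2,\\ \varpi_0(r), & r\ge 1+\delta/2.\end{cases}$$ For $n\ge 1$ put $K_n(x)=\frac{1}{2x}x^{-n}$ for $x>1$, $K_n(x)=\frac1{2x}x^{n}$ for $0<x\le 1$ (extended to $x=0$ by its limit), and for a radial profile $\varpi$ put $c(r)=\int_0^\infty\varpi'(s)K_1(r/s)\,ds$. For a function $f(r,\theta)$ in polar coordinates let $u_r[f],u_\theta[f]$ be the polar components of the velocity $\frac1{2\pi}\int_{\mathbb R^2}\frac{(x-y)^\perp}{|x-y|^2}f(y)\,dy$, where $(a,b)^\perp=(-b,a)$. There is $N\in\mathbb N$ such that for every $n\ge N$ there are $\lambda_1\in\left(-\frac{\log 2}{2},-\frac{1-\log 2}{2}\right)$ and $M<\infty$ with the following property. For every $0<\alpha<1$ and every $\varepsilon>0$ there is $\delta_1\in(0,1]$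 such that for every $0<\delta<\delta_1$: 1. $\varpi_\delta\in W^{1,\infty}((0,\infty))$, $\ \|(1+r^2)^{-1}-\varpi_\delta\|_{C^\alpha([0,\infty))}\le\varepsilon$, $\varpi_\delta$ is non-increasing on $[0,\infty)$, it is constant on $(1-\delta/2,1+\delta/2)$, and $\operatorname{supp}(\partial_r\varpi_\delta)=[0,1-\delta/2]\cup[1+\delta/2,\infty)$. 2. There are $\lambda_2\in\mathbb R$ with $|\lambda_2|\le M$ and a function $h\in C^\infty(\operatorname{supp}(\partial_r\varpi_\delta))$, not identically zero, such that, with $$\lambda=\frac{\log 2}{2}+\delta\lambda_1+\delta^2\log^2(\delta)\,\lambda_2>0$$ and $\varpi=\varpi_\delta$, $$(\lambda+c(r))\,h(r)-\frac1n\int_0^\infty\partial_s\varpi(s)\,K_n\!\left(\frac rs\right)h(s)\,ds=0\qquad\text{for all } r\in\operatorname{supp}(\partial_r\varpi),$$ the integrals being absolutely convergent. 3. The function $w(t,r,\theta)=h(r)\,\partial_r\varpi_\delta(r)\cos(n(\theta-\lambda t))$ (read as $0$ where $\partial_r\varpi_\delta$ vanishes or does not exist) is a solution of the 2D Euler equation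 linearized around $\varpi_\delta$, $$\partial_t w+u_r[w]\,\partial_r\varpi_\delta+\frac{u_\theta[\varpi_\delta]}{r}\,\partial_\theta w=0\qquad (r>0),$$ which rotates rigidly with angular velocity $\lambda$, is periodic in time, is invariant under the rotation by the angle $2\pi/n$, and is not radial at any time. -/

import Mathlib

open Real Set MeasureTheory
open scoped NNReal ENNReal ContDiff

namespace LinearizedEuler

noncomputable section

/-! Functions of the radius are total functions `ℝ → ℝ`; only their values on `[0, ∞)` matter. -/

/-- The algebraic vortex `ϖ₀(r) = (1 + r²)⁻¹`. -/
def vortex (r : ℝ) : ℝ := (1 + r ^ 2)⁻¹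

/-- The vortex `ϖ₀` flattened on `(1 - δ/2, 1 + δ/2)`. -/
def profile (δ r : ℝ) : ℝ :=
  if r ≤ 1 - δ / 2 then vortex r + vortex (1 + δ / 2) - vortex (1 - δ / 2)
  else if r < 1 + δ / 2 then vortex (1 + δ / 2)
  else vortex r

/-- `f ∈ W^{1,∞}((0,∞))` with weak derivative `g`. -/
def MemW1InftyWith (f g : ℝ → ℝ) : Prop :=
  MemLp f ∞ (volume.restrict (Ioi 0)) ∧ MemLp g ∞ (volume.restrict (Ioi 0)) ∧
    ∀ φ : ℝ → ℝ, ContDiff ℝ ∞ φ → HasCompactSupport φ → tsupport φ ⊆ Ioi 0 →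
      ∫ r in Ioi (0 : ℝ), f r * deriv φ r = -∫ r in Ioi (0 : ℝ), g r * φ r

/-- The `C^α` norm on `[0,∞)`: supremum norm plus Hölder seminorm (possibly `∞`). -/
def holderFullNorm (α : ℝ≥0) (f : ℝ → ℝ) : ℝ≥0∞ :=
  (⨆ r : Ici (0 : ℝ), ‖f r‖ₑ) + eHolderNorm α ((Ici (0 : ℝ)).domRestrict f)

/-- The support of `∂_r ϖ` in `[0,∞)`. -/
def derivSupport (ϖ : ℝ → ℝ) : Set ℝ := closure {r | 0 < r ∧ deriv ϖ r ≠ 0}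

/-- The kernel `K_n(x) = x^{-n} / (2x)` for `x > 1` and `x^n / (2x)` for `x ≤ 1` (with `n ≥ 1`);
the power of `x` is simplified so that the value at `x = 0` is the limit as `x → 0⁺`. -/
def kernelK (n : ℕ) (x : ℝ) : ℝ :=
  if x ≤ 1 then x ^ (n - 1) / 2 else 1 / (2 * x ^ (n + 1))

/-- `c(r) = ∫₀^∞ ϖ'(s) K₁(r/s) ds`. -/
def cFun (ϖ : ℝ → ℝ) (r : ℝ) : ℝ :=
  ∫ s in Ioi (0 : ℝ), deriv ϖ s * kernelK 1 (r / s)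

/-- The eigenvalue integral equation for `h` on the support of `∂_r ϖ`,
all integrals being absolutely convergent. -/
def SolvesEigenEq (n : ℕ) (ϖ : ℝ → ℝ) (lam : ℝ) (h : ℝ → ℝ) : Prop :=
  ∀ r ∈ derivSupport ϖ,
    IntegrableOn (fun s => deriv ϖ s * kernelK 1 (r / s)) (Ioi 0) ∧
    IntegrableOn (fun s => deriv ϖ s * kernelK n (r / s) * h s) (Ioi 0) ∧
    (lam + cFun ϖ r) * h r
      - 1 / (n : ℝ) * ∫ s in Ioi (0 : ℝ), deriv ϖ s * kernelK n (r / s) * h s = 0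

/-- First component of `(x - y)^⊥ / |x - y|²`, where `(a, b)^⊥ = (-b, a)` and `x`, `y` have polar
coordinates `(r, θ)`, `(s, β)`. -/
def biotSavart₁ (r θ s β : ℝ) : ℝ :=
  -(r * sin θ - s * sin β) / (r ^ 2 + s ^ 2 - 2 * r * s * cos (θ - β))

/-- Second component of `(x - y)^⊥ / |x - y|²`. -/
def biotSavart₂ (r θ s β : ℝ) : ℝ :=
  (r * cos θ - s * cos β) / (r ^ 2 + s ^ 2 - 2 * r * s * cos (θ - β))

/-- Integrand of `u_r[f](r,θ)`, that is `e_r(θ) · (x - y)^⊥ / |x - y|² f(s,β) s`. -/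
def radialIntegrand (f : ℝ → ℝ → ℝ) (r θ : ℝ) (p : ℝ × ℝ) : ℝ :=
  (cos θ * biotSavart₁ r θ p.1 p.2 + sin θ * biotSavart₂ r θ p.1 p.2) * f p.1 p.2 * p.1

/-- Integrand of `u_θ[f](r,θ)`, that is `e_θ(θ) · (x - y)^⊥ / |x - y|² f(s,β) s`. -/
def angularIntegrand (f : ℝ → ℝ → ℝ) (r θ : ℝ) (p : ℝ × ℝ) : ℝ :=
  (-sin θ * biotSavart₁ r θ p.1 p.2 + cos θ * biotSavart₂ r θ p.1 p.2) * f p.1 p.2 * p.1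

/-- The domain of the polar coordinates `(s, β)`. -/
def polarDomain : Set (ℝ × ℝ) := Ioi (0 : ℝ) ×ˢ Ioc (-π) π

/-- Radial velocity generated by the vorticity `f(s, β)`. -/
def velR (f : ℝ → ℝ → ℝ) (r θ : ℝ) : ℝ :=
  1 / (2 * π) * ∫ p in polarDomain, radialIntegrand f r θ p

/-- Angular velocity component generated by the vorticity `f(s, β)`. -/
def velθ (f : ℝ → ℝ → ℝ) (r θ : ℝ) : ℝ :=
  1 / (2 * π) * ∫ p in polarDomain, angularIntegrand f r θ p

/-- `w(t, r, θ)` solves `∂_t w + u_r[w] ∂_r ϖ + (u_θ[ϖ] / r) ∂_θ w = 0`, the 2D Euler equation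
linearized around the radial vorticity `ϖ`; `w` is `2π`-periodic in `θ` and the Biot–Savart
integrals converge absolutely. -/
def SolvesLinearizedEuler (ϖ : ℝ → ℝ) (w : ℝ → ℝ → ℝ → ℝ) : Prop :=
  (∀ t r θ, w t r (θ + 2 * π) = w t r θ) ∧
  ∀ t r θ, 0 < r →
    DifferentiableAt ℝ (fun τ => w τ r θ) t ∧
    DifferentiableAt ℝ (fun η => w t r η) θ ∧
    IntegrableOn (radialIntegrand (w t) r θ) polarDomain ∧
    IntegrableOn (angularIntegrand (fun s _ => ϖ s) r θ) polarDomain ∧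
    deriv (fun τ => w τ r θ) t + velR (w t) r θ * deriv ϖ r
      + velθ (fun s _ => ϖ s) r θ / r * deriv (fun η => w t r η) θ = 0

/-- The wave `w(t, r, θ) = h(r) ∂_rϖ(r) cos(n(θ - λt))`. -/
def rotatingWave (n : ℕ) (ϖ : ℝ → ℝ) (lam : ℝ) (h : ℝ → ℝ) (t r θ : ℝ) : ℝ :=
  h r * deriv ϖ r * cos (n * (θ - lam * t))

/-- `w` rotates rigidly with angular velocity `lam`, is periodic in time, is invariant under the
rotation of angle `2π/n`, and is not radial at any time. -/
def IsNonradialRotating (n : ℕ) (lam : ℝ) (w : ℝ → ℝ → ℝ → ℝ) : Prop :=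
  (∀ t r θ, w t r θ = w 0 r (θ - lam * t)) ∧
  (∃ T > 0, ∀ t r θ, w (t + T) r θ = w t r θ) ∧
  (∀ t r θ, w t r (θ + 2 * π / n) = w t r θ) ∧
  ∀ t, ∃ r > 0, ∃ θ θ', w t r θ ≠ w t r θ'

end

end LinearizedEuler

open LinearizedEuler

/-! The angular velocity of the vortex is -c(r), and λ is close to its value log 2 / 2 at r = 1.
Flattening the vorticity on an annulus of width δ around r = 1 removes ϖ' exactly where λ + c
changes sign. On the support of ϖ' one can therefore divide by λ + c, and no singular critical layer
is left.

In the coordinates t = r² inside and t = r⁻² outside, each side becomes a part of (0, 1), and |λ +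
c| becomes D(t) + P - R (1 - t). Here D is a fixed profile that vanishes at t = 1 with slope -b,
while P and R are O(δ). The number b = `criticalSlope` is the same on both sides
(`isSideProfile_innerProfile`, `isSideProfile_outerProfile`). Up to normalisation, h is r^(n-1) Q₁ /
(λ + c) inside and r^(-n-1) Q₂ / (λ + c) outside. Since K_n(r/s) factorises when r and s lie on
different sides, the two sides interact only through scalars: each Q solves its own Volterra
equation with Q(0) = 1 and weight ±1 / ((1+t)² (D + P - R (1 - t))). The Volterra kernel is bounded
by (1 - t)/2 and by 1/(2n), so for large n it gives a contraction although the weight is nearly as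
singular as 1/(1 - t) (`eventually_limitWeight_small`, `exists_isVolterraSol`). What remains of the
eigenvalue equation is one scalar condition: the two values of `volterraFlux` add up to 2n
(`IsMatched.solvesEigenEq`).

Put λ = log 2 / 2 + δ ℓ. By `exists_flux_bound` each flux is ±(constant - log(gap)/(4b)) plus a
constant, up to O(δ log² δ). To leading order the gap is δ (-(1 - log 2)/2 - ℓ) inside and δ (ℓ +
log 2 / 2) outside. The signs are opposite and b is common, so log δ cancels
(`exists_flux_sum_bound`). The limiting function of ℓ increases from -∞ to ∞ on the interval where
both gaps are positive. The point where it equals 2n is lam₁, and the intermediate value theorem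
puts the true ℓ within O(δ log² δ) of it (`exists_isMatched`); this distance is what λ₂ records.

Smoothness of h is a bootstrap: Q' is a weighted mean of the weight times Q
(`IsVolterraSol.contDiffOn`). The passage to the Euler equation is Fourier analysis: the angular
integrals of the Biot–Savart kernel are Poisson integrals and produce exactly `kernelK`
(`velR_fourier_mode`, `velθ_radial`, `solvesLinearizedEuler_rotatingWave`). -/

namespace LinearizedEuler

/-! ### The flattened vortex -/

/-- The derivative of the vortex `ϖ₀`. -/
noncomputable def vortexDeriv (r : ℝ) : ℝ := -(2 * r) / (1 + r ^ 2) ^ 2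

lemma hasDerivAt_vortex (r : ℝ) : HasDerivAt vortex (vortexDeriv r) r := by
  have h0 : (1 + r ^ 2) ≠ 0 := by positivity
  have : HasDerivAt (fun x : ℝ => (1 + x ^ 2)⁻¹) _ r :=
    ((hasDerivAt_pow 2 r).const_add 1).fun_inv h0
  exact this.congr_deriv (by simp [vortexDeriv])

lemma vortexDeriv_neg {r : ℝ} (hr : 0 < r) : vortexDeriv r < 0 := by
  unfold vortexDeriv
  exact div_neg_of_neg_of_pos (by linarith) (by positivity)

lemma abs_vortexDeriv_le (r : ℝ) : |vortexDeriv r| ≤ 1 := by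
  unfold vortexDeriv
  rw [abs_div, abs_of_pos (by positivity : 0 < (1 + r ^ 2) ^ 2), div_le_one (by positivity),
    abs_neg]
  apply abs_le.2
  constructor <;> nlinarith [sq_nonneg (r ^ 2), sq_nonneg (r - 1), sq_nonneg (r + 1)]

lemma vortex_pos (r : ℝ) : 0 < vortex r := by unfold vortex; positivity

lemma vortex_le_one (r : ℝ) : vortex r ≤ 1 := by
  unfold vortex
  exact inv_le_one_of_one_le₀ (by nlinarith [sq_nonneg r])

lemma continuous_vortex : Continuous vortex :=
  continuous_iff_continuousAt.2 fun r => (hasDerivAt_vortex r).continuousAt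

lemma lipschitzWith_vortex : LipschitzWith 1 vortex := by
  apply lipschitzWith_of_nnnorm_deriv_le (fun r => (hasDerivAt_vortex r).differentiableAt)
  intro r
  rw [(hasDerivAt_vortex r).deriv, ← NNReal.coe_le_coe]
  simpa using abs_vortexDeriv_le r

lemma vortex_antitoneOn : AntitoneOn vortex (Ici 0) := by
  intro x hx y hy hxy
  unfold vortex
  have : x ^ 2 ≤ y ^ 2 := pow_le_pow_left₀ hx hxy 2
  gcongr

/-- Clamping replaces the case distinction by compositions of `vortex` with `min` and `max`, from
which the Lipschitz bound and the monotonicity can be read off. -/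
lemma profile_eq {δ : ℝ} (hδ : 0 < δ) (r : ℝ) : profile δ r =
    vortex (min r (1 - δ / 2)) - vortex (1 - δ / 2) + vortex (max r (1 + δ / 2)) := by
  unfold profile
  split_ifs with h1 h2
  · rw [min_eq_left h1, max_eq_right (by linarith)]; ring
  · rw [min_eq_right (by linarith), max_eq_right h2.le]; ring
  · rw [min_eq_right (by linarith), max_eq_left (by linarith)]; ring

lemma profile_of_le {δ r : ℝ} (h : r ≤ 1 - δ / 2) :
    profile δ r = vortex r + vortex (1 + δ / 2) - vortex (1 - δ / 2) := if_pos h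

lemma profile_of_ge {δ r : ℝ} (hδ : 0 < δ) (h : 1 + δ / 2 ≤ r) : profile δ r = vortex r := by
  unfold profile
  rw [if_neg (by linarith), if_neg (by linarith)]

lemma profile_of_mem {δ r : ℝ} (h1 : 1 - δ / 2 ≤ r) (h2 : r ≤ 1 + δ / 2) :
    profile δ r = vortex (1 + δ / 2) := by
  unfold profile
  split_ifs with h h'
  · rw [le_antisymm h h1]; ring
  · rfl
  · rw [le_antisymm h2 (not_lt.1 h')]

lemma lipschitzWith_profile {δ : ℝ} (hδ : 0 < δ) : LipschitzWith 2 (profile δ) := by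
  have h1 : LipschitzWith 1 fun r : ℝ => vortex (min r (1 - δ / 2)) := by
    simpa [Function.comp_def] using lipschitzWith_vortex.comp (LipschitzWith.id.min_const (1 - δ / 2))
  have h2 : LipschitzWith 1 fun r : ℝ => vortex (max r (1 + δ / 2)) := by
    simpa [Function.comp_def] using lipschitzWith_vortex.comp (LipschitzWith.id.max_const (1 + δ / 2))
  have h3 := (h1.sub (LipschitzWith.const (vortex (1 - δ / 2)))).add h2
  have : profile δ = fun r => vortex (min r (1 - δ / 2)) - vortex (1 - δ / 2)
      + vortex (max r (1 + δ / 2)) := funext (profile_eq hδ)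
  rw [this]
  norm_num at h3
  convert h3 using 1

lemma profile_antitoneOn {δ : ℝ} (hδ : 0 < δ) (hδ1 : δ < 1) :
    AntitoneOn (profile δ) (Ici 0) := by
  intro x hx y hy hxy
  rw [profile_eq hδ, profile_eq hδ]
  simp only [mem_Ici] at hx hy
  have h1 := vortex_antitoneOn (a := min x (1 - δ / 2)) (b := min y (1 - δ / 2))
    (by simp only [mem_Ici, le_min_iff]; constructor <;> linarith)
    (by simp only [mem_Ici, le_min_iff]; constructor <;> linarith) (min_le_min_right _ hxy)
  have h2 := vortex_antitoneOn (a := max x (1 + δ / 2)) (b := max y (1 + δ / 2))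
    (by simp only [mem_Ici, le_max_iff]; left; linarith)
    (by simp only [mem_Ici, le_max_iff]; left; linarith) (max_le_max_right _ hxy)
  linarith

lemma deriv_profile_of_lt {δ r : ℝ} (h : r < 1 - δ / 2) :
    deriv (profile δ) r = vortexDeriv r := by
  have : profile δ =ᶠ[nhds r] fun r => vortex r + vortex (1 + δ / 2) - vortex (1 - δ / 2) := by
    filter_upwards [Iio_mem_nhds h] with x hx using profile_of_le (le_of_lt hx)
  rw [this.deriv_eq]
  exact (((hasDerivAt_vortex r).add_const _).sub_const _).deriv

lemma deriv_profile_of_gt {δ r : ℝ} (hδ : 0 < δ) (h : 1 + δ / 2 < r) :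
    deriv (profile δ) r = vortexDeriv r := by
  have : profile δ =ᶠ[nhds r] vortex := by
    filter_upwards [Ioi_mem_nhds h] with x hx using profile_of_ge hδ (le_of_lt hx)
  rw [this.deriv_eq, (hasDerivAt_vortex r).deriv]

lemma deriv_profile_of_mem {δ r : ℝ} (h1 : 1 - δ / 2 < r) (h2 : r < 1 + δ / 2) :
    deriv (profile δ) r = 0 := by
  have : profile δ =ᶠ[nhds r] fun _ => vortex (1 + δ / 2) := by
    filter_upwards [Ioo_mem_nhds h1 h2] with x hx using profile_of_mem hx.1.le hx.2.le
  rw [this.deriv_eq, deriv_const]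

lemma derivSupport_profile {δ : ℝ} (hδ : 0 < δ) (hδ1 : δ < 1) :
    derivSupport (profile δ) = Icc 0 (1 - δ / 2) ∪ Ici (1 + δ / 2) := by
  unfold derivSupport
  apply Subset.antisymm
  · apply closure_minimal _ (isClosed_Icc.union isClosed_Ici)
    rintro r ⟨hr, hd⟩
    by_contra hcon
    simp only [mem_union, mem_Icc, mem_Ici, not_or, not_and, not_le] at hcon
    exact hd (deriv_profile_of_mem (hcon.1 hr.le) hcon.2)
  -- Nothing has to be known about the derivative at 0 and 1 ± δ/2: these points enter through the
  -- closure.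
  · rw [← closure_Ioo (by linarith : (0 : ℝ) ≠ 1 - δ / 2), ← closure_Ioi, ← closure_union]
    apply closure_mono
    rintro r (⟨h1, h2⟩ | h)
    · exact ⟨h1, by rw [deriv_profile_of_lt h2]; exact (vortexDeriv_neg h1).ne⟩
    · have h0 : 0 < r := by simp only [mem_Ioi] at h; linarith
      exact ⟨h0, by rw [deriv_profile_of_gt hδ h]; exact (vortexDeriv_neg h0).ne⟩

lemma abs_deriv_profile_le {δ : ℝ} (hδ : 0 < δ) (r : ℝ) : |deriv (profile δ) r| ≤ 2 := by
  simpa using norm_deriv_le_of_lipschitz (lipschitzWith_profile hδ) (x₀ := r)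

lemma abs_profile_le {δ : ℝ} (hδ : 0 < δ) (r : ℝ) : |profile δ r| ≤ 2 := by
  rw [profile_eq hδ, abs_le]
  have h1 := vortex_pos (min r (1 - δ / 2))
  have h2 := vortex_pos (1 - δ / 2)
  have h3 := vortex_pos (max r (1 + δ / 2))
  have h4 := vortex_le_one (min r (1 - δ / 2))
  have h5 := vortex_le_one (1 - δ / 2)
  have h6 := vortex_le_one (max r (1 + δ / 2))
  constructor <;> linarith

/-! ### Sobolev regularity and Hölder distance to the vortex. -/

lemma memW1InftyWith_profile {δ : ℝ} (hδ : 0 < δ) :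
    MemW1InftyWith (profile δ) (deriv (profile δ)) := by
  refine ⟨?_, ?_, ?_⟩
  · exact memLp_top_of_bound (lipschitzWith_profile hδ).continuous.aestronglyMeasurable 2
      (Filter.Eventually.of_forall fun r => abs_profile_le hδ r)
  · exact memLp_top_of_bound (measurable_deriv _).aestronglyMeasurable 2
      (Filter.Eventually.of_forall fun r => abs_deriv_profile_le hδ r)
  · intro φ hφ hc hs
    have hz : ∀ r ∉ Ioi (0 : ℝ), φ r = 0 := fun r hr => image_eq_zero_of_notMem_tsupport
      fun h => hr (hs h)
    have hz' : ∀ r ∉ Ioi (0 : ℝ), deriv φ r = 0 := fun r hr => by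
      by_contra h
      exact hr (hs (support_deriv_subset (𝕜 := ℝ) h))
    -- The test function is supported in the open half-line, so the integration by parts takes place
    -- on all of ℝ without a boundary term at 0.
    rw [setIntegral_eq_integral_of_forall_compl_eq_zero (fun r hr => by rw [hz' r hr, mul_zero]),
      setIntegral_eq_integral_of_forall_compl_eq_zero (fun r hr => by rw [hz r hr, mul_zero])]
    obtain ⟨D, hD⟩ := hφ.lipschitzWith_of_hasCompactSupport hc (by simp)
    have := LipschitzWith.integral_lineDeriv_mul_eq (μ := volume) (lipschitzWith_profile hδ) hD hc 1
    have e1 : ∀ x, lineDeriv ℝ (profile δ) x 1 = deriv (profile δ) x := fun x => by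
      simp [lineDeriv, deriv_comp_const_add]
    have e2 : ∀ x, lineDeriv ℝ φ x (-1) = -deriv φ x := fun x => by
      rw [lineDeriv_neg]
      simp [lineDeriv, deriv_comp_const_add]
    simp_rw [e1, e2] at this
    rw [this, ← integral_neg]
    congr 1
    ext x
    ring

/-- The difference is constant on each side of the annulus, so it only depends on the radius clamped
to the annulus. Its increments are then bounded both by δ and by |x - y|. -/
lemma vortex_sub_profile {δ : ℝ} (hδ : 0 < δ) (r : ℝ) : (1 + r ^ 2)⁻¹ - profile δ r =
    vortex (max (1 - δ / 2) (min r (1 + δ / 2))) - vortex (1 + δ / 2) := by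
  change vortex r - _ = _
  rcases le_total r (1 - δ / 2) with h | h
  · rw [profile_of_le h, min_eq_left (by linarith), max_eq_left h]; ring
  rcases le_total r (1 + δ / 2) with h' | h'
  · rw [profile_of_mem h h', min_eq_left h', max_eq_right h]
  · rw [profile_of_ge hδ h', min_eq_right h', max_eq_right (by linarith)]; ring

lemma abs_clamp_sub_le {a b : ℝ} (hab : a ≤ b) (x y : ℝ) :
    |max a (min x b) - max a (min y b)| ≤ b - a := by
  have h1 : a ≤ max a (min x b) := le_max_left _ _
  have h2 : a ≤ max a (min y b) := le_max_left _ _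
  have h3 : max a (min x b) ≤ b := max_le hab (min_le_right _ _)
  have h4 : max a (min y b) ≤ b := max_le hab (min_le_right _ _)
  rw [abs_le]; constructor <;> linarith

lemma abs_clamp_sub_le' {a b : ℝ} (x y : ℝ) :
    |max a (min x b) - max a (min y b)| ≤ |x - y| := by
  have h1 := abs_max_sub_max_le_max a (min x b) a (min y b)
  have h2 := abs_min_sub_min_le_max x b y b
  simp only [sub_self, abs_zero] at h1 h2
  exact h1.trans (max_le (abs_nonneg _) (h2.trans (max_le le_rfl (abs_nonneg _))))

/-- Interpolation: an increment A of the clamped radius satisfies A ≤ δ and A ≤ |x - y|, and A =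
A^(1-α) A^α uses the first bound for one factor and the second for the other. -/
lemma holderFullNorm_vortex_sub_profile_le {α : ℝ≥0} (hα1 : α < 1) {δ : ℝ} (hδ : 0 < δ)
    (hδ1 : δ < 1) :
    holderFullNorm α (fun r => (1 + r ^ 2)⁻¹ - profile δ r)
      ≤ ENNReal.ofReal (2 * δ ^ (1 - α : ℝ)) := by
  have hα1' : (α : ℝ) < 1 := hα1
  have hL : ∀ x y : ℝ, |vortex x - vortex y| ≤ |x - y| := fun x y => by
    simpa [Real.dist_eq] using lipschitzWith_vortex.dist_le_mul x y
  have hp : 0 ≤ δ ^ (1 - α : ℝ) := by positivity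
  have hd : δ ≤ δ ^ (1 - α : ℝ) := by
    conv_lhs => rw [← Real.rpow_one δ]
    exact Real.rpow_le_rpow_of_exponent_ge hδ hδ1.le (by simp)
  have h1 : (⨆ r : Ici (0 : ℝ), ‖(1 + (r : ℝ) ^ 2)⁻¹ - profile δ r‖ₑ)
      ≤ ENNReal.ofReal (δ ^ (1 - α : ℝ)) := by
    refine iSup_le fun r => ?_
    rw [← ofReal_norm, vortex_sub_profile hδ]
    refine ENNReal.ofReal_le_ofReal ((hL _ _).trans ?_)
    have := abs_clamp_sub_le (by linarith : 1 - δ / 2 ≤ 1 + δ / 2) (r : ℝ) (1 + δ / 2)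
    rw [min_self, max_eq_right (by linarith : 1 - δ / 2 ≤ 1 + δ / 2)] at this
    linarith
  have h2 : eHolderNorm α ((Ici (0 : ℝ)).domRestrict fun r => (1 + r ^ 2)⁻¹ - profile δ r)
      ≤ ENNReal.ofReal (δ ^ (1 - α : ℝ)) := by
    apply HolderWith.eHolderNorm_le
    intro x y
    simp only [Set.domRestrict_apply, vortex_sub_profile hδ, edist_dist, Real.dist_eq,
      sub_sub_sub_cancel_right]
    rw [← ENNReal.ofReal.eq_1, ENNReal.ofReal_rpow_of_nonneg dist_nonneg (by positivity),
      ← ENNReal.ofReal_mul hp]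
    refine ENNReal.ofReal_le_ofReal ((hL _ _).trans ?_)
    rw [Subtype.dist_eq, Real.dist_eq]
    have e1 := abs_clamp_sub_le (by linarith : 1 - δ / 2 ≤ 1 + δ / 2) (x : ℝ) y
    have e2 := abs_clamp_sub_le' (a := 1 - δ / 2) (b := 1 + δ / 2) (x : ℝ) y
    set A := |max (1 - δ / 2) (min (x : ℝ) (1 + δ / 2)) - max (1 - δ / 2) (min (y : ℝ) (1 + δ / 2))|
    have hA : 0 ≤ A := abs_nonneg _
    calc A = A ^ (1 - α : ℝ) * A ^ (α : ℝ) := by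
          rw [← Real.rpow_add_of_nonneg hA (by linarith) (by positivity)]; simp
      _ ≤ _ := by
          gcongr
          linarith
  unfold holderFullNorm
  refine (add_le_add h1 h2).trans ?_
  rw [← ENNReal.ofReal_add hp hp, two_mul]

lemma abs_deriv_profile_le_vortexDeriv {δ : ℝ} (hδ : 0 < δ) :
    ∀ᵐ s : ℝ, |deriv (profile δ) s| ≤ |vortexDeriv s| := by
  have h1 : ∀ᵐ s : ℝ, s ≠ 1 - δ / 2 := by simp [ae_iff, measure_singleton]
  have h2 : ∀ᵐ s : ℝ, s ≠ 1 + δ / 2 := by simp [ae_iff, measure_singleton]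
  filter_upwards [h1, h2] with s hs1 hs2
  rcases lt_or_gt_of_ne hs1 with h | h
  · rw [deriv_profile_of_lt h]
  rcases lt_or_gt_of_ne hs2 with h' | h'
  · rw [deriv_profile_of_mem h h']; simp
  · rw [deriv_profile_of_gt hδ h']

/-! ### Integrability of ϖ' and the angular velocity of the flattened vortex. -/

lemma tendsto_vortex_atTop : Filter.Tendsto vortex Filter.atTop (nhds 0) := by
  unfold vortex
  apply Filter.Tendsto.inv_tendsto_atTop
  exact Filter.tendsto_atTop_add_const_left _ _ (Filter.tendsto_pow_atTop two_ne_zero)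

lemma integrableOn_vortexDeriv : IntegrableOn vortexDeriv (Ioi 0) :=
  integrableOn_Ioi_deriv_of_nonpos (continuous_vortex.continuousWithinAt)
    (fun x _ => hasDerivAt_vortex x) (fun _ hx => (vortexDeriv_neg hx).le) tendsto_vortex_atTop

lemma integrableOn_deriv_profile {δ : ℝ} (hδ : 0 < δ) :
    IntegrableOn (deriv (profile δ)) (Ioi 0) :=
  Integrable.mono integrableOn_vortexDeriv (measurable_deriv _).aestronglyMeasurable
    (ae_restrict_of_ae (abs_deriv_profile_le_vortexDeriv hδ))

lemma measurable_kernelK (n : ℕ) : Measurable (kernelK n) := by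
  unfold kernelK
  exact Measurable.ite measurableSet_Iic (by fun_prop) (by fun_prop)

lemma kernelK_nonneg (n : ℕ) {x : ℝ} (hx : 0 ≤ x) : 0 ≤ kernelK n x := by
  unfold kernelK
  split_ifs <;> positivity

lemma kernelK_le (n : ℕ) {x : ℝ} (hx : 0 ≤ x) : kernelK n x ≤ 1 / 2 := by
  unfold kernelK
  split_ifs with h
  · have := pow_le_one₀ (n := n - 1) hx h
    linarith
  · push Not at h
    have := one_le_pow₀ (n := n + 1) h.le
    rw [div_le_div_iff₀ (by positivity) (by norm_num)]
    linarith

lemma integrableOn_deriv_profile_mul_kernelK {δ : ℝ} (hδ : 0 < δ) (n : ℕ) {r : ℝ} (hr : 0 ≤ r) :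
    IntegrableOn (fun s => deriv (profile δ) s * kernelK n (r / s)) (Ioi 0) := by
  apply (integrableOn_deriv_profile hδ).mul_bdd (c := 1 / 2)
  · exact ((measurable_kernelK n).comp (by fun_prop)).aestronglyMeasurable
  · filter_upwards [ae_restrict_mem measurableSet_Ioi] with s hs
    have h0 : 0 ≤ r / s := div_nonneg hr (le_of_lt hs)
    rw [Real.norm_of_nonneg (kernelK_nonneg n h0)]
    exact kernelK_le n h0

lemma absolutelyContinuousOnInterval_profile {δ : ℝ} (hδ : 0 < δ) (x y : ℝ) :
    AbsolutelyContinuousOnInterval (profile δ) x y :=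
  (lipschitzWith_profile hδ).lipschitzOnWith.absolutelyContinuousOnInterval

lemma integral_Ioi_deriv_profile {δ : ℝ} (hδ : 0 < δ) {r : ℝ} (hr : 0 ≤ r) :
    ∫ s in Ioi r, deriv (profile δ) s = -profile δ r := by
  have h1 := intervalIntegral_tendsto_integral_Ioi r
    ((integrableOn_deriv_profile hδ).mono_set (Ioi_subset_Ioi hr)) Filter.tendsto_id
  simp only [id, (absolutelyContinuousOnInterval_profile hδ r _).integral_deriv_eq_sub] at h1
  have h2 : Filter.Tendsto (fun x => profile δ x - profile δ r) Filter.atTop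
      (nhds (0 - profile δ r)) := by
    apply Filter.Tendsto.sub_const
    apply tendsto_vortex_atTop.congr'
    filter_upwards [Filter.eventually_ge_atTop (1 + δ / 2)] with x hx
    exact (profile_of_ge hδ hx).symm
  rw [tendsto_nhds_unique h1 h2, zero_sub]

lemma cFun_profile_zero {δ : ℝ} (hδ : 0 < δ) : cFun (profile δ) 0 = -(profile δ 0 / 2) := by
  unfold cFun kernelK
  simp only [zero_div, zero_le_one, if_true, Nat.sub_self, pow_zero]
  rw [integral_mul_const, integral_Ioi_deriv_profile hδ le_rfl]
  ring

/-- Integration by parts on (0, r), where the kernel is a multiple of s²; the boundary term cancels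
the contribution of s > r. In this form -c is the circulation over 2π divided by r², that is, u_θ /
r. -/
lemma cFun_profile {δ : ℝ} (hδ : 0 < δ) {r : ℝ} (hr : 0 < r) :
    cFun (profile δ) r = -((∫ s in (0 : ℝ)..r, s * profile δ s) / r ^ 2) := by
  have hi := integrableOn_deriv_profile_mul_kernelK hδ 1 hr.le
  unfold cFun
  rw [← Ioc_union_Ioi_eq_Ioi hr.le, setIntegral_union (Ioc_disjoint_Ioi le_rfl) measurableSet_Ioi
    (hi.mono_set Ioc_subset_Ioi_self) (hi.mono_set (Ioi_subset_Ioi hr.le))]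
  have e1 : ∫ s in Ioi r, deriv (profile δ) s * kernelK 1 (r / s) = -(profile δ r / 2) := by
    rw [setIntegral_congr_fun (g := fun s => deriv (profile δ) s * (1 / 2)) measurableSet_Ioi,
      integral_mul_const, integral_Ioi_deriv_profile hδ hr.le]
    · ring
    · intro s hs
      have hs' : 0 < s := hr.trans hs
      have : r / s ≤ 1 := (div_le_one hs').2 (le_of_lt hs)
      simp [kernelK, this]
  have e2 : ∫ s in Ioc 0 r, deriv (profile δ) s * kernelK 1 (r / s)
      = (∫ s in (0 : ℝ)..r, s ^ 2 * deriv (profile δ) s) / (2 * r ^ 2) := by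
    rw [intervalIntegral.integral_of_le hr.le, ← integral_div]
    apply setIntegral_congr_fun measurableSet_Ioc
    intro s hs
    have hs0 : s ≠ 0 := hs.1.ne'
    simp only [kernelK]
    split_ifs with h
    · have : s = r := le_antisymm hs.2 ((div_le_one hs.1).1 h)
      subst this
      field_simp
      simp
    · rw [div_pow]
      field_simp
      ring
  have hac : AbsolutelyContinuousOnInterval (fun s : ℝ => s ^ 2) 0 r := by
    have : ContDiffOn ℝ 1 (fun s : ℝ => s ^ 2) (uIcc 0 r) := by fun_prop
    obtain ⟨K, hK⟩ := this.exists_lipschitzOnWith (by simp) (convex_uIcc _ _) isCompact_uIcc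
    exact hK.absolutelyContinuousOnInterval
  rw [e1, e2, hac.integral_mul_deriv_eq_deriv_mul (absolutelyContinuousOnInterval_profile hδ 0 r)]
  have e3 : ∫ s in (0 : ℝ)..r, deriv (fun s : ℝ => s ^ 2) s * profile δ s
      = 2 * ∫ s in (0 : ℝ)..r, s * profile δ s := by
    rw [← intervalIntegral.integral_const_mul]
    congr 1
    ext s
    simp
    ring
  rw [e3]
  field_simp
  ring

/-- Half the height of the jump that is removed from the vortex. -/
noncomputable def innerShift (δ : ℝ) : ℝ := (vortex (1 + δ / 2) - vortex (1 - δ / 2)) / 2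

/-- The change of the circulation (over `2π`) outside of the flattened annulus. -/
noncomputable def outerShift (δ : ℝ) : ℝ :=
  innerShift δ * (1 - δ / 2) ^ 2 + δ * vortex (1 + δ / 2)
    - (log (1 + (1 + δ / 2) ^ 2) - log (1 + (1 - δ / 2) ^ 2)) / 2

/-- The function `t ↦ log (1 + t) / t`, with the value `1` at `t = 0`. -/
noncomputable def logSlope (t : ℝ) : ℝ := dslope (fun t => log (1 + t)) 0 t

lemma logSlope_of_ne {t : ℝ} (ht : t ≠ 0) : logSlope t = log (1 + t) / t := by
  rw [logSlope, dslope_of_ne _ ht, slope_def_field]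
  simp

lemma logSlope_zero : logSlope 0 = 1 := by
  rw [logSlope, dslope_same]
  have : HasDerivAt (fun t : ℝ => log (1 + t)) _ 0 :=
    ((hasDerivAt_id (0 : ℝ)).const_add 1).log (by norm_num)
  rw [this.deriv]
  norm_num

lemma integral_mul_vortex (x y : ℝ) :
    ∫ s in x..y, s * vortex s = (log (1 + y ^ 2) - log (1 + x ^ 2)) / 2 := by
  have h : ∀ s ∈ uIcc x y, HasDerivAt (fun s : ℝ => log (1 + s ^ 2) / 2) (s * vortex s) s := by
    intro s _
    have h0 : (1 + s ^ 2) ≠ 0 := by positivity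
    have := (((hasDerivAt_pow 2 s).const_add 1).log h0).div_const 2
    refine this.congr_deriv ?_
    unfold vortex
    field_simp
    norm_num
    ring
  rw [intervalIntegral.integral_eq_sub_of_hasDerivAt h
    ((continuous_id.mul continuous_vortex).intervalIntegrable _ _)]
  ring

lemma integral_mul_profile_of_le {δ r : ℝ} (hr : 0 ≤ r) (h : r ≤ 1 - δ / 2) :
    ∫ s in (0 : ℝ)..r, s * profile δ s = log (1 + r ^ 2) / 2 + innerShift δ * r ^ 2 := by
  have : ∫ s in (0 : ℝ)..r, s * profile δ s
      = ∫ s in (0 : ℝ)..r, (s * vortex s + 2 * innerShift δ * s) := by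
    apply intervalIntegral.integral_congr
    intro s hs
    rw [uIcc_of_le hr] at hs
    simp only
    rw [profile_of_le (hs.2.trans h), innerShift]
    ring
  have hv : Continuous fun s : ℝ => s * vortex s := continuous_id.mul continuous_vortex
  rw [this, intervalIntegral.integral_add (hv.intervalIntegrable _ _)
    (Continuous.intervalIntegrable (by fun_prop) _ _), integral_mul_vortex,
    intervalIntegral.integral_const_mul, integral_id]
  simp
  ring

lemma integral_mul_profile_of_ge {δ r : ℝ} (hδ : 0 < δ) (hδ1 : δ < 1) (h : 1 + δ / 2 ≤ r) :
    ∫ s in (0 : ℝ)..r, s * profile δ s = log (1 + r ^ 2) / 2 + outerShift δ := by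
  have hc : Continuous fun s => s * profile δ s :=
    continuous_id.mul (lipschitzWith_profile hδ).continuous
  rw [← intervalIntegral.integral_add_adjacent_intervals (hc.intervalIntegrable 0 (1 - δ / 2))
    (hc.intervalIntegrable _ _), ← intervalIntegral.integral_add_adjacent_intervals
    (hc.intervalIntegrable (1 - δ / 2) (1 + δ / 2)) (hc.intervalIntegrable _ _),
    integral_mul_profile_of_le (by linarith) le_rfl]
  have e1 : ∫ s in (1 - δ / 2)..(1 + δ / 2), s * profile δ s = δ * vortex (1 + δ / 2) := by
    have : ∫ s in (1 - δ / 2)..(1 + δ / 2), s * profile δ s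
        = ∫ s in (1 - δ / 2)..(1 + δ / 2), s * vortex (1 + δ / 2) := by
      apply intervalIntegral.integral_congr
      intro s hs
      rw [uIcc_of_le (by linarith)] at hs
      simp only
      rw [profile_of_mem hs.1 hs.2]
    rw [this, intervalIntegral.integral_mul_const, integral_id]
    ring
  have e2 : ∫ s in (1 + δ / 2)..r, s * profile δ s = ∫ s in (1 + δ / 2)..r, s * vortex s := by
    apply intervalIntegral.integral_congr
    intro s hs
    rw [uIcc_of_le h] at hs
    simp only
    rw [profile_of_ge hδ hs.1]
  rw [e1, e2, integral_mul_vortex, outerShift]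
  ring

lemma cFun_profile_of_le {δ r : ℝ} (hδ : 0 < δ) (hδ1 : δ < 1) (hr : 0 ≤ r) (h : r ≤ 1 - δ / 2) :
    cFun (profile δ) r = -(logSlope (r ^ 2) / 2 + innerShift δ) := by
  rcases hr.eq_or_lt with rfl | hr
  · rw [cFun_profile_zero hδ, profile_of_le (by linarith), innerShift]
    simp [logSlope_zero, vortex]
    ring
  · rw [cFun_profile hδ hr, integral_mul_profile_of_le hr.le h, logSlope_of_ne (by positivity)]
    field_simp

lemma cFun_profile_of_ge {δ r : ℝ} (hδ : 0 < δ) (hδ1 : δ < 1) (h : 1 + δ / 2 ≤ r) :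
    cFun (profile δ) r = -((log (1 + r ^ 2) / 2 + outerShift δ) / r ^ 2) := by
  rw [cFun_profile hδ (by linarith), integral_mul_profile_of_ge hδ hδ1 h]

/-! ### Fourier integrals of the Biot–Savart kernel -/

lemma poisson_den_pos {ρ : ℝ} (h0 : 0 ≤ ρ) (h1 : ρ < 1) (φ : ℝ) :
    0 < 1 - 2 * ρ * cos φ + ρ ^ 2 := by
  nlinarith [cos_le_one φ, mul_nonneg h0 (sub_nonneg.2 (cos_le_one φ)), sq_pos_of_pos (sub_pos.2 h1)]

/-- Real and imaginary part of the geometric series of ρ exp(iφ). -/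
lemma hasSum_geometric_cis {ρ : ℝ} (h0 : 0 ≤ ρ) (h1 : ρ < 1) (φ : ℝ) :
    HasSum (fun k : ℕ => ρ ^ k * cos (k * φ))
      ((1 - ρ * cos φ) / (1 - 2 * ρ * cos φ + ρ ^ 2)) ∧
    HasSum (fun k : ℕ => ρ ^ k * sin (k * φ)) (ρ * sin φ / (1 - 2 * ρ * cos φ + ρ ^ 2)) := by
  have hD := poisson_den_pos h0 h1 φ
  set z : ℂ := ρ * Complex.exp (φ * Complex.I) with hz
  have hnorm : ‖z‖ < 1 := by
    rw [hz, norm_mul, Complex.norm_exp_ofReal_mul_I, Complex.norm_real, mul_one,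
      Real.norm_of_nonneg h0]
    exact h1
  have hs := hasSum_geometric_of_norm_lt_one hnorm
  have hk : ∀ k : ℕ, z ^ k = (ρ ^ k * cos (k * φ) : ℝ) + (ρ ^ k * sin (k * φ) : ℝ) * Complex.I := by
    intro k
    rw [hz, mul_pow, ← Complex.exp_nat_mul, ← mul_assoc, Complex.exp_mul_I]
    push_cast
    ring
  have hre : ∀ k : ℕ, (z ^ k).re = ρ ^ k * cos (k * φ) := fun k => by
    rw [hk k]
    simp only [Complex.add_re, Complex.ofReal_re, Complex.mul_re, Complex.ofReal_im, Complex.I_re,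
      Complex.I_im]
    ring
  have him : ∀ k : ℕ, (z ^ k).im = ρ ^ k * sin (k * φ) := fun k => by
    rw [hk k]
    simp only [Complex.add_im, Complex.ofReal_re, Complex.mul_im, Complex.ofReal_im, Complex.I_re,
      Complex.I_im]
    ring
  have hzre : z.re = ρ * cos φ := by simpa using hre 1
  have hzim : z.im = ρ * sin φ := by simpa using him 1
  have hns : Complex.normSq (1 - z) = 1 - 2 * ρ * cos φ + ρ ^ 2 := by
    rw [Complex.normSq_apply]
    simp only [Complex.sub_re, Complex.one_re, Complex.sub_im, Complex.one_im, hzre, hzim]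
    nlinarith [sin_sq_add_cos_sq φ]
  constructor
  · have := Complex.hasSum_re hs
    rw [Complex.inv_re, hns] at this
    simp only [Complex.sub_re, Complex.one_re, hzre] at this
    simpa only [hre] using this
  · have := Complex.hasSum_im hs
    rw [Complex.inv_im, hns] at this
    simp only [Complex.sub_im, Complex.one_im, hzim] at this
    rw [zero_sub, neg_neg] at this
    simpa only [him] using this

lemma integral_cos_int_mul (m : ℤ) :
    ∫ φ in (-π)..π, cos (m * φ) = if m = 0 then 2 * π else 0 := by
  split_ifs with h
  · subst h
    simp
    ring
  · have hm : (m : ℝ) ≠ 0 := by exact_mod_cast h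
    rw [intervalIntegral.integral_comp_mul_left (fun x => cos x) hm, integral_cos]
    simp [sin_int_mul_pi]

lemma integral_sin_int_mul (m : ℤ) : ∫ φ in (-π)..π, sin (m * φ) = 0 := by
  rcases eq_or_ne m 0 with h | h
  · subst h
    simp
  · have hm : (m : ℝ) ≠ 0 := by exact_mod_cast h
    rw [intervalIntegral.integral_comp_mul_left (fun x => sin x) hm, integral_sin]
    simp

lemma integral_sin_mul_cos_sub (k n : ℕ) (hn : 1 ≤ n) (Θ : ℝ) :
    ∫ φ in (-π)..π, sin (k * φ) * cos (n * (Θ - φ)) = if k = n then π * sin (n * Θ) else 0 := by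
  have e : ∀ φ : ℝ, sin (k * φ) * cos (n * (Θ - φ))
      = (sin (n * Θ) / 2) * cos (((k - n : ℤ) : ℝ) * φ) + (cos (n * Θ) / 2) * sin (((k - n : ℤ) : ℝ) * φ)
        + ((cos (n * Θ) / 2) * sin (((k + n : ℤ) : ℝ) * φ)
          - (sin (n * Θ) / 2) * cos (((k + n : ℤ) : ℝ) * φ)) := by
    intro φ
    push_cast
    rw [mul_sub, sub_mul, add_mul, cos_sub, cos_sub, sin_sub, sin_add, cos_add]
    ring
  have hi : ∀ f : ℝ → ℝ, Continuous f → IntervalIntegrable f volume (-π) π :=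
    fun f hf => hf.intervalIntegrable _ _
  simp_rw [e]
  rw [intervalIntegral.integral_add (hi _ (by fun_prop)) (hi _ (by fun_prop)),
    intervalIntegral.integral_add (hi _ (by fun_prop)) (hi _ (by fun_prop)),
    intervalIntegral.integral_sub (hi _ (by fun_prop)) (hi _ (by fun_prop))]
  simp only [intervalIntegral.integral_const_mul, integral_cos_int_mul, integral_sin_int_mul]
  -- Here n ≥ 1 excludes a resonance of the sum frequency; only k = n survives.
  have h1 : ((k : ℤ) + n) ≠ 0 := by omega
  have h2 : ((k : ℤ) - n = 0) ↔ k = n := by omega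
  simp only [h1, h2, if_false]
  split_ifs <;> ring

/-- The conjugate Poisson kernel is the sum of ρ^k sin(kφ), dominated by a geometric series, and
orthogonality selects the term k = n. -/
lemma integral_poisson_sin {ρ : ℝ} (h0 : 0 ≤ ρ) (h1 : ρ < 1) {n : ℕ} (hn : 1 ≤ n) (Θ : ℝ) :
    ∫ φ in (-π)..π, ρ * sin φ / (1 - 2 * ρ * cos φ + ρ ^ 2) * cos (n * (Θ - φ))
      = π * ρ ^ n * sin (n * Θ) := by
  have h : HasSum (fun k : ℕ => ∫ φ in (-π)..π, ρ ^ k * (sin (k * φ) * cos (n * (Θ - φ))))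
      (∫ φ in (-π)..π, ρ * sin φ / (1 - 2 * ρ * cos φ + ρ ^ 2) * cos (n * (Θ - φ))) := by
    apply intervalIntegral.hasSum_integral_of_dominated_convergence (fun k _ => ρ ^ k)
    · intro k
      exact (by fun_prop : Continuous fun φ : ℝ =>
        ρ ^ k * (sin (k * φ) * cos (n * (Θ - φ)))).aestronglyMeasurable
    · intro k
      refine Filter.Eventually.of_forall fun φ _ => ?_
      rw [norm_mul, norm_mul, Real.norm_of_nonneg (pow_nonneg h0 k)]
      have a1 := abs_sin_le_one (k * φ)
      have a2 := abs_cos_le_one (n * (Θ - φ))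
      calc ρ ^ k * (‖sin (k * φ)‖ * ‖cos (n * (Θ - φ))‖) ≤ ρ ^ k * (1 * 1) := by
            gcongr <;> assumption
        _ = ρ ^ k := by ring
    · exact Filter.Eventually.of_forall fun φ _ => summable_geometric_of_lt_one h0 h1
    · exact intervalIntegrable_const
    · refine Filter.Eventually.of_forall fun φ _ => ?_
      have := (hasSum_geometric_cis h0 h1 φ).2.mul_right (cos (n * (Θ - φ)))
      simpa only [mul_assoc] using this
  simp only [intervalIntegral.integral_const_mul, integral_sin_mul_cos_sub _ _ hn] at h
  have h' := hasSum_single (f := fun k : ℕ => ρ ^ k * if k = n then π * sin (n * Θ) else 0) n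
    (fun k hk => by simp [hk])
  rw [h.unique h']
  simp
  ring

lemma integral_poisson_cos {ρ : ℝ} (h0 : 0 ≤ ρ) (h1 : ρ < 1) :
    ∫ φ in (-π)..π, (1 - ρ * cos φ) / (1 - 2 * ρ * cos φ + ρ ^ 2) = 2 * π := by
  have h : HasSum (fun k : ℕ => ∫ φ in (-π)..π, ρ ^ k * cos (k * φ))
      (∫ φ in (-π)..π, (1 - ρ * cos φ) / (1 - 2 * ρ * cos φ + ρ ^ 2)) := by
    apply intervalIntegral.hasSum_integral_of_dominated_convergence (fun k _ => ρ ^ k)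
    · intro k
      exact (by fun_prop : Continuous fun φ : ℝ => ρ ^ k * cos (k * φ)).aestronglyMeasurable
    · intro k
      refine Filter.Eventually.of_forall fun φ _ => ?_
      rw [norm_mul, Real.norm_of_nonneg (pow_nonneg h0 k)]
      exact mul_le_of_le_one_right (pow_nonneg h0 k) (abs_cos_le_one _)
    · exact Filter.Eventually.of_forall fun φ _ => summable_geometric_of_lt_one h0 h1
    · exact intervalIntegrable_const
    · exact Filter.Eventually.of_forall fun φ _ => (hasSum_geometric_cis h0 h1 φ).1
  have e : ∀ k : ℕ, ∫ φ in (-π)..π, ρ ^ k * cos (k * φ) = ρ ^ k * if k = 0 then 2 * π else 0 := by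
    intro k
    rw [intervalIntegral.integral_const_mul]
    have := integral_cos_int_mul k
    simpa using congrArg (ρ ^ k * ·) this
  simp only [e] at h
  have h' := hasSum_single (f := fun k : ℕ => ρ ^ k * if k = 0 then 2 * π else 0) 0
    (fun k hk => by simp [hk])
  rw [h.unique h']
  simp

/-- The squared distance of two points with radii `r`, `s` and angle `φ` between them. -/
noncomputable def sqDist (r s φ : ℝ) : ℝ := r ^ 2 + s ^ 2 - 2 * r * s * cos φ

lemma sqDist_of_lt {r s : ℝ} (hr : 0 < r) (φ : ℝ) :
    sqDist r s φ = r ^ 2 * (1 - 2 * (s / r) * cos φ + (s / r) ^ 2) := by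
  unfold sqDist
  field_simp
  ring

lemma sqDist_comm (r s φ : ℝ) : sqDist r s φ = sqDist s r φ := by
  unfold sqDist
  ring

lemma radialIntegrand_eq (f : ℝ → ℝ → ℝ) (r θ s β : ℝ) :
    radialIntegrand f r θ (s, β) = -(s * sin (θ - β)) / sqDist r s (θ - β) * f s β * s := by
  unfold radialIntegrand biotSavart₁ biotSavart₂ sqDist
  simp only
  rw [sin_sub]
  ring

lemma angularIntegrand_eq (f : ℝ → ℝ → ℝ) (r θ s β : ℝ) :
    angularIntegrand f r θ (s, β) = (r - s * cos (θ - β)) / sqDist r s (θ - β) * f s β * s := by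
  unfold angularIntegrand biotSavart₁ biotSavart₂ sqDist
  simp only
  have := sin_sq_add_cos_sq θ
  have e : r - s * cos (θ - β) = -sin θ * -(r * sin θ - s * sin β)
      + cos θ * (r * cos θ - s * cos β) := by
    rw [cos_sub]
    linear_combination (-r) * this
  rw [e]
  ring

/-- Scaling by the larger of the two radii gives the conjugate Poisson kernel with a ratio ρ < 1.
The two cases are the two branches of `kernelK`; this is the origin of that kernel. -/
lemma integral_sin_div_sqDist {r s : ℝ} (hr : 0 < r) (hs : 0 < s) (hrs : s ≠ r) {n : ℕ}
    (hn : 1 ≤ n) (Θ : ℝ) :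
    ∫ φ in (-π)..π, s * sin φ / sqDist r s φ * cos (n * (Θ - φ)) * s
      = 2 * π * kernelK n (r / s) * sin (n * Θ) := by
  rcases lt_or_gt_of_ne hrs with h | h
  · have hρ0 : 0 ≤ s / r := by positivity
    have hρ1 : s / r < 1 := (div_lt_one hr).2 h
    have e : ∀ φ, s * sin φ / sqDist r s φ * cos (n * (Θ - φ)) * s = (s / r) *
        (s / r * sin φ / (1 - 2 * (s / r) * cos φ + (s / r) ^ 2) * cos (n * (Θ - φ))) := by
      intro φ
      have := (poisson_den_pos hρ0 hρ1 φ).ne'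
      rw [sqDist_of_lt hr]
      generalize 1 - 2 * (s / r) * cos φ + (s / r) ^ 2 = X at *
      field_simp
    simp_rw [e]
    rw [intervalIntegral.integral_const_mul, integral_poisson_sin hρ0 hρ1 hn, kernelK,
      if_neg (by rw [not_le]; exact (one_lt_div hs).2 h), div_pow, div_pow, pow_succ,
      pow_succ]
    field_simp
  · have hρ0 : 0 ≤ r / s := by positivity
    have hρ1 : r / s < 1 := (div_lt_one hs).2 h
    have e : ∀ φ, s * sin φ / sqDist r s φ * cos (n * (Θ - φ)) * s = (s / r) *
        (r / s * sin φ / (1 - 2 * (r / s) * cos φ + (r / s) ^ 2) * cos (n * (Θ - φ))) := by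
      intro φ
      have := (poisson_den_pos hρ0 hρ1 φ).ne'
      rw [sqDist_comm, sqDist_of_lt hs]
      generalize 1 - 2 * (r / s) * cos φ + (r / s) ^ 2 = X at *
      field_simp
    simp_rw [e]
    rw [intervalIntegral.integral_const_mul, integral_poisson_sin hρ0 hρ1 hn, kernelK,
      if_pos hρ1.le]
    obtain ⟨m, rfl⟩ : ∃ m, n = m + 1 := ⟨n - 1, by omega⟩
    rw [Nat.add_sub_cancel, pow_succ]
    field_simp

/-- Newton's shell theorem in the plane: a uniform circle acts on the exterior as if it were
concentrated at its centre, and not at all on its interior. -/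
lemma integral_sub_cos_div_sqDist {r s : ℝ} (hr : 0 < r) (hs : 0 < s) (hrs : s ≠ r) :
    ∫ φ in (-π)..π, (r - s * cos φ) / sqDist r s φ = if s < r then 2 * π / r else 0 := by
  rcases lt_or_gt_of_ne hrs with h | h
  · have hρ0 : 0 ≤ s / r := by positivity
    have hρ1 : s / r < 1 := (div_lt_one hr).2 h
    have e : ∀ φ, (r - s * cos φ) / sqDist r s φ = (1 / r) *
        ((1 - (s / r) * cos φ) / (1 - 2 * (s / r) * cos φ + (s / r) ^ 2)) := by
      intro φ
      have := (poisson_den_pos hρ0 hρ1 φ).ne'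
      rw [sqDist_of_lt hr]
      generalize 1 - 2 * (s / r) * cos φ + (s / r) ^ 2 = X at *
      field_simp
    simp_rw [e]
    rw [intervalIntegral.integral_const_mul, integral_poisson_cos hρ0 hρ1, if_pos h]
    ring
  · have hρ0 : 0 ≤ r / s := by positivity
    have hρ1 : r / s < 1 := (div_lt_one hs).2 h
    have e : ∀ φ, (r - s * cos φ) / sqDist r s φ = (1 / r) *
        (1 - (1 - (r / s) * cos φ) / (1 - 2 * (r / s) * cos φ + (r / s) ^ 2)) := by
      intro φ
      have h0 := (poisson_den_pos hρ0 hρ1 φ).ne'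
      have h1 : r - s * cos φ = (s ^ 2 / r) * ((1 - 2 * (r / s) * cos φ + (r / s) ^ 2)
          - (1 - (r / s) * cos φ)) := by
        field_simp
        ring
      rw [sqDist_comm, sqDist_of_lt hs, h1]
      generalize 1 - 2 * (r / s) * cos φ + (r / s) ^ 2 = X at *
      generalize 1 - r / s * cos φ = Y at *
      field_simp
    have hc : Continuous fun φ => (1 - (r / s) * cos φ) / (1 - 2 * (r / s) * cos φ + (r / s) ^ 2) :=
      Continuous.div (by fun_prop) (by fun_prop) fun φ => (poisson_den_pos hρ0 hρ1 φ).ne'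
    simp_rw [e]
    rw [intervalIntegral.integral_const_mul, intervalIntegral.integral_sub intervalIntegrable_const
      (hc.intervalIntegrable _ _), integral_poisson_cos hρ0 hρ1, if_neg (by linarith)]
    simp
    right
    ring

/-! ### Absolute convergence of the Biot–Savart integrals -/

lemma intervalIntegrable_abs_rpow (a b : ℝ) :
    IntervalIntegrable (fun x : ℝ => |x| ^ (-(1 / 2) : ℝ)) volume a b := by
  have h : ∀ b : ℝ, 0 ≤ b → IntervalIntegrable (fun x : ℝ => |x| ^ (-(1 / 2) : ℝ)) volume 0 b := by
    intro b hb
    apply (intervalIntegral.intervalIntegrable_rpow' (by norm_num : (-1 : ℝ) < -(1 / 2))).congr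
    intro x hx
    rw [uIoc_of_le hb] at hx
    simp only [abs_of_pos hx.1]
  have h' : ∀ b : ℝ, IntervalIntegrable (fun x : ℝ => |x| ^ (-(1 / 2) : ℝ)) volume 0 b := by
    intro b
    rcases le_total 0 b with hb | hb
    · exact h b hb
    · rw [IntervalIntegrable.iff_comp_neg]
      simpa using h (-b) (by linarith)
  exact (h' a).symm.trans (h' b)

/-- Periodicity moves the singularity to the centre of the interval, where Jordan's inequality
|sin(x/2)| ≥ |x|/π compares the function with |x|^(-1/2). -/
lemma integrableOn_abs_sin_rpow (θ : ℝ) :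
    IntegrableOn (fun β : ℝ => |sin ((θ - β) / 2)| ^ (-(1 / 2) : ℝ)) (Ioc (-π) π) := by
  have hper : Function.Periodic (fun β : ℝ => |sin ((θ - β) / 2)| ^ (-(1 / 2) : ℝ)) (2 * π) := by
    intro β
    have : (θ - (β + 2 * π)) / 2 = (θ - β) / 2 - π := by ring
    simp only [this, sin_sub_pi, abs_neg]
  have hi : IntervalIntegrable (fun β : ℝ => |sin ((θ - β) / 2)| ^ (-(1 / 2) : ℝ)) volume
      (θ - π) (θ - π + 2 * π) := by
    have h1 : IntervalIntegrable (fun x : ℝ => |sin (x / 2)| ^ (-(1 / 2) : ℝ)) volume (-π) π := by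
      apply ((intervalIntegrable_abs_rpow (-π) π).const_mul (π ^ (1 / 2 : ℝ))).mono_fun
      · exact (by fun_prop : Measurable fun x : ℝ =>
          |sin (x / 2)| ^ (-(1 / 2) : ℝ)).aestronglyMeasurable
      · rw [uIoc_of_le (by linarith [pi_pos])]
        filter_upwards [ae_restrict_mem measurableSet_Ioc] with x hx
        rw [Real.norm_of_nonneg (by positivity), Real.norm_of_nonneg (by positivity)]
        rcases eq_or_ne x 0 with rfl | hx0
        · norm_num
        have hle : |x| / π ≤ |sin (x / 2)| := by
          have h2 : |x / 2| ≤ π / 2 := by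
            rw [abs_le]; constructor <;> linarith [hx.1, hx.2]
          have := mul_abs_le_abs_sin h2
          rw [abs_div, abs_two] at this
          calc |x| / π = 2 / π * (|x| / 2) := by ring
            _ ≤ _ := this
        have hpos : 0 < |x| / π := by positivity
        calc |sin (x / 2)| ^ (-(1 / 2) : ℝ) ≤ (|x| / π) ^ (-(1 / 2) : ℝ) :=
              rpow_le_rpow_of_nonpos hpos hle (by norm_num)
          _ = π ^ (1 / 2 : ℝ) * |x| ^ (-(1 / 2) : ℝ) := by
              rw [div_rpow (abs_nonneg _) pi_pos.le, rpow_neg pi_pos.le]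
              field_simp
    have h2 := h1.comp_sub_left θ
    simp only [sub_neg_eq_add] at h2
    convert h2.symm using 1
    ring
  have := hper.intervalIntegrable (by linarith [pi_pos]) hi (-π) π
  rwa [intervalIntegrable_iff_integrableOn_Ioc_of_le (by linarith [pi_pos])] at this

/-- The exponent 3/4 is the Jacobian s times the factor s^(-1/4) that comes out of √(rs)^(-1/2). Up
to 2r the singularity at s = r is integrable; beyond 2r one has |r - s| ≥ s/2 and the tail decays
like s^(-7/4). -/
lemma integrableOn_radial_weight {r : ℝ} (hr : 0 < r) :
    IntegrableOn (fun s : ℝ => |r - s| ^ (-(1 / 2) : ℝ) * s ^ (3 / 4 : ℝ) * (1 + s ^ 2)⁻¹) (Ioi 0) := by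
  have hm : Measurable fun s : ℝ => |r - s| ^ (-(1 / 2) : ℝ) * s ^ (3 / 4 : ℝ) * (1 + s ^ 2)⁻¹ := by
    fun_prop
  have hle : ∀ s : ℝ, 0 < s → s ^ (3 / 4 : ℝ) * (1 + s ^ 2)⁻¹ ≤ 1 := by
    intro s hs
    rw [mul_inv_le_iff₀ (by positivity), one_mul]
    rcases le_total s 1 with h | h
    · have := rpow_le_one hs.le h (by norm_num : (0 : ℝ) ≤ 3 / 4)
      nlinarith [sq_nonneg s]
    · have : s ^ (3 / 4 : ℝ) ≤ s ^ (2 : ℝ) := rpow_le_rpow_of_exponent_le h (by norm_num)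
      rw [rpow_two] at this
      linarith
  rw [← Ioc_union_Ioi_eq_Ioi (by linarith : 0 ≤ 2 * r)]
  apply IntegrableOn.union
  · have h1 := (intervalIntegrable_abs_rpow r (-r)).comp_sub_left r
    rw [sub_self, sub_neg_eq_add, ← two_mul,
      intervalIntegrable_iff_integrableOn_Ioc_of_le (by linarith)] at h1
    apply Integrable.mono' h1 hm.aestronglyMeasurable
    filter_upwards [ae_restrict_mem measurableSet_Ioc] with s hs
    have h0 : 0 < s := hs.1
    rw [Real.norm_of_nonneg (by positivity), mul_assoc]
    exact mul_le_of_le_one_right (by positivity) (hle s hs.1)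
  · have h2 := (integrableOn_Ioi_rpow_of_lt (by norm_num : (-(7 / 4) : ℝ) < -1)
      (by linarith : 0 < 2 * r)).const_mul ((1 / 2 : ℝ) ^ (-(1 / 2) : ℝ))
    apply Integrable.mono' h2 hm.aestronglyMeasurable
    filter_upwards [ae_restrict_mem measurableSet_Ioi] with s hs
    have hs : 2 * r < s := hs
    have h0 : 0 < s := by linarith
    rw [Real.norm_of_nonneg (by positivity)]
    have e1 : |r - s| ^ (-(1 / 2) : ℝ) ≤ (1 / 2 * s) ^ (-(1 / 2) : ℝ) := by
      apply rpow_le_rpow_of_nonpos (by linarith) _ (by norm_num)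
      rw [abs_of_neg (by linarith)]
      linarith
    have e2 : (1 + s ^ 2)⁻¹ ≤ s ^ (-2 : ℝ) := by
      rw [rpow_neg h0.le, rpow_two]
      gcongr
      linarith
    calc |r - s| ^ (-(1 / 2) : ℝ) * s ^ (3 / 4 : ℝ) * (1 + s ^ 2)⁻¹
        ≤ (1 / 2 * s) ^ (-(1 / 2) : ℝ) * s ^ (3 / 4 : ℝ) * s ^ (-2 : ℝ) := by gcongr
      _ = (1 / 2 : ℝ) ^ (-(1 / 2) : ℝ) * s ^ (-(7 / 4) : ℝ) := by
          rw [mul_rpow (by norm_num) h0.le, mul_assoc, mul_assoc, ← rpow_add h0, ← rpow_add h0]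
          norm_num

/-- The squared distance is (r - s)² + 4rs sin²(φ/2), and the arithmetic-geometric mean inequality
turns this sum into a product of a function of s and a function of φ. -/
lemma sqDist_ge {r s : ℝ} (hr : 0 < r) (hs : 0 < s) (φ : ℝ) :
    4 * (|r - s| * √(r * s) * |sin (φ / 2)|) ≤ sqDist r s φ := by
  have hc : cos φ = 1 - 2 * sin (φ / 2) ^ 2 := by
    have := cos_two_mul (φ / 2)
    rw [mul_div_cancel₀ φ two_ne_zero] at this
    nlinarith [sin_sq_add_cos_sq (φ / 2)]
  have h1 : √(r * s) ^ 2 = r * s := sq_sqrt (by positivity)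
  have h2 : |r - s| ^ 2 = (r - s) ^ 2 := sq_abs _
  have h3 : |sin (φ / 2)| ^ 2 = sin (φ / 2) ^ 2 := sq_abs _
  unfold sqDist
  rw [hc, ← h3]
  nlinarith [sq_nonneg (|r - s| - 2 * (√(r * s) * |sin (φ / 2)|)),
    mul_pow (√(r * s)) |sin (φ / 2)| 2]

/-- Since |x| is at most the distance, the quotient is at most the inverse distance, and the product
bound of `sqDist_ge` splits it into one-dimensional singularities of exponent -1/2. Absolute
convergence over the plane is thereby reduced to two integrals in one variable. -/
lemma abs_div_sqDist_le {r s φ x : ℝ} (hr : 0 < r) (hs : 0 < s) (hrs : s ≠ r)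
    (hφ : sin (φ / 2) ≠ 0) (hx : x ^ 2 ≤ sqDist r s φ) :
    |x / sqDist r s φ| ≤ r ^ (-(1 / 4) : ℝ) *
      (|r - s| ^ (-(1 / 2) : ℝ) * s ^ (-(1 / 4) : ℝ) * |sin (φ / 2)| ^ (-(1 / 2) : ℝ)) := by
  have hE := sqDist_ge hr hs φ
  have h1 : 0 < |r - s| := abs_pos.2 (sub_ne_zero.2 hrs.symm)
  have h2 : 0 < |sin (φ / 2)| := abs_pos.2 hφ
  set E := |r - s| * √(r * s) * |sin (φ / 2)| with hEdef
  have hEpos : 0 < E := by positivity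
  have hD : 0 < sqDist r s φ := by linarith
  have e1 : |x / sqDist r s φ| ≤ E ^ (-(1 / 2) : ℝ) := by
    rw [abs_div, abs_of_pos hD, rpow_neg hEpos.le, ← sqrt_eq_rpow, div_le_iff₀ hD]
    have h3 : |x| ≤ √(sqDist r s φ) := abs_le_sqrt hx
    have h4 : √E ≤ √(sqDist r s φ) := sqrt_le_sqrt (by linarith)
    have h5 : √(sqDist r s φ) * √(sqDist r s φ) = sqDist r s φ := mul_self_sqrt hD.le
    have h6 : 0 < √E := sqrt_pos.2 hEpos
    rw [inv_mul_eq_div, le_div_iff₀ h6]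
    calc |x| * √E ≤ √(sqDist r s φ) * √(sqDist r s φ) := by gcongr
      _ = _ := h5
  refine e1.trans (le_of_eq ?_)
  rw [hEdef, mul_rpow (by positivity) (by positivity), mul_rpow (by positivity) (by positivity),
    sqrt_eq_rpow, ← rpow_mul (by positivity), mul_rpow hr.le hs.le]
  norm_num
  ring

lemma restrict_polarDomain : (volume : Measure (ℝ × ℝ)).restrict polarDomain
    = (volume.restrict (Ioi (0 : ℝ))).prod (volume.restrict (Ioc (-π) π)) := by
  rw [polarDomain, Measure.prod_restrict, Measure.volume_eq_prod]

lemma ae_polarDomain (r θ : ℝ) : ∀ᵐ p ∂((volume : Measure (ℝ × ℝ)).restrict polarDomain),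
    0 < p.1 ∧ p.1 ≠ r ∧ sin ((θ - p.2) / 2) ≠ 0 := by
  have h1 : ∀ᵐ p ∂((volume : Measure (ℝ × ℝ)).restrict polarDomain), p.1 ≠ r := by
    rw [restrict_polarDomain]
    exact Measure.quasiMeasurePreserving_fst.ae (Measure.ae_ne _ r)
  have h2 : ∀ᵐ p ∂((volume : Measure (ℝ × ℝ)).restrict polarDomain),
      sin ((θ - p.2) / 2) ≠ 0 := by
    rw [restrict_polarDomain]
    apply Measure.quasiMeasurePreserving_snd.ae (p := fun β : ℝ => sin ((θ - β) / 2) ≠ 0)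
    apply ae_restrict_of_ae
    have hc : {β : ℝ | sin ((θ - β) / 2) = 0}.Countable := by
      have : {β : ℝ | sin ((θ - β) / 2) = 0} ⊆ range fun k : ℤ => θ - 2 * (k * π) := by
        intro β hβ
        obtain ⟨k, hk⟩ := sin_eq_zero_iff.1 hβ
        exact ⟨k, by simp only [hk]; ring⟩
      exact (countable_range _).mono this
    filter_upwards [hc.ae_notMem volume] with β hβ using hβ
  filter_upwards [h1, h2, ae_restrict_mem (measurableSet_Ioi.prod measurableSet_Ioc)] with p a b c
  exact ⟨c.1, a, b⟩

lemma integrableOn_kernel_mul {r : ℝ} (hr : 0 < r) (θ C : ℝ) {f : ℝ → ℝ → ℝ}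
    (hf : Measurable fun p : ℝ × ℝ => f p.1 p.2)
    (hfb : ∀ s β, 0 < s → |f s β| ≤ C * (1 + s ^ 2)⁻¹) {x : ℝ × ℝ → ℝ} (hx : Measurable x)
    (hxb : ∀ p : ℝ × ℝ, x p ^ 2 ≤ sqDist r p.1 (θ - p.2)) :
    IntegrableOn (fun p : ℝ × ℝ => x p / sqDist r p.1 (θ - p.2) * f p.1 p.2 * p.1) polarDomain := by
  have hi := ((integrableOn_radial_weight hr).mul_prod (integrableOn_abs_sin_rpow θ)).const_mul
    (r ^ (-(1 / 4) : ℝ) * C)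
  rw [← restrict_polarDomain] at hi
  apply Integrable.mono' hi
  · have : Measurable fun p : ℝ × ℝ => sqDist r p.1 (θ - p.2) := by
      unfold sqDist
      fun_prop
    exact (((hx.div this).mul hf).mul measurable_fst).aestronglyMeasurable
  · filter_upwards [ae_polarDomain r θ] with p ⟨h1, h2, h3⟩
    have hs : p.1 * p.1 ^ (-(1 / 4) : ℝ) = p.1 ^ (3 / 4 : ℝ) := by
      nth_rewrite 1 [← rpow_one p.1]
      rw [← rpow_add h1]
      norm_num
    rw [norm_mul, norm_mul, Real.norm_eq_abs, Real.norm_eq_abs, Real.norm_eq_abs, abs_of_pos h1,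
      ← hs]
    have a1 := abs_div_sqDist_le hr h1 h2 h3 (hxb p)
    have a2 := hfb p.1 p.2 h1
    calc _ ≤ (r ^ (-(1 / 4) : ℝ) * (|r - p.1| ^ (-(1 / 2) : ℝ) * p.1 ^ (-(1 / 4) : ℝ)
          * |sin ((θ - p.2) / 2)| ^ (-(1 / 2) : ℝ))) * (C * (1 + p.1 ^ 2)⁻¹) * p.1 := by
            gcongr
      _ = _ := by ring

lemma integrableOn_radialIntegrand {r : ℝ} (hr : 0 < r) (θ C : ℝ) {f : ℝ → ℝ → ℝ}
    (hf : Measurable fun p : ℝ × ℝ => f p.1 p.2)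
    (hfb : ∀ s β, 0 < s → |f s β| ≤ C * (1 + s ^ 2)⁻¹) :
    IntegrableOn (radialIntegrand f r θ) polarDomain := by
  have := integrableOn_kernel_mul hr θ C hf hfb (x := fun p => -(p.1 * sin (θ - p.2)))
    (by fun_prop) (fun p => by
      unfold sqDist
      nlinarith [sin_sq_add_cos_sq (θ - p.2), sq_nonneg (r - p.1 * cos (θ - p.2))])
  convert this using 2 with p
  exact radialIntegrand_eq f r θ p.1 p.2

lemma integrableOn_angularIntegrand {r : ℝ} (hr : 0 < r) (θ C : ℝ) {f : ℝ → ℝ → ℝ}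
    (hf : Measurable fun p : ℝ × ℝ => f p.1 p.2)
    (hfb : ∀ s β, 0 < s → |f s β| ≤ C * (1 + s ^ 2)⁻¹) :
    IntegrableOn (angularIntegrand f r θ) polarDomain := by
  have := integrableOn_kernel_mul hr θ C hf hfb (x := fun p => r - p.1 * cos (θ - p.2))
    (by fun_prop) (fun p => by
      unfold sqDist
      nlinarith [sin_sq_add_cos_sq (θ - p.2), sq_nonneg (p.1 * sin (θ - p.2))])
  convert this using 2 with p
  exact angularIntegrand_eq f r θ p.1 p.2

/-! ### The velocity of a Fourier mode and of a radial vorticity -/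

lemma integral_comp_sub_of_periodic {F : ℝ → ℝ} (hF : Function.Periodic F (2 * π)) (θ : ℝ) :
    ∫ β in Ioc (-π) π, F (θ - β) = ∫ φ in (-π)..π, F φ := by
  rw [← intervalIntegral.integral_of_le (by linarith [pi_pos]),
    intervalIntegral.integral_comp_sub_left (fun x => F x) θ]
  have h1 := hF.intervalIntegral_add_eq (θ - π) (-π)
  rw [show θ - π + 2 * π = θ - -π by ring, show -π + 2 * π = π by ring] at h1
  exact h1

lemma velR_fourier_mode {r : ℝ} (hr : 0 < r) (θ τ C : ℝ) {n : ℕ} (hn : 1 ≤ n) {g : ℝ → ℝ}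
    (hg : Measurable g) (hgb : ∀ s, 0 < s → |g s| ≤ C * (1 + s ^ 2)⁻¹) :
    velR (fun s β => g s * cos (n * (β - τ))) r θ
      = -(sin (n * (θ - τ)) * ∫ s in Ioi (0 : ℝ), g s * kernelK n (r / s)) := by
  have hC : ∀ s β : ℝ, 0 < s → |g s * cos (n * (β - τ))| ≤ C * (1 + s ^ 2)⁻¹ := by
    intro s β hs
    rw [abs_mul]
    exact (mul_le_of_le_one_right (abs_nonneg _) (abs_cos_le_one _)).trans (hgb s hs)
  have hi := integrableOn_radialIntegrand hr θ C (f := fun s β => g s * cos (n * (β - τ)))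
    (by fun_prop) hC
  unfold velR
  rw [IntegrableOn, restrict_polarDomain] at hi
  rw [restrict_polarDomain, integral_prod _ hi]
  have e : ∀ᵐ s ∂(volume.restrict (Ioi (0 : ℝ))),
      ∫ β in Ioc (-π) π, radialIntegrand (fun s β => g s * cos (n * (β - τ))) r θ (s, β)
        = (-(2 * π * sin (n * (θ - τ)))) * (g s * kernelK n (r / s)) := by
    filter_upwards [ae_restrict_mem measurableSet_Ioi, Measure.ae_ne _ r] with s hs hsr
    have hs : 0 < s := hs
    set F : ℝ → ℝ := fun φ => s * sin φ / sqDist r s φ * cos (n * (θ - τ - φ)) * s with hF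
    have hper : Function.Periodic F (2 * π) := by
      intro φ
      have : (n : ℝ) * (θ - τ - (φ + 2 * π)) = n * (θ - τ - φ) - n * (2 * π) := by ring
      simp only [hF, sqDist, sin_add_two_pi, cos_add_two_pi, this, cos_sub_nat_mul_two_pi]
    have h1 := integral_comp_sub_of_periodic hper θ
    rw [hF, integral_sin_div_sqDist hr hs hsr hn] at h1
    calc _ = ∫ β in Ioc (-π) π, (-g s) * (s * sin (θ - β) / sqDist r s (θ - β)
            * cos (n * (θ - τ - (θ - β))) * s) := by
          congr 1
          ext β
          rw [radialIntegrand_eq, show θ - τ - (θ - β) = β - τ by ring]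
          ring
      _ = _ := by
          rw [integral_const_mul, h1]
          ring
  rw [integral_congr_ae e, integral_const_mul]
  field_simp

lemma velθ_radial {r : ℝ} (hr : 0 < r) (θ C : ℝ) {g : ℝ → ℝ}
    (hg : Measurable g) (hgb : ∀ s, 0 < s → |g s| ≤ C * (1 + s ^ 2)⁻¹) :
    velθ (fun s _ => g s) r θ = (∫ s in (0 : ℝ)..r, s * g s) / r := by
  have hi := integrableOn_angularIntegrand hr θ C (f := fun s _ => g s)
    (by fun_prop) (fun s _ hs => hgb s hs)
  unfold velθ
  rw [IntegrableOn, restrict_polarDomain] at hi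
  rw [restrict_polarDomain, integral_prod _ hi]
  have e : ∀ᵐ s ∂(volume.restrict (Ioi (0 : ℝ))),
      ∫ β in Ioc (-π) π, angularIntegrand (fun s _ => g s) r θ (s, β)
        = (2 * π / r) * (Iio r).indicator (fun s => s * g s) s := by
    filter_upwards [ae_restrict_mem measurableSet_Ioi, Measure.ae_ne _ r] with s hs hsr
    have hs : 0 < s := hs
    set F : ℝ → ℝ := fun φ => (r - s * cos φ) / sqDist r s φ with hF
    have hper : Function.Periodic F (2 * π) := by
      intro φ
      simp only [hF, sqDist, cos_add_two_pi]
    have h1 := integral_comp_sub_of_periodic hper θ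
    rw [hF, integral_sub_cos_div_sqDist hr hs hsr] at h1
    calc _ = ∫ β in Ioc (-π) π, (s * g s) * ((r - s * cos (θ - β)) / sqDist r s (θ - β)) := by
          congr 1
          ext β
          rw [angularIntegrand_eq]
          ring
      _ = _ := by
          rw [integral_const_mul, h1]
          by_cases h : s < r
          · rw [if_pos h, indicator_of_mem (by exact h)]
            ring
          · rw [if_neg h, indicator_of_notMem (by exact h)]
            ring
  rw [integral_congr_ae e, integral_const_mul, setIntegral_indicator measurableSet_Iio,
    Ioi_inter_Iio, intervalIntegral.integral_of_le hr.le, integral_Ioc_eq_integral_Ioo]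
  field_simp

/-! ### A singular Volterra equation -/

/-- The kernel of the Volterra equation. -/
noncomputable def volterraKernel (n : ℕ) (τ t : ℝ) : ℝ := (1 - (t / max τ t) ^ n) / (2 * n)

/-- Bernoulli's inequality. The bound is uniform in n and vanishes at t = 1, which compensates a
weight of size 1/(1 - t). -/
lemma one_sub_pow_div_le {n : ℕ} (hn : 1 ≤ n) {t : ℝ} (ht : 0 ≤ t) :
    (1 - t ^ n) / (2 * n) ≤ (1 - t) / 2 := by
  have h := one_add_mul_le_pow (by linarith : (-2 : ℝ) ≤ t - 1) n
  rw [add_sub_cancel] at h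
  have hn' : (0 : ℝ) < n := by exact_mod_cast hn
  rw [div_le_div_iff₀ (by positivity) (by norm_num)]
  nlinarith

lemma one_sub_pow_div_nonneg (n : ℕ) {t : ℝ} (ht : 0 ≤ t) (ht1 : t ≤ 1) :
    0 ≤ (1 - t ^ n) / (2 * n) :=
  div_nonneg (sub_nonneg.2 (pow_le_one₀ ht ht1)) (by positivity)

lemma volterraKernel_nonneg (n : ℕ) (τ : ℝ) {t : ℝ} (ht : 0 < t) : 0 ≤ volterraKernel n τ t := by
  have h : 0 < max τ t := lt_max_of_lt_right ht
  exact one_sub_pow_div_nonneg n (by positivity) ((div_le_one h).2 (le_max_right _ _))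

lemma volterraKernel_le (n : ℕ) {τ t : ℝ} (hτ : τ ≤ 1) (ht : 0 < t) (ht1 : t ≤ 1) :
    volterraKernel n τ t ≤ (1 - t ^ n) / (2 * n) := by
  have h : 0 < max τ t := lt_max_of_lt_right ht
  unfold volterraKernel
  have : t ≤ t / max τ t := by
    rw [le_div_iff₀ h]
    exact mul_le_of_le_one_right ht.le (max_le hτ ht1)
  gcongr

lemma volterraKernel_one (n : ℕ) {t : ℝ} (ht1 : t ≤ 1) :
    volterraKernel n 1 t = (1 - t ^ n) / (2 * n) := by
  rw [volterraKernel, max_eq_left ht1, div_one]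

/-- For t ≤ τ the difference is (t/τ)^n (1 - τ^n)/(2n), to which Bernoulli's bound applies; for t ≥
τ the bound for the kernel at τ = 1 is enough. -/
lemma abs_volterraKernel_sub_le {n : ℕ} (hn : 1 ≤ n) {τ t : ℝ} (hτ : 0 ≤ τ) (hτ1 : τ ≤ 1)
    (ht : 0 < t) (ht1 : t ≤ 1) :
    |volterraKernel n 1 t - volterraKernel n τ t| ≤ min (1 - τ) (1 - t) / 2 := by
  have h0 := volterraKernel_le n hτ1 ht ht1
  rw [volterraKernel_one n ht1, abs_of_nonneg (by linarith)]
  have hn' : (0 : ℝ) < n := by exact_mod_cast hn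
  have h1 := volterraKernel_nonneg n τ ht
  have h2 := one_sub_pow_div_le hn ht.le
  rcases le_total t τ with h | h
  · rw [min_eq_left (by linarith), volterraKernel, max_eq_left h]
    have hτ' : 0 < τ := lt_of_lt_of_le ht h
    have e : (1 - t ^ n) / (2 * n) - (1 - (t / τ) ^ n) / (2 * n)
        = (t / τ) ^ n * ((1 - τ ^ n) / (2 * n)) := by
      rw [div_pow]
      field_simp
      ring
    rw [e]
    have h3 := one_sub_pow_div_le hn hτ
    have h4 := one_sub_pow_div_nonneg n hτ hτ1
    have h5 : (t / τ) ^ n ≤ 1 := pow_le_one₀ (by positivity) ((div_le_one hτ').2 h)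
    calc (t / τ) ^ n * ((1 - τ ^ n) / (2 * n)) ≤ 1 * ((1 - τ) / 2) := by gcongr
      _ = _ := one_mul _
  · rw [min_eq_right (by linarith)]
    linarith

lemma measurable_volterraKernel (n : ℕ) (τ : ℝ) : Measurable (volterraKernel n τ) := by
  unfold volterraKernel
  fun_prop

lemma continuous_volterraKernel (n : ℕ) {t : ℝ} (ht : 0 < t) :
    Continuous fun τ => volterraKernel n τ t := by
  unfold volterraKernel
  have : Continuous fun τ : ℝ => t / max τ t :=
    Continuous.div (by fun_prop) (by fun_prop) fun τ => (lt_max_of_lt_right ht).ne'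
  fun_prop

/-- Weights for which the Volterra operator is a contraction with constant `1/3`. -/
structure IsSmallWeight (n : ℕ) (v : ℝ → ℝ) : Prop where
  meas : Measurable v
  integrable : IntegrableOn (fun t => (1 - t) * |v t|) (Ioo 0 1)
  small : ∫ t in Ioo (0 : ℝ) 1, (1 - t ^ n) / (2 * n) * |v t| ≤ 1 / 3

/-- `Q` solves the Volterra equation with weight `v` and takes values in `[1/2, 3/2]`. -/
structure IsVolterraSol (n : ℕ) (v Q : ℝ → ℝ) : Prop where
  cont : Continuous Q
  abs_sub_one_le : ∀ τ ∈ Icc (0 : ℝ) 1, |Q τ - 1| ≤ 1 / 2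
  eq : ∀ τ ∈ Icc (0 : ℝ) 1, Q τ = 1 - ∫ t in Ioo (0 : ℝ) 1, volterraKernel n τ t * v t * Q t

variable {n : ℕ} {v v' Q Q' : ℝ → ℝ}

lemma integrableOn_one_sub_pow_mul (hn : 1 ≤ n) (hm : Measurable v)
    (hi : IntegrableOn (fun t => (1 - t) * |v t|) (Ioo 0 1)) :
    IntegrableOn (fun t => (1 - t ^ n) / (2 * n) * |v t|) (Ioo 0 1) := by
  apply Integrable.mono' hi (by fun_prop)
  filter_upwards [ae_restrict_mem measurableSet_Ioo] with t ht
  have h1 := one_sub_pow_div_nonneg n ht.1.le ht.2.le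
  have h2 := one_sub_pow_div_le hn ht.1.le
  rw [Real.norm_of_nonneg (by positivity)]
  have : (1 - t ^ n) / (2 * n) ≤ 1 - t := by linarith [ht.2]
  gcongr

lemma integrableOn_volterraKernel_mul (hn : 1 ≤ n) (hm : Measurable v)
    (hi : IntegrableOn (fun t => (1 - t) * |v t|) (Ioo 0 1)) (hQ : Measurable Q) {B τ : ℝ}
    (hτ : τ ≤ 1) (hB : ∀ t ∈ Ioo (0 : ℝ) 1, |Q t| ≤ B) :
    IntegrableOn (fun t => volterraKernel n τ t * v t * Q t) (Ioo 0 1) := by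
  apply Integrable.mono' (hi.mul_const B)
    (((measurable_volterraKernel n τ).mul hm).mul hQ).aestronglyMeasurable
  filter_upwards [ae_restrict_mem measurableSet_Ioo] with t ht
  have h0 := volterraKernel_nonneg n τ ht.1
  have h1 := volterraKernel_le n hτ ht.1 ht.2.le
  have h2 := one_sub_pow_div_le hn ht.1.le
  have h3 : volterraKernel n τ t ≤ 1 - t := by linarith [ht.2]
  have := hB t ht
  have h4 : 0 ≤ 1 - t := by linarith [ht.2]
  change ‖volterraKernel n τ t * v t * Q t‖ ≤ _
  rw [norm_mul, norm_mul, Real.norm_of_nonneg h0, Real.norm_eq_abs, Real.norm_eq_abs]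
  gcongr

/-- If `|F| ≤ B` then the Volterra operator maps `F` to a function bounded by
`B ∫ (1 - tⁿ)/(2 n) |v|`. -/
lemma abs_integral_volterraKernel_le (hn : 1 ≤ n) (hm : Measurable v)
    (hi : IntegrableOn (fun t => (1 - t) * |v t|) (Ioo 0 1)) {B τ : ℝ}
    (hτ : τ ≤ 1) (hB : ∀ t ∈ Ioo (0 : ℝ) 1, |Q t| ≤ B) :
    |∫ t in Ioo (0 : ℝ) 1, volterraKernel n τ t * v t * Q t|
      ≤ (∫ t in Ioo (0 : ℝ) 1, (1 - t ^ n) / (2 * n) * |v t|) * B := by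
  rw [← integral_mul_const, ← Real.norm_eq_abs]
  apply norm_integral_le_of_norm_le ((integrableOn_one_sub_pow_mul hn hm hi).mul_const B)
  filter_upwards [ae_restrict_mem measurableSet_Ioo] with t ht
  have h0 := volterraKernel_nonneg n τ ht.1
  have h1 := volterraKernel_le n hτ ht.1 ht.2.le
  rw [norm_mul, norm_mul, Real.norm_of_nonneg h0, Real.norm_eq_abs, Real.norm_eq_abs]
  have := hB t ht
  have h2 := h0.trans h1
  gcongr

open BoundedContinuousFunction in
/-- The affine Volterra map on bounded continuous functions. -/
noncomputable def volterraMap (hn : 1 ≤ n) (hv : IsSmallWeight n v) (Q : ℝ →ᵇ ℝ) : ℝ →ᵇ ℝ :=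
  BoundedContinuousFunction.ofNormedAddCommGroup
    -- The kernel bounds need τ ≤ 1, so τ is clamped there in order to act on functions on all of ℝ.
    -- Negative τ are harmless because the kernel vanishes for t ≥ τ.
    (fun τ => 1 - ∫ t in Ioo (0 : ℝ) 1, volterraKernel n (min τ 1) t * v t * Q t)
    (by
      apply continuous_const.sub
      apply continuous_of_dominated (bound := fun t => (1 - t) * |v t| * ‖Q‖)
      · intro τ
        exact (((measurable_volterraKernel n _).mul hv.meas).mul
          Q.continuous.measurable).aestronglyMeasurable
      · intro τ
        filter_upwards [ae_restrict_mem measurableSet_Ioo] with t ht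
        have h0 := volterraKernel_nonneg n (min τ 1) ht.1
        have h1 := volterraKernel_le n (min_le_right τ 1) ht.1 ht.2.le
        have h2 := one_sub_pow_div_le hn ht.1.le
        have h3 : volterraKernel n (min τ 1) t ≤ 1 - t := by linarith [ht.2]
        have h4 := h0.trans h3
        rw [norm_mul, norm_mul, Real.norm_of_nonneg h0, Real.norm_eq_abs]
        have := Q.norm_coe_le_norm t
        gcongr
      · exact hv.integrable.mul_const _
      · filter_upwards [ae_restrict_mem measurableSet_Ioo] with t ht
        exact (((continuous_volterraKernel n ht.1).comp (by fun_prop)).mul_const _).mul_const _)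
    (1 + 1 / 3 * ‖Q‖)
    (fun τ => by
      have h := abs_integral_volterraKernel_le hn hv.meas hv.integrable (min_le_right τ 1)
        (fun t _ => Q.norm_coe_le_norm t)
      have h' := mul_le_mul_of_nonneg_right hv.small (norm_nonneg Q)
      refine (norm_sub_le _ _).trans ?_
      rw [norm_one, Real.norm_eq_abs]
      linarith)

lemma volterraMap_apply (hn : 1 ≤ n) (hv : IsSmallWeight n v)
    (Q : BoundedContinuousFunction ℝ ℝ) (τ : ℝ) : volterraMap hn hv Q τ
      = 1 - ∫ t in Ioo (0 : ℝ) 1, volterraKernel n (min τ 1) t * v t * Q t := rfl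

lemma contractingWith_volterraMap (hn : 1 ≤ n) (hv : IsSmallWeight n v) :
    ContractingWith (1 / 3) (volterraMap hn hv) := by
  refine ⟨by rw [← NNReal.coe_lt_coe]; norm_num, LipschitzWith.of_dist_le_mul fun Q Q' => ?_⟩
  rw [BoundedContinuousFunction.dist_le (by positivity)]
  intro τ
  have hb : ∀ Q : BoundedContinuousFunction ℝ ℝ, IntegrableOn
      (fun t => volterraKernel n (min τ 1) t * v t * Q t) (Ioo 0 1) := fun Q =>
    integrableOn_volterraKernel_mul hn hv.meas hv.integrable Q.continuous.measurable
      (min_le_right τ 1) (fun t _ => Q.norm_coe_le_norm t)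
  have h := abs_integral_volterraKernel_le (Q := fun t => Q' t - Q t) (B := dist Q Q') hn
    hv.meas hv.integrable
    (min_le_right τ 1) (fun t _ => by
      rw [abs_sub_comm]
      exact BoundedContinuousFunction.dist_coe_le_dist (f := Q) (g := Q') t)
  rw [volterraMap_apply, volterraMap_apply, Real.dist_eq, sub_sub_sub_cancel_left,
    ← integral_sub (hb Q') (hb Q)]
  simp_rw [← mul_sub]
  refine h.trans ?_
  have := mul_le_mul_of_nonneg_right hv.small (dist_nonneg : 0 ≤ dist Q Q')
  simpa using this

/-- Banach's fixed point theorem with constant 1/3. The fixed point satisfies ‖Q‖ ≤ 1 + ‖Q‖/3, hence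
‖Q‖ ≤ 3/2 and |Q - 1| ≤ 1/2; in particular Q stays away from 0, so that dividing by Q(1) is safe. -/
theorem exists_isVolterraSol (hn : 1 ≤ n) (hv : IsSmallWeight n v) :
    ∃ Q, IsVolterraSol n v Q := by
  set Q := (contractingWith_volterraMap hn hv).fixedPoint _ with hQ
  have hfix : volterraMap hn hv Q = Q := (contractingWith_volterraMap hn hv).fixedPoint_isFixedPt
  have heq : ∀ τ, Q τ = 1 - ∫ t in Ioo (0 : ℝ) 1, volterraKernel n (min τ 1) t * v t * Q t := by
    intro τ
    conv_lhs => rw [← hfix]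
    rfl
  have hb : ∀ τ, |∫ t in Ioo (0 : ℝ) 1, volterraKernel n (min τ 1) t * v t * Q t| ≤ 1 / 3 * ‖Q‖ := by
    intro τ
    refine (abs_integral_volterraKernel_le hn hv.meas hv.integrable (min_le_right τ 1)
        (fun t _ => Q.norm_coe_le_norm t)).trans ?_
    exact mul_le_mul_of_nonneg_right hv.small (norm_nonneg Q)
  have hnorm : ‖Q‖ ≤ 1 + 1 / 3 * ‖Q‖ := by
    rw [BoundedContinuousFunction.norm_le (by positivity)]
    intro τ
    rw [heq τ]
    refine (norm_sub_le _ _).trans ?_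
    rw [norm_one, Real.norm_eq_abs]
    linarith [hb τ]
  refine ⟨Q, Q.continuous, fun τ _ => ?_, fun τ hτ => ?_⟩
  · rw [heq τ, sub_sub_cancel_left, abs_neg]
    linarith [hb τ]
  · have := heq τ
    rwa [min_eq_left hτ.2] at this

namespace IsVolterraSol

lemma abs_le (h : IsVolterraSol n v Q) {τ : ℝ} (hτ : τ ∈ Icc (0 : ℝ) 1) : |Q τ| ≤ 3 / 2 := by
  have := _root_.abs_le.1 (h.abs_sub_one_le τ hτ)
  rw [_root_.abs_le]
  constructor <;> linarith [this.1, this.2]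

lemma half_le (h : IsVolterraSol n v Q) {τ : ℝ} (hτ : τ ∈ Icc (0 : ℝ) 1) : 1 / 2 ≤ Q τ := by
  linarith [(_root_.abs_le.1 (h.abs_sub_one_le τ hτ)).1]

lemma half_le_one (h : IsVolterraSol n v Q) : 1 / 2 ≤ Q 1 := h.half_le ⟨zero_le_one, le_rfl⟩

lemma integrableOn_kernel (hn : 1 ≤ n) (hv : IsSmallWeight n v) (h : IsVolterraSol n v Q) {τ : ℝ}
    (hτ : τ ≤ 1) : IntegrableOn (fun t => volterraKernel n τ t * v t * Q t) (Ioo 0 1) :=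
  integrableOn_volterraKernel_mul hn hv.meas hv.integrable h.cont.measurable hτ
    fun _ ht => h.abs_le (Ioo_subset_Icc_self ht)

/-- The solution depends on the weight in a Lipschitz way. -/
theorem abs_sub_le (hn : 1 ≤ n) (hv : IsSmallWeight n v) (hv' : IsSmallWeight n v')
    (h : IsVolterraSol n v Q) (h' : IsVolterraSol n v' Q') {τ : ℝ} (hτ : τ ∈ Icc (0 : ℝ) 1) :
    |Q τ - Q' τ| ≤ 2 * ∫ t in Ioo (0 : ℝ) 1, (1 - t) * |v t - v' t| := by
  set E := ∫ t in Ioo (0 : ℝ) 1, (1 - t) * |v t - v' t| with hE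
  have hi : IntegrableOn (fun t => (1 - t) * |v t - v' t|) (Ioo 0 1) := by
    have hm := hv.meas
    have hm' := hv'.meas
    apply Integrable.mono' (hv.integrable.add hv'.integrable) (by fun_prop)
    filter_upwards [ae_restrict_mem measurableSet_Ioo] with t ht
    have h0 : 0 ≤ 1 - t := by linarith [ht.2]
    rw [Real.norm_of_nonneg (by positivity)]
    simp only [Pi.add_apply]
    rw [← mul_add]
    gcongr
    exact abs_sub _ _
  have hE0 : 0 ≤ E := setIntegral_nonneg measurableSet_Ioo fun t ht => by
    have h0 : 0 ≤ 1 - t := by linarith [ht.2]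
    positivity
  -- At a maximum point of |Q - Q'| the contraction term is at most a third of the left side and can
  -- be absorbed. The factor 3/4 below is the kernel bound 1/2 times |Q'| ≤ 3/2.
  obtain ⟨x, hx, hmax⟩ := isCompact_Icc.exists_isMaxOn (nonempty_Icc.2 zero_le_one)
    (by have := h.cont; have := h'.cont; fun_prop :
      ContinuousOn (fun τ => |Q τ - Q' τ|) (Icc (0 : ℝ) 1))
  have key : |Q x - Q' x| ≤ 3 / 4 * E + 1 / 3 * |Q x - Q' x| := by
    have i1 := h.integrableOn_kernel hn hv hx.2
    have i2 := h'.integrableOn_kernel hn hv' hx.2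
    have i3 : IntegrableOn (fun t => volterraKernel n x t * v t * Q' t) (Ioo 0 1) :=
      integrableOn_volterraKernel_mul hn hv.meas hv.integrable h'.cont.measurable hx.2
        fun _ ht => h'.abs_le (Ioo_subset_Icc_self ht)
    have e : Q x - Q' x = -(∫ t in Ioo (0 : ℝ) 1, volterraKernel n x t * v t * (Q t - Q' t))
        - ∫ t in Ioo (0 : ℝ) 1, volterraKernel n x t * (v t - v' t) * Q' t := by
      simp_rw [mul_sub, sub_mul]
      rw [integral_sub i1 i3, integral_sub i3 i2, h.eq x hx, h'.eq x hx]
      ring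
    have b1 : |∫ t in Ioo (0 : ℝ) 1, volterraKernel n x t * v t * (Q t - Q' t)|
        ≤ 1 / 3 * |Q x - Q' x| := by
      refine (abs_integral_volterraKernel_le hn hv.meas hv.integrable hx.2
        (Q := fun t => Q t - Q' t) (fun t ht => hmax (Ioo_subset_Icc_self ht))).trans ?_
      exact mul_le_mul_of_nonneg_right hv.small (abs_nonneg _)
    have b2 : |∫ t in Ioo (0 : ℝ) 1, volterraKernel n x t * (v t - v' t) * Q' t| ≤ 3 / 4 * E := by
      rw [hE, ← integral_const_mul, ← Real.norm_eq_abs]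
      apply norm_integral_le_of_norm_le (hi.const_mul _)
      filter_upwards [ae_restrict_mem measurableSet_Ioo] with t ht
      have h0 := volterraKernel_nonneg n x ht.1
      have h1 := volterraKernel_le n hx.2 ht.1 ht.2.le
      have h2 := one_sub_pow_div_le hn ht.1.le
      have h3 : volterraKernel n x t ≤ (1 - t) / 2 := by linarith
      have h4 := h'.abs_le (Ioo_subset_Icc_self ht)
      rw [norm_mul, norm_mul, Real.norm_of_nonneg h0, Real.norm_eq_abs, Real.norm_eq_abs]
      have h5 : 0 ≤ (1 - t) / 2 := by linarith [ht.2]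
      calc volterraKernel n x t * |v t - v' t| * |Q' t|
          ≤ (1 - t) / 2 * |v t - v' t| * (3 / 2) := by gcongr
        _ = _ := by ring
    calc |Q x - Q' x| = |-(∫ t in Ioo (0 : ℝ) 1, volterraKernel n x t * v t * (Q t - Q' t))
        - ∫ t in Ioo (0 : ℝ) 1, volterraKernel n x t * (v t - v' t) * Q' t| := by rw [← e]
      _ ≤ _ := by
        refine (abs_sub _ _).trans ?_
        rw [abs_neg]
        linarith
  have : |Q τ - Q' τ| ≤ |Q x - Q' x| := hmax hτ
  linarith

end IsVolterraSol

/-! ### Logarithmic integrals on the unit interval -/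

lemma integral_Ioo_comp_one_sub (f : ℝ → ℝ) :
    ∫ t in Ioo (0 : ℝ) 1, f (1 - t) = ∫ z in Ioo (0 : ℝ) 1, f z := by
  rw [← integral_Ioc_eq_integral_Ioo, ← integral_Ioc_eq_integral_Ioo,
    ← intervalIntegral.integral_of_le zero_le_one, ← intervalIntegral.integral_of_le zero_le_one,
    intervalIntegral.integral_comp_sub_left (fun x => f x)]
  simp

lemma integrableOn_Ioo_comp_one_sub {f : ℝ → ℝ} (hf : IntegrableOn f (Ioo 0 1)) :
    IntegrableOn (fun t => f (1 - t)) (Ioo 0 1) := by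
  rw [← intervalIntegrable_iff_integrableOn_Ioo_of_le zero_le_one] at hf ⊢
  have := hf.symm.comp_sub_left 1
  simpa using this

lemma measurable_min_one_div (a : ℝ) : Measurable fun z : ℝ => min 1 (a / z) := by fun_prop

lemma integrableOn_min_one_div {a : ℝ} (ha : 0 ≤ a) :
    IntegrableOn (fun z : ℝ => min 1 (a / z)) (Ioo 0 1) := by
  apply Integrable.mono' (integrableOn_const (C := (1 : ℝ)) (by simp))
    (measurable_min_one_div a).aestronglyMeasurable
  filter_upwards [ae_restrict_mem measurableSet_Ioo] with z hz
  have h0 : 0 ≤ a / z := div_nonneg ha hz.1.le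
  rw [Real.norm_of_nonneg (le_min zero_le_one h0)]
  exact min_le_left _ _

lemma integrableOn_one_sub_log : IntegrableOn (fun z : ℝ => 1 - log z) (Ioo 0 1) := by
  rw [← intervalIntegrable_iff_integrableOn_Ioo_of_le zero_le_one]
  exact intervalIntegrable_const.sub intervalIntegral.intervalIntegrable_log'

lemma integrableOn_min_one_div_mul_log {a : ℝ} (ha : 0 ≤ a) :
    IntegrableOn (fun z : ℝ => min 1 (a / z) * (1 - log z)) (Ioo 0 1) := by
  apply Integrable.mono' integrableOn_one_sub_log
    ((measurable_min_one_div a).mul (by fun_prop)).aestronglyMeasurable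
  filter_upwards [ae_restrict_mem measurableSet_Ioo] with z hz
  have h0 : 0 ≤ a / z := div_nonneg ha hz.1.le
  have h1 : log z ≤ 0 := log_nonpos hz.1.le hz.2.le
  have h2 : 0 ≤ min 1 (a / z) := le_min zero_le_one h0
  change ‖min 1 (a / z) * (1 - log z)‖ ≤ _
  rw [norm_mul, Real.norm_of_nonneg h2, Real.norm_of_nonneg (by linarith)]
  exact mul_le_of_le_one_left (by linarith) (min_le_left _ _)

/-- The minimum switches at z = a. Below a the integral of the logarithm is explicit; above a the
bound log z ≥ log a leaves a logarithm times the integral of a/z, which is a second logarithm. This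
is one of the two sources of the error δ log² δ. -/
lemma integral_min_one_div_mul_log_le {a : ℝ} (ha : 0 < a) (ha1 : a < 1) :
    ∫ z in Ioo (0 : ℝ) 1, min 1 (a / z) * (1 - log z) ≤ 2 * (a * (1 - log a) ^ 2) := by
  have hl : log a < 0 := log_neg ha ha1
  have hi := integrableOn_min_one_div_mul_log ha.le
  rw [← integral_Ioc_eq_integral_Ioo, ← intervalIntegral.integral_of_le zero_le_one]
  have hi' : IntervalIntegrable (fun z : ℝ => min 1 (a / z) * (1 - log z)) volume 0 1 :=
    (intervalIntegrable_iff_integrableOn_Ioo_of_le zero_le_one).2 hi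
  have i1 := hi'.mono_set (c := 0) (d := a) (by
    rw [uIcc_of_le zero_le_one, uIcc_of_le ha.le]; exact Icc_subset_Icc le_rfl ha1.le)
  have i2 := hi'.mono_set (c := a) (d := 1) (by
    rw [uIcc_of_le zero_le_one, uIcc_of_le ha1.le]; exact Icc_subset_Icc ha.le le_rfl)
  rw [← intervalIntegral.integral_add_adjacent_intervals i1 i2]
  have b1 : ∫ z in (0 : ℝ)..a, min 1 (a / z) * (1 - log z) ≤ a * (2 - log a) := by
    have : ∫ z in (0 : ℝ)..a, (1 - log z) = a * (2 - log a) := by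
      rw [intervalIntegral.integral_sub intervalIntegrable_const
        intervalIntegral.intervalIntegrable_log', integral_log]
      simp
      ring
    rw [← this]
    apply intervalIntegral.integral_mono_on ha.le i1
      (intervalIntegrable_const.sub intervalIntegral.intervalIntegrable_log')
    intro z hz
    have h1 : log z ≤ 0 := log_nonpos hz.1 (hz.2.trans ha1.le)
    exact mul_le_of_le_one_left (by linarith) (min_le_left _ _)
  have b2 : ∫ z in a..1, min 1 (a / z) * (1 - log z) ≤ (1 - log a) * (a * -log a) := by
    have : ∫ z in a..1, (1 - log a) * (a * z⁻¹) = (1 - log a) * (a * -log a) := by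
      rw [intervalIntegral.integral_const_mul, intervalIntegral.integral_const_mul,
        integral_inv_of_pos ha one_pos, one_div, log_inv]
    rw [← this]
    apply intervalIntegral.integral_mono_on ha1.le i2
    · apply ContinuousOn.intervalIntegrable
      rw [uIcc_of_le ha1.le]
      apply continuousOn_const.mul (continuousOn_const.mul (continuousOn_inv₀.mono _))
      intro z hz
      exact (ha.trans_le hz.1).ne'
    · intro z hz
      have hz0 : 0 < z := ha.trans_le hz.1
      have h1 : log z ≤ 0 := log_nonpos hz0.le hz.2
      have h2 : log a ≤ log z := log_le_log ha hz.1
      rw [mul_comm]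
      have h3 : min 1 (a / z) ≤ a * z⁻¹ := min_le_right _ _
      have h4 : 0 ≤ min 1 (a / z) := le_min zero_le_one (by positivity)
      apply mul_le_mul (by linarith) h3 h4 (by linarith)
  nlinarith [mul_pos ha (neg_pos.2 hl), mul_nonneg ha.le (sq_nonneg (log a))]

lemma integral_min_one_div_le {a : ℝ} (ha : 0 < a) (ha1 : a ≤ 1) :
    ∫ z in Ioo (0 : ℝ) 1, min 1 (a / z) ≤ a * (1 - log a) := by
  have hi := integrableOn_min_one_div ha.le
  rw [← integral_Ioc_eq_integral_Ioo, ← intervalIntegral.integral_of_le zero_le_one]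
  have hi' : IntervalIntegrable (fun z : ℝ => min 1 (a / z)) volume 0 1 :=
    (intervalIntegrable_iff_integrableOn_Ioo_of_le zero_le_one).2 hi
  have i1 := hi'.mono_set (c := 0) (d := a) (by
    rw [uIcc_of_le zero_le_one, uIcc_of_le ha.le]; exact Icc_subset_Icc le_rfl ha1)
  have i2 := hi'.mono_set (c := a) (d := 1) (by
    rw [uIcc_of_le zero_le_one, uIcc_of_le ha1]; exact Icc_subset_Icc ha.le le_rfl)
  rw [← intervalIntegral.integral_add_adjacent_intervals i1 i2]
  have b1 : ∫ z in (0 : ℝ)..a, min 1 (a / z) ≤ a := by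
    have : ∫ z in (0 : ℝ)..a, (1 : ℝ) = a := by simp
    nth_rewrite 3 [← this]
    exact intervalIntegral.integral_mono_on ha.le i1 intervalIntegrable_const
      fun z hz => min_le_left _ _
  have b2 : ∫ z in a..1, min 1 (a / z) ≤ a * -log a := by
    have : ∫ z in a..1, a * z⁻¹ = a * -log a := by
      rw [intervalIntegral.integral_const_mul, integral_inv_of_pos ha one_pos, one_div, log_inv]
    rw [← this]
    apply intervalIntegral.integral_mono_on ha1 i2
    · apply ContinuousOn.intervalIntegrable
      rw [uIcc_of_le ha1]
      apply continuousOn_const.mul (continuousOn_inv₀.mono _)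
      intro z hz
      exact (ha.trans_le hz.1).ne'
    · intro z hz
      exact min_le_right _ _
  linarith

/-- The modulus of continuity at `1` of solutions with a weight of size `1/(1-t)`. -/
theorem IsVolterraSol.abs_one_sub_le (hn : 1 ≤ n) (hv : IsSmallWeight n v)
    (h : IsVolterraSol n v Q) {C : ℝ} (hC : ∀ t ∈ Ioo (0 : ℝ) 1, |v t| ≤ C / (1 - t)) {τ : ℝ}
    (hτ : τ ∈ Ioo (0 : ℝ) 1) :
    |Q 1 - Q τ| ≤ C * ((1 - τ) * (1 - log (1 - τ))) := by
  have h1 : (1 : ℝ) ∈ Icc (0 : ℝ) 1 := ⟨zero_le_one, le_rfl⟩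
  have hC0 : 0 ≤ C := by
    have := (abs_nonneg _).trans (hC (1 / 2) ⟨by norm_num, by norm_num⟩)
    by_contra hcon
    push Not at hcon
    exact absurd this (not_le.2 (div_neg_of_neg_of_pos hcon (by norm_num)))
  have hz : 0 < 1 - τ := by linarith [hτ.2]
  have e : Q 1 - Q τ = -∫ t in Ioo (0 : ℝ) 1,
      (volterraKernel n 1 t - volterraKernel n τ t) * v t * Q t := by
    simp_rw [sub_mul]
    rw [integral_sub (h.integrableOn_kernel hn hv le_rfl) (h.integrableOn_kernel hn hv hτ.2.le),
      h.eq 1 h1, h.eq τ (Ioo_subset_Icc_self hτ)]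
    ring
  rw [e, abs_neg]
  have hi := (integrableOn_Ioo_comp_one_sub (integrableOn_min_one_div hz.le)).const_mul (3 / 4 * C)
  have b : |∫ t in Ioo (0 : ℝ) 1, (volterraKernel n 1 t - volterraKernel n τ t) * v t * Q t|
      ≤ ∫ t in Ioo (0 : ℝ) 1, 3 / 4 * C * min 1 ((1 - τ) / (1 - t)) := by
    rw [← Real.norm_eq_abs]
    apply norm_integral_le_of_norm_le hi
    filter_upwards [ae_restrict_mem measurableSet_Ioo] with t ht
    have hz' : 0 < 1 - t := by linarith [ht.2]
    have a1 := abs_volterraKernel_sub_le hn hτ.1.le hτ.2.le ht.1 ht.2.le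
    have a2 := hC t ht
    have a3 := h.abs_le (Ioo_subset_Icc_self ht)
    rw [norm_mul, norm_mul, Real.norm_eq_abs, Real.norm_eq_abs, Real.norm_eq_abs]
    -- Pulling out the factor 1 - t cancels the singularity of the weight.
    have a4 : min (1 - τ) (1 - t) = min 1 ((1 - τ) / (1 - t)) * (1 - t) := by
      rw [min_mul_of_nonneg _ _ hz'.le, div_mul_cancel₀ _ hz'.ne', one_mul, min_comm]
    have a5 : 0 ≤ min 1 ((1 - τ) / (1 - t)) := le_min zero_le_one (by positivity)
    rw [a4] at a1
    calc _ ≤ min 1 ((1 - τ) / (1 - t)) * (1 - t) / 2 * (C / (1 - t)) * (3 / 2) := by gcongr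
      _ = _ := by
        field_simp
        norm_num
        ring
  refine b.trans ?_
  rw [integral_const_mul, integral_Ioo_comp_one_sub (fun z => min 1 ((1 - τ) / z))]
  have h2 := integral_min_one_div_le hz (by linarith [hτ.1])
  have h3 : 0 ≤ (1 - τ) * (1 - log (1 - τ)) := by
    have : log (1 - τ) ≤ 0 := log_nonpos hz.le (by linarith [hτ.1])
    exact mul_nonneg hz.le (by linarith)
  calc _ ≤ 3 / 4 * C * ((1 - τ) * (1 - log (1 - τ))) := by gcongr
    _ ≤ _ := by nlinarith [mul_nonneg hC0 h3]

/-! ### Weights with a nearly singular endpoint -/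

/-- A positive function on `(0,1)` that vanishes to first order at `1` with slope `-b`. -/
structure IsSideProfile (D : ℝ → ℝ) (b C : ℝ) : Prop where
  b_pos : 0 < b
  C_nonneg : 0 ≤ C
  meas : Measurable D
  lower : ∀ t ∈ Ioo (0 : ℝ) 1, b * (1 - t) ≤ D t
  quad : ∀ t ∈ Ioo (0 : ℝ) 1, |D t - b * (1 - t)| ≤ C * (1 - t) ^ 2

/-- Parameters of a perturbation of size `δ` which keeps the profile positive up to the
distance `ζ` from the endpoint `1`. -/
structure IsAdmissible (b K η δ ζ P R : ℝ) : Prop where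
  δ_pos : 0 < δ
  δ_lt : δ < 1
  K_ge : 1 ≤ K
  η_pos : 0 < η
  η_le : 2 * η ≤ b
  abs_P : |P| ≤ K * δ
  abs_R : |R| ≤ K * δ
  abs_R' : |R| ≤ η
  δ_le : δ ≤ K * ζ
  ζ_le : ζ ≤ K * δ
  ζ_lt : ζ < 1
  -- Equivalent to bζ + P ≥ 2ηζ: the linearised profile is still positive, with a margin, at the cut
  -- t = 1 - ζ.
  P_ge : -((b - 2 * η) * ζ) ≤ P

/-- The weight of the perturbed profile `D + P - R (1 - t)`, cut off at distance `ζ` from `1`. -/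
noncomputable def sideWeight (D : ℝ → ℝ) (ζ P R t : ℝ) : ℝ :=
  if t < 1 - ζ then ((1 + t) ^ 2 * (D t + P - R * (1 - t)))⁻¹ else 0

/-- The weight of the unperturbed profile. -/
noncomputable def limitWeight (D : ℝ → ℝ) (t : ℝ) : ℝ := ((1 + t) ^ 2 * D t)⁻¹

section

variable {D : ℝ → ℝ} {b C K η δ ζ P R t : ℝ}

lemma IsAdmissible.ζ_pos (h : IsAdmissible b K η δ ζ P R) : 0 < ζ := by
  have := h.δ_pos.trans_le h.δ_le
  exact pos_of_mul_pos_right this (by linarith [h.K_ge])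

/-- For 1 - t > ζ the lower bound on P costs at most (b - 2η)(1 - t) of the slope b, and R costs at
most η (1 - t); a slope η is left. -/
lemma IsAdmissible.le_denom (hD : IsSideProfile D b C) (h : IsAdmissible b K η δ ζ P R)
    (ht : t ∈ Ioo (0 : ℝ) 1) (htζ : t < 1 - ζ) : η * (1 - t) ≤ D t + P - R * (1 - t) := by
  have h1 := hD.lower t ht
  have h2 := h.P_ge
  have h3 := (abs_le.1 h.abs_R').2
  have h4 : 0 ≤ (b - 2 * η) * ((1 - t) - ζ) :=
    mul_nonneg (by linarith [h.η_le]) (by linarith)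
  have h5 : 0 ≤ (η - R) * (1 - t) := mul_nonneg (by linarith) (by linarith [ht.2])
  nlinarith

lemma IsAdmissible.le_linear (h : IsAdmissible b K η δ ζ P R) (htζ : t ≤ 1 - ζ) :
    2 * η * (1 - t) ≤ b * (1 - t) + P := by
  have h2 := h.P_ge
  have h4 : 0 ≤ (b - 2 * η) * ((1 - t) - ζ) :=
    mul_nonneg (by linarith [h.η_le]) (by linarith)
  nlinarith

/-- Together with `one_le_min_one_div` this puts two kinds of errors under one bound: those of size
δ/(1 - t) before the cut, and those of size 1 beyond it, where 1 - t ≤ Kδ. -/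
lemma le_min_one_div {K δ z : ℝ} (hK : 1 ≤ K) (hδ : 0 < δ) (hz : 0 < z) (h : δ ≤ K * z) :
    δ / z ≤ K * min 1 (δ / z) := by
  rcases le_total 1 (δ / z) with h1 | h1
  · rw [min_eq_left h1, mul_one, div_le_iff₀ hz]
    exact h
  · rw [min_eq_right h1]
    have : 0 ≤ δ / z := by positivity
    nlinarith

lemma one_le_min_one_div {K δ z : ℝ} (hK : 1 ≤ K) (hz : 0 < z) (h : z ≤ K * δ) :
    1 ≤ K * min 1 (δ / z) := by
  rcases le_total 1 (δ / z) with h1 | h1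
  · rw [min_eq_left h1]; linarith
  · rw [min_eq_right h1, ← mul_div_assoc, le_div_iff₀ hz]
    linarith

/-! ### Bounds for the perturbed weight and its distance to the limit weight. -/

lemma measurable_sideWeight (hD : Measurable D) (ζ P R : ℝ) : Measurable (sideWeight D ζ P R) := by
  unfold sideWeight
  exact Measurable.ite measurableSet_Iio (by fun_prop) measurable_const

lemma measurable_limitWeight (hD : Measurable D) : Measurable (limitWeight D) := by
  unfold limitWeight
  fun_prop

lemma one_le_one_add_sq {t : ℝ} (ht : 0 < t) : 1 ≤ (1 + t) ^ 2 := by nlinarith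

lemma inv_mul_le_inv {x y w : ℝ} (hx : 1 ≤ x) (hw : 0 < w) (hy : w ≤ y) : |(x * y)⁻¹| ≤ 1 / w := by
  have hy0 : 0 < y := hw.trans_le hy
  rw [abs_of_pos (by positivity), one_div]
  apply inv_anti₀ hw
  nlinarith

lemma abs_sideWeight_le (hD : IsSideProfile D b C) (h : IsAdmissible b K η δ ζ P R)
    (ht : t ∈ Ioo (0 : ℝ) 1) : |sideWeight D ζ P R t| ≤ 1 / (η * (1 - t)) := by
  have hz : 0 < 1 - t := by linarith [ht.2]
  have hη := h.η_pos
  unfold sideWeight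
  split_ifs with hc
  · exact inv_mul_le_inv (one_le_one_add_sq ht.1) (by positivity) (h.le_denom hD ht hc)
  · rw [abs_zero]; positivity

lemma abs_sideWeight_le' (hD : IsSideProfile D b C) (h : IsAdmissible b K η δ ζ P R)
    (ht : t ∈ Ioo (0 : ℝ) 1) : |sideWeight D ζ P R t| ≤ 1 / (η * ζ) := by
  have hη := h.η_pos
  have hζ := h.ζ_pos
  by_cases hc : t < 1 - ζ
  · refine (abs_sideWeight_le hD h ht).trans ?_
    gcongr
    linarith
  · rw [sideWeight, if_neg hc, abs_zero]; positivity

lemma abs_limitWeight_le (hD : IsSideProfile D b C) (ht : t ∈ Ioo (0 : ℝ) 1) :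
    |limitWeight D t| ≤ 1 / (b * (1 - t)) := by
  have hz : 0 < 1 - t := by linarith [ht.2]
  have hb := hD.b_pos
  exact inv_mul_le_inv (one_le_one_add_sq ht.1) (by positivity) (hD.lower t ht)

lemma abs_inv_sub_inv_le {x y y' w w' : ℝ} (hx : 1 ≤ x) (hw : 0 < w) (hw' : 0 < w') (hy : w ≤ y)
    (hy' : w' ≤ y') : |(x * y)⁻¹ - (x * y')⁻¹| ≤ |y - y'| / (w * w') := by
  have hy0 : 0 < y := hw.trans_le hy
  have hy0' : 0 < y' := hw'.trans_le hy'
  have hx0 : 0 < x := by linarith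
  have e : (x * y)⁻¹ - (x * y')⁻¹ = x⁻¹ * ((y' - y) / (y * y')) := by
    field_simp
  rw [e, abs_mul, abs_div, abs_of_pos (by positivity : 0 < x⁻¹),
    abs_of_pos (by positivity : 0 < y * y'), abs_sub_comm]
  have h1 : x⁻¹ ≤ 1 := inv_le_one_of_one_le₀ hx
  calc x⁻¹ * (|y - y'| / (y * y')) ≤ 1 * (|y - y'| / (w * w')) := by gcongr
    _ = _ := one_mul _

/-- Before the cut the two denominators differ by O(δ) and are bounded below by multiples of 1 - t.
Beyond the cut only the limit weight is left, and there 1 - t is at most Kδ. -/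
lemma abs_sideWeight_sub_limitWeight_le (hD : IsSideProfile D b C)
    (h : IsAdmissible b K η δ ζ P R) (ht : t ∈ Ioo (0 : ℝ) 1) :
    |sideWeight D ζ P R t - limitWeight D t|
      ≤ (2 * K ^ 2 / (η * b) + K / b) * (min 1 (δ / (1 - t)) / (1 - t)) := by
  have hz : 0 < 1 - t := by linarith [ht.2]
  have hz1 : 1 - t ≤ 1 := by linarith [ht.1]
  have hη := h.η_pos
  have hb := hD.b_pos
  have hK := h.K_ge
  have hK0 : 0 < K := by linarith
  have hδ := h.δ_pos
  have hm : 0 ≤ min 1 (δ / (1 - t)) := le_min zero_le_one (by positivity)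
  by_cases hc : t < 1 - ζ
  · rw [sideWeight, if_pos hc, limitWeight]
    refine (abs_inv_sub_inv_le (one_le_one_add_sq ht.1) (by positivity) (by positivity)
      (h.le_denom hD ht hc) (hD.lower t ht)).trans ?_
    have h1 : |D t + P - R * (1 - t) - D t| ≤ 2 * K * δ := by
      have : D t + P - R * (1 - t) - D t = P - R * (1 - t) := by ring
      rw [this]
      refine (abs_sub _ _).trans ?_
      rw [abs_mul, abs_of_pos hz]
      have := mul_le_mul h.abs_R hz1 hz.le (by positivity)
      linarith [h.abs_P]
    have h2 := le_min_one_div hK hδ hz (by nlinarith [h.δ_le] : δ ≤ K * (1 - t))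
    have h3 : 0 ≤ K / b * (min 1 (δ / (1 - t)) / (1 - t)) := by positivity
    calc _ ≤ 2 * K * δ / (η * (1 - t) * (b * (1 - t))) := by gcongr
      _ = 2 * K / (η * b) * ((δ / (1 - t)) / (1 - t)) := by field_simp
      _ ≤ 2 * K / (η * b) * ((K * min 1 (δ / (1 - t))) / (1 - t)) := by gcongr
      _ = 2 * K ^ 2 / (η * b) * (min 1 (δ / (1 - t)) / (1 - t)) := by ring
      _ ≤ _ := by rw [add_mul]; linarith
  · rw [sideWeight, if_neg hc, zero_sub, abs_neg]
    refine (abs_limitWeight_le hD ht).trans ?_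
    have h2 := one_le_min_one_div hK hz (by push Not at hc; linarith [h.ζ_le] : 1 - t ≤ K * δ)
    have h3 : 0 ≤ 2 * K ^ 2 / (η * b) * (min 1 (δ / (1 - t)) / (1 - t)) := by positivity
    calc 1 / (b * (1 - t)) ≤ (K * min 1 (δ / (1 - t))) / (b * (1 - t)) := by gcongr
      _ = K / b * (min 1 (δ / (1 - t)) / (1 - t)) := by field_simp
      _ ≤ _ := by rw [add_mul]; linarith

lemma integrableOn_sideWeight (hD : IsSideProfile D b C) (h : IsAdmissible b K η δ ζ P R) :
    IntegrableOn (sideWeight D ζ P R) (Ioo 0 1) := by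
  apply Integrable.mono' (integrableOn_const (C := 1 / (η * ζ)) (by simp))
    (measurable_sideWeight hD.meas _ _ _).aestronglyMeasurable
  filter_upwards [ae_restrict_mem measurableSet_Ioo] with t ht
  exact abs_sideWeight_le' hD h ht

lemma integrableOn_one_sub_mul_sideWeight (hD : IsSideProfile D b C)
    (h : IsAdmissible b K η δ ζ P R) :
    IntegrableOn (fun t => (1 - t) * |sideWeight D ζ P R t|) (Ioo 0 1) := by
  have hm := measurable_sideWeight hD.meas ζ P R
  have hη := h.η_pos
  apply Integrable.mono' (integrableOn_const (C := 1 / η) (by simp)) (by fun_prop)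
  filter_upwards [ae_restrict_mem measurableSet_Ioo] with t ht
  have hz : 0 < 1 - t := by linarith [ht.2]
  rw [Real.norm_of_nonneg (by positivity)]
  calc _ ≤ (1 - t) * (1 / (η * (1 - t))) := by gcongr; exact abs_sideWeight_le hD h ht
    _ = _ := by field_simp

lemma integrableOn_one_sub_mul_limitWeight (hD : IsSideProfile D b C) :
    IntegrableOn (fun t => (1 - t) * |limitWeight D t|) (Ioo 0 1) := by
  have hm := measurable_limitWeight hD.meas
  have hb := hD.b_pos
  apply Integrable.mono' (integrableOn_const (C := 1 / b) (by simp)) (by fun_prop)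
  filter_upwards [ae_restrict_mem measurableSet_Ioo] with t ht
  have hz : 0 < 1 - t := by linarith [ht.2]
  rw [Real.norm_of_nonneg (by positivity)]
  calc _ ≤ (1 - t) * (1 / (b * (1 - t))) := by gcongr; exact abs_limitWeight_le hD ht
    _ = _ := by field_simp

lemma integral_one_sub_mul_abs_sub_le (hD : IsSideProfile D b C)
    (h : IsAdmissible b K η δ ζ P R) :
    ∫ t in Ioo (0 : ℝ) 1, (1 - t) * |sideWeight D ζ P R t - limitWeight D t|
      ≤ (2 * K ^ 2 / (η * b) + K / b) * (δ * (1 - log δ)) := by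
  have hη := h.η_pos
  have hb := hD.b_pos
  have hK : 0 < K := by linarith [h.K_ge]
  set C₁ := 2 * K ^ 2 / (η * b) + K / b
  have hC₁ : 0 ≤ C₁ := by positivity
  have hi := (integrableOn_Ioo_comp_one_sub (integrableOn_min_one_div h.δ_pos.le)).const_mul C₁
  calc _ ≤ ∫ t in Ioo (0 : ℝ) 1, C₁ * min 1 (δ / (1 - t)) := by
        apply integral_mono_of_nonneg _ hi
        · filter_upwards [ae_restrict_mem measurableSet_Ioo] with t ht
          have hz : 0 < 1 - t := by linarith [ht.2]
          have := abs_sideWeight_sub_limitWeight_le hD h ht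
          calc _ ≤ (1 - t) * (C₁ * (min 1 (δ / (1 - t)) / (1 - t))) := by
                gcongr
            _ = _ := by field_simp
        · filter_upwards [ae_restrict_mem measurableSet_Ioo] with t ht
          have hz : 0 < 1 - t := by linarith [ht.2]
          simp only [Pi.zero_apply]
          positivity
    _ ≤ _ := by
        rw [integral_const_mul, integral_Ioo_comp_one_sub (fun z => min 1 (δ / z))]
        gcongr
        exact integral_min_one_div_le h.δ_pos h.δ_lt.le

/-- Integrating 1/(η (1 - t)) up to the cut costs only a logarithm. Multiplied by the stability
error δ |log δ| of the Volterra solutions, it is the other source of δ log² δ. -/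
lemma integral_abs_sideWeight_le (hD : IsSideProfile D b C) (h : IsAdmissible b K η δ ζ P R) :
    ∫ t in Ioo (0 : ℝ) 1, |sideWeight D ζ P R t| ≤ (log K - log δ) / η := by
  have hη := h.η_pos
  have hK : 0 < K := by linarith [h.K_ge]
  have hδ := h.δ_pos
  have hζ := h.ζ_pos
  have hζ1 := h.ζ_lt
  have e : ∫ t in (0 : ℝ)..(1 - ζ), 1 / η * (1 - t)⁻¹ = 1 / η * -log ζ := by
    rw [intervalIntegral.integral_const_mul,
      intervalIntegral.integral_comp_sub_left (fun x => x⁻¹) 1, sub_sub_cancel, sub_zero,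
      integral_inv_of_pos hζ one_pos, one_div ζ, log_inv]
  have hii : IntegrableOn (fun t : ℝ => 1 / η * (1 - t)⁻¹) (Ioc 0 (1 - ζ)) := by
    rw [← intervalIntegrable_iff_integrableOn_Ioc_of_le (by linarith)]
    apply ContinuousOn.intervalIntegrable
    rw [uIcc_of_le (by linarith)]
    apply continuousOn_const.mul (ContinuousOn.inv₀ (by fun_prop) _)
    intro t ht
    have := ht.2
    linarith
  have hi := integrableOn_sideWeight hD h
  calc ∫ t in Ioo (0 : ℝ) 1, |sideWeight D ζ P R t|
      = ∫ t in Ioc (0 : ℝ) (1 - ζ), |sideWeight D ζ P R t| := by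
        apply setIntegral_eq_of_subset_of_forall_sdiff_eq_zero measurableSet_Ioo
        · intro t ht
          exact ⟨ht.1, by linarith [ht.2]⟩
        · intro t ht
          rw [sideWeight, if_neg, abs_zero]
          intro hc
          exact ht.2 ⟨ht.1.1, hc.le⟩
    _ ≤ ∫ t in Ioc (0 : ℝ) (1 - ζ), 1 / η * (1 - t)⁻¹ := by
        apply setIntegral_mono_on _ hii measurableSet_Ioc
        · intro t ht
          refine (abs_sideWeight_le hD h ⟨ht.1, by linarith [ht.2]⟩).trans (le_of_eq ?_)
          rw [one_div, mul_inv, one_div]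
        · apply IntegrableOn.mono_set hi.abs
          intro t ht
          exact ⟨ht.1, by linarith [ht.2]⟩
    _ = 1 / η * -log ζ := by
        rw [← e, intervalIntegral.integral_of_le (by linarith)]
    _ ≤ _ := by
        rw [one_div, inv_mul_eq_div]
        gcongr
        have := log_le_log hδ h.δ_le
        rw [log_mul hK.ne' hζ.ne'] at this
        linarith

/-! ### The logarithmic asymptotics of the integral of the weight -/

/-- The difference between the limit weight and its leading singular part. -/
noncomputable def regularPart (D : ℝ → ℝ) (b t : ℝ) : ℝ := limitWeight D t - (4 * (b * (1 - t)))⁻¹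

/-- The difference between the perturbed weight and its leading nearly singular part. -/
noncomputable def sideRegularPart (D : ℝ → ℝ) (b ζ P R t : ℝ) : ℝ :=
  if t < 1 - ζ then sideWeight D ζ P R t - (4 * (b * (1 - t) + P))⁻¹ else 0

/-- At t = 1 the factor 1/(1+t)² equals 1/4; this explains the 4 in the singular parts that are
subtracted from the weights. -/
lemma abs_numerator_le {t : ℝ} (ht : t ∈ Ioo (0 : ℝ) 1) :
    |4 * ((1 + t) ^ 2)⁻¹ - 1| ≤ 4 * (1 - t) := by
  have h1 := one_le_one_add_sq ht.1
  have h2 : 0 < (1 + t) ^ 2 := by linarith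
  have e : 4 * ((1 + t) ^ 2)⁻¹ - 1 = (1 - t) * (3 + t) / (1 + t) ^ 2 := by
    rw [eq_div_iff h2.ne', sub_mul, mul_assoc, inv_mul_cancel₀ h2.ne']
    ring
  have hz : 0 < 1 - t := by linarith [ht.2]
  have h3 : 0 < 3 + t := by linarith [ht.1]
  rw [e, abs_of_pos (by positivity), div_le_iff₀ h2]
  have : 3 + t ≤ 4 * (1 + t) ^ 2 := by nlinarith [ht.1]
  nlinarith

lemma abs_regular_numerator_le (hD : IsSideProfile D b C) (ht : t ∈ Ioo (0 : ℝ) 1) :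
    |4 * ((1 + t) ^ 2)⁻¹ * (b * (1 - t)) - D t| ≤ (4 * b + C) * (1 - t) ^ 2 := by
  have hz : 0 < 1 - t := by linarith [ht.2]
  have hb := hD.b_pos
  have e : 4 * ((1 + t) ^ 2)⁻¹ * (b * (1 - t)) - D t
      = (4 * ((1 + t) ^ 2)⁻¹ - 1) * (b * (1 - t)) - (D t - b * (1 - t)) := by ring
  rw [e]
  refine (abs_sub _ _).trans ?_
  rw [abs_mul, abs_of_pos (by positivity : 0 < b * (1 - t))]
  have h1 := mul_le_mul_of_nonneg_right (abs_numerator_le ht) (by positivity : 0 ≤ b * (1 - t))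
  have h2 := hD.quad t ht
  nlinarith

lemma abs_regularPart_le (hD : IsSideProfile D b C) (ht : t ∈ Ioo (0 : ℝ) 1) :
    |regularPart D b t| ≤ (4 * b + C) / (4 * b ^ 2) := by
  have hz : 0 < 1 - t := by linarith [ht.2]
  have hb := hD.b_pos
  have hC := hD.C_nonneg
  have hlow := hD.lower t ht
  have hD0 : 0 < D t := lt_of_lt_of_le (by positivity) hlow
  have h1 : 0 < 1 + t := by linarith [ht.1]
  have e : regularPart D b t = (4 * ((1 + t) ^ 2)⁻¹ * (b * (1 - t)) - D t)
      / (4 * (b * (1 - t)) * D t) := by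
    unfold regularPart limitWeight
    field_simp
  rw [e, abs_div, abs_of_pos (by positivity : 0 < 4 * (b * (1 - t)) * D t)]
  have := abs_regular_numerator_le hD ht
  calc _ ≤ (4 * b + C) * (1 - t) ^ 2 / (4 * (b * (1 - t)) * (b * (1 - t))) := by gcongr
    _ = _ := by field_simp

-- With z = 1 - t, G = 1/(1+t)², D₁ the perturbed denominator, M = bz + P and N = 4Gbz - D, the
-- difference before the cut is ((4G - 1)P + Rz)/(4 D₁ M) + N (1/(4 D₁ M) - 1/(4 D bz)). The
-- denominators are of order z, and N = O(z²) by the quadratic bound on the profile, so both terms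
-- are O(δ/z). This is one power of z better than the difference of the weights themselves and
-- integrates to O(δ |log δ|).
set_option maxHeartbeats 800000 in
lemma abs_sideRegularPart_sub_le (hD : IsSideProfile D b C)
    (h : IsAdmissible b K η δ ζ P R) (ht : t ∈ Ioo (0 : ℝ) 1) :
    |sideRegularPart D b ζ P R t - regularPart D b t|
      ≤ (K * (5 * K / (8 * η ^ 2) + (4 * b + C) * (K * (b + C) + 2 * K * (b + K ^ 2))
          / (8 * η ^ 2 * b ^ 2)) + K * ((4 * b + C) / (4 * b ^ 2))) * min 1 (δ / (1 - t)) := by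
  have hz : 0 < 1 - t := by linarith [ht.2]
  have hz1 : 1 - t ≤ 1 := by linarith [ht.1]
  have hη := h.η_pos
  have hb := hD.b_pos
  have hC := hD.C_nonneg
  have hK := h.K_ge
  have hK0 : 0 < K := by linarith
  have hδ := h.δ_pos
  have hm : 0 ≤ min 1 (δ / (1 - t)) := le_min zero_le_one (by positivity)
  rw [add_mul]
  by_cases hc : t < 1 - ζ
  · have hδz : δ ≤ K * (1 - t) := by nlinarith [h.δ_le]
    have h2 := le_min_one_div hK hδ hz hδz
    have hden := h.le_denom hD ht hc
    have hlin := h.le_linear hc.le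
    have hlow := hD.lower t ht
    have hnum := abs_regular_numerator_le hD ht
    have hquad := hD.quad t ht
    have hg := abs_numerator_le ht
    have h1t : 0 < 1 + t := by linarith [ht.1]
    rw [sideRegularPart, if_pos hc, sideWeight, if_pos hc, regularPart, limitWeight]
    set z := 1 - t with hzdef
    set G := ((1 + t) ^ 2)⁻¹ with hG
    set D₁ := D t + P - R * z with hD₁
    set M := b * z + P with hM
    have hD0 : 0 < D t := lt_of_lt_of_le (by positivity) hlow
    have hD1 : 0 < D₁ := lt_of_lt_of_le (by positivity) hden
    have hM0 : 0 < M := lt_of_lt_of_le (by positivity) hlin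
    have e : ((1 + t) ^ 2 * D₁)⁻¹ - (4 * M)⁻¹ - (((1 + t) ^ 2 * D t)⁻¹ - (4 * (b * z))⁻¹)
        = ((4 * G - 1) * P + R * z) / (4 * D₁ * M)
          + (4 * G * (b * z) - D t) * ((D t * (b * z - M) + M * (D t - D₁))
            / (4 * D₁ * M * (D t * (b * z)))) := by
      have a1 : ((1 + t) ^ 2 * D₁)⁻¹ - (4 * M)⁻¹ = (4 * G * M - D₁) / (4 * D₁ * M) := by
        rw [hG]
        field_simp
      have a2 : ((1 + t) ^ 2 * D t)⁻¹ - (4 * (b * z))⁻¹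
          = (4 * G * (b * z) - D t) / (4 * (D t * (b * z))) := by
        rw [hG]
        field_simp
      have a3 : 4 * G * M - D₁ = (4 * G * (b * z) - D t) + ((4 * G - 1) * P + R * z) := by
        rw [hM, hD₁]
        ring
      rw [a1, a2, a3]
      generalize 4 * G * (b * z) - D t = N
      generalize (4 * G - 1) * P + R * z = N'
      field_simp
      ring
    have b1 : |(4 * G - 1) * P + R * z| ≤ 5 * K * δ * z := by
      refine (abs_add_le _ _).trans ?_
      rw [abs_mul, abs_mul, abs_of_pos hz]
      have a1 := h.abs_P
      have a2 := h.abs_R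
      calc |4 * G - 1| * |P| + |R| * z ≤ 4 * z * (K * δ) + K * δ * z := by gcongr
        _ = _ := by ring
    have b2 : |D t * (b * z - M) + M * (D t - D₁)|
        ≤ (K * (b + C) + 2 * K * (b + K ^ 2)) * (δ * z) := by
      have a1 : |b * z - M| ≤ K * δ := by
        rw [hM, sub_add_cancel_left, abs_neg]; exact h.abs_P
      have a2 : |D t - D₁| ≤ 2 * K * δ := by
        have : D t - D₁ = R * z - P := by rw [hD₁]; ring
        rw [this]
        refine (abs_sub _ _).trans ?_
        rw [abs_mul, abs_of_pos hz]
        have := mul_le_mul h.abs_R hz1 hz.le (by positivity)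
        linarith [h.abs_P]
      have a3 : D t ≤ (b + C) * z := by
        have := (abs_le.1 hquad).2
        nlinarith
      have a4 : M ≤ (b + K ^ 2) * z := by
        have := (abs_le.1 h.abs_P).2
        rw [hM]
        nlinarith
      refine (abs_add_le _ _).trans ?_
      rw [abs_mul, abs_mul, abs_of_pos hD0, abs_of_pos hM0]
      calc D t * |b * z - M| + M * |D t - D₁|
          ≤ (b + C) * z * (K * δ) + (b + K ^ 2) * z * (2 * K * δ) := by gcongr
        _ = _ := by ring
    have b3 : |((4 * G - 1) * P + R * z) / (4 * D₁ * M)| ≤ 5 * K / (8 * η ^ 2) * (δ / z) := by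
      rw [abs_div, abs_of_pos (by positivity : 0 < 4 * D₁ * M)]
      calc _ ≤ 5 * K * δ * z / (4 * (η * z) * (2 * η * z)) := by gcongr
        _ = _ := by field_simp; norm_num
    have b4 : |(4 * G * (b * z) - D t) * ((D t * (b * z - M) + M * (D t - D₁))
            / (4 * D₁ * M * (D t * (b * z))))|
        ≤ (4 * b + C) * (K * (b + C) + 2 * K * (b + K ^ 2)) / (8 * η ^ 2 * b ^ 2) * (δ / z) := by
      rw [abs_mul, abs_div, abs_of_pos (by positivity : 0 < 4 * D₁ * M * (D t * (b * z)))]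
      calc _ ≤ (4 * b + C) * z ^ 2 * ((K * (b + C) + 2 * K * (b + K ^ 2)) * (δ * z)
            / (4 * (η * z) * (2 * η * z) * ((b * z) * (b * z)))) := by gcongr
        _ = _ := by field_simp; norm_num
    have b5 : 0 ≤ K * ((4 * b + C) / (4 * b ^ 2)) * min 1 (δ / z) := by positivity
    rw [e]
    refine (abs_add_le _ _).trans ((add_le_add b3 b4).trans ?_)
    rw [← add_mul]
    set A := 5 * K / (8 * η ^ 2) + (4 * b + C) * (K * (b + C) + 2 * K * (b + K ^ 2))
      / (8 * η ^ 2 * b ^ 2)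
    have hA : 0 ≤ A := by positivity
    calc A * (δ / z) ≤ A * (K * min 1 (δ / z)) := by gcongr
      _ = K * A * min 1 (δ / z) := by ring
      _ ≤ _ := by linarith
  · rw [sideRegularPart, if_neg hc, zero_sub, abs_neg]
    have h2 := one_le_min_one_div hK hz (by push Not at hc; linarith [h.ζ_le] : 1 - t ≤ K * δ)
    have h3 := abs_regularPart_le hD ht
    have b5 : 0 ≤ K * (5 * K / (8 * η ^ 2) + (4 * b + C) * (K * (b + C) + 2 * K * (b + K ^ 2))
      / (8 * η ^ 2 * b ^ 2)) * min 1 (δ / (1 - t)) := by positivity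
    have b6 : 0 ≤ (4 * b + C) / (4 * b ^ 2) := by positivity
    nlinarith

end

section

variable {D : ℝ → ℝ} {b C K η δ ζ P R t : ℝ}

lemma measurable_regularPart (hD : Measurable D) (b : ℝ) : Measurable (regularPart D b) := by
  have := measurable_limitWeight hD
  unfold regularPart
  fun_prop

lemma integrableOn_regularPart (hD : IsSideProfile D b C) :
    IntegrableOn (regularPart D b) (Ioo 0 1) := by
  apply Integrable.mono' (integrableOn_const (C := (4 * b + C) / (4 * b ^ 2)) (by simp))
    (measurable_regularPart hD.meas _).aestronglyMeasurable
  filter_upwards [ae_restrict_mem measurableSet_Ioo] with t ht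
  exact abs_regularPart_le hD ht

/-- The constant in the asymptotic expansion of the integral of the weight. -/
noncomputable def weightConstant (D : ℝ → ℝ) (b : ℝ) : ℝ :=
  log b / (4 * b) + ∫ t in Ioo (0 : ℝ) 1, regularPart D b t

lemma integral_linear_inv (hb : 0 < b) (h : IsAdmissible b K η δ ζ P R) :
    ∫ t in (0 : ℝ)..(1 - ζ), (4 * (b * (1 - t) + P))⁻¹
      = (log (b + P) - log (b * ζ + P)) / (4 * b) := by
  have hη := h.η_pos
  have hζ := h.ζ_pos
  have hζ1 := h.ζ_lt
  have hpos : ∀ t ∈ uIcc 0 (1 - ζ), 0 < b * (1 - t) + P := by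
    intro t ht
    rw [uIcc_of_le (by linarith)] at ht
    have h1 := h.le_linear ht.2
    have h2 : 0 < 1 - t := by linarith [ht.2]
    exact lt_of_lt_of_le (by positivity) h1
  have hd : ∀ t ∈ uIcc 0 (1 - ζ), HasDerivAt (fun t => -(log (b * (1 - t) + P) / (4 * b)))
      ((4 * (b * (1 - t) + P))⁻¹) t := by
    intro t ht
    have h0 := (hpos t ht).ne'
    have h1 : HasDerivAt (fun t => b * (1 - t) + P) (b * (-1)) t :=
      (((hasDerivAt_id t).const_sub 1).const_mul b).add_const P
    refine ((h1.log h0).div_const (4 * b)).neg.congr_deriv ?_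
    field_simp
  rw [intervalIntegral.integral_eq_sub_of_hasDerivAt hd]
  · simp only [sub_zero, mul_one, sub_sub_cancel]
    ring
  · apply ContinuousOn.intervalIntegrable
    apply ContinuousOn.inv₀ (by fun_prop)
    intro t ht
    have := hpos t ht
    positivity

/-- The integral of the weight up to errors of size `δ |log δ|`. -/
theorem exists_integral_sideWeight_bound (hD : IsSideProfile D b C) (K η : ℝ) :
    ∃ A : ℝ, ∀ δ ζ P R, IsAdmissible b K η δ ζ P R →
      |(∫ t in Ioo (0 : ℝ) 1, sideWeight D ζ P R t)
        - (weightConstant D b - log (b * ζ + P) / (4 * b))| ≤ A * (δ * (1 - log δ)) := by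
  set C₃ := (K * (5 * K / (8 * η ^ 2) + (4 * b + C) * (K * (b + C) + 2 * K * (b + K ^ 2))
          / (8 * η ^ 2 * b ^ 2)) + K * ((4 * b + C) / (4 * b ^ 2))) with hC₃
  refine ⟨C₃ + K / (2 * η) / (4 * b), fun δ ζ P R h => ?_⟩
  have hη := h.η_pos
  have hb := hD.b_pos
  have hC := hD.C_nonneg
  have hK0 : 0 < K := by linarith [h.K_ge]
  have hδ := h.δ_pos
  have hζ := h.ζ_pos
  have hζ1 := h.ζ_lt
  have hC₃0 : 0 ≤ C₃ := by positivity
  have hlin := integral_linear_inv hb h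
  have hlogδ : log δ ≤ 0 := log_nonpos hδ.le h.δ_lt.le
  set L : ℝ → ℝ := fun t => if t < 1 - ζ then (4 * (b * (1 - t) + P))⁻¹ else 0 with hL
  have hLm : Measurable L := Measurable.ite measurableSet_Iio (by fun_prop) measurable_const
  have hLb : ∀ t, |L t| ≤ (4 * (2 * η * ζ))⁻¹ := by
    intro t
    simp only [hL]
    split_ifs with hc
    · have h1 := h.le_linear hc.le
      have h2 : 2 * η * ζ ≤ b * (1 - t) + P := by nlinarith
      have h3 : 0 < b * (1 - t) + P := lt_of_lt_of_le (by positivity) h2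
      rw [abs_of_pos (by positivity)]
      gcongr
    · rw [abs_zero]; positivity
  have hLi : IntegrableOn L (Ioo 0 1) := by
    apply Integrable.mono' (integrableOn_const (C := (4 * (2 * η * ζ))⁻¹) (by simp))
      hLm.aestronglyMeasurable
    exact Filter.Eventually.of_forall hLb
  have hLint : ∫ t in Ioo (0 : ℝ) 1, L t = (log (b + P) - log (b * ζ + P)) / (4 * b) := by
    rw [← hlin, intervalIntegral.integral_of_le (by linarith), integral_Ioc_eq_integral_Ioo]
    rw [setIntegral_eq_of_subset_of_forall_sdiff_eq_zero measurableSet_Ioo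
      (s := Ioo 0 (1 - ζ))]
    · apply setIntegral_congr_fun measurableSet_Ioo
      intro t ht
      simp only [hL, if_pos ht.2]
    · exact Ioo_subset_Ioo le_rfl (by linarith)
    · intro t ht
      simp only [hL]
      rw [if_neg]
      intro hc
      exact ht.2 ⟨ht.1.1, hc⟩
  have hVi := integrableOn_sideWeight hD h
  have hW : ∀ t, sideRegularPart D b ζ P R t = sideWeight D ζ P R t - L t := by
    intro t
    simp only [hL, sideRegularPart, sideWeight]
    split_ifs <;> simp
  have hWi : IntegrableOn (sideRegularPart D b ζ P R) (Ioo 0 1) := by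
    have : sideRegularPart D b ζ P R = fun t => sideWeight D ζ P R t - L t := funext hW
    rw [this]
    exact hVi.sub hLi
  have e1 : ∫ t in Ioo (0 : ℝ) 1, sideRegularPart D b ζ P R t
      = (∫ t in Ioo (0 : ℝ) 1, sideWeight D ζ P R t)
        - (log (b + P) - log (b * ζ + P)) / (4 * b) := by
    simp_rw [hW]
    rw [integral_sub hVi hLi, hLint]
  have hRi := integrableOn_regularPart hD
  have e2 : |(∫ t in Ioo (0 : ℝ) 1, sideRegularPart D b ζ P R t)
      - ∫ t in Ioo (0 : ℝ) 1, regularPart D b t| ≤ C₃ * (δ * (1 - log δ)) := by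
    rw [← integral_sub hWi hRi, ← Real.norm_eq_abs]
    have hi := (integrableOn_Ioo_comp_one_sub (integrableOn_min_one_div hδ.le)).const_mul C₃
    refine (norm_integral_le_of_norm_le hi ?_).trans ?_
    · filter_upwards [ae_restrict_mem measurableSet_Ioo] with t ht
      exact abs_sideRegularPart_sub_le hD h ht
    · rw [integral_const_mul, integral_Ioo_comp_one_sub (fun z => min 1 (δ / z))]
      gcongr
      exact integral_min_one_div_le hδ h.δ_lt.le
  have hbP : 2 * η ≤ b + P := by
    have := h.le_linear (t := 0) (by linarith)
    linarith
  -- The antiderivative at t = 0 gives log(b + P), whereas `weightConstant` contains log b; the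
  -- replacement costs O(δ).
  have e3 : |log (b + P) - log b| ≤ K / (2 * η) * (δ * (1 - log δ)) := by
    have h1 : |log (b + P) - log b| ≤ |P| / (2 * η) := by
      have hbP0 : 0 < b + P := by linarith
      rw [← log_div hbP0.ne' hb.ne', abs_le]
      constructor
      · have := one_sub_inv_le_log_of_pos (div_pos hbP0 hb)
        refine le_trans ?_ this
        have e : 1 - ((b + P) / b)⁻¹ = P / (b + P) := by field_simp; ring
        rw [e, neg_le, ← neg_div]
        calc -P / (b + P) ≤ |P| / (b + P) := by gcongr; exact neg_le_abs P
          _ ≤ _ := by gcongr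
      · have := log_le_sub_one_of_pos (div_pos hbP0 hb)
        refine this.trans ?_
        have e : (b + P) / b - 1 = P / b := by field_simp; ring
        rw [e]
        calc P / b ≤ |P| / b := by gcongr; exact le_abs_self P
          _ ≤ _ := by gcongr; exact h.η_le
    refine h1.trans ?_
    have h2 := h.abs_P
    have h3 : δ ≤ δ * (1 - log δ) := by nlinarith
    calc |P| / (2 * η) ≤ K * (δ * (1 - log δ)) / (2 * η) := by
          gcongr
          exact h2.trans (by gcongr)
      _ = _ := by ring
  have e4 : (∫ t in Ioo (0 : ℝ) 1, sideWeight D ζ P R t)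
        - (weightConstant D b - log (b * ζ + P) / (4 * b))
      = ((∫ t in Ioo (0 : ℝ) 1, sideRegularPart D b ζ P R t)
        - ∫ t in Ioo (0 : ℝ) 1, regularPart D b t) + (log (b + P) - log b) / (4 * b) := by
    rw [e1, weightConstant]
    ring
  rw [e4]
  refine (abs_add_le _ _).trans ?_
  rw [abs_div, abs_of_pos (by positivity : 0 < 4 * b), add_mul]
  refine add_le_add e2 ?_
  calc |log (b + P) - log b| / (4 * b) ≤ K / (2 * η) * (δ * (1 - log δ)) / (4 * b) := by gcongr
    _ = _ := by ring

end

/-! ### The logarithmic derivative at the endpoint -/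

/-- The (negative, doubled) logarithmic derivative at `1` of a solution of the Volterra equation. -/
noncomputable def volterraFlux (n : ℕ) (v Q : ℝ → ℝ) : ℝ :=
  (∫ t in Ioo (0 : ℝ) 1, t ^ n * v t * Q t) / Q 1

section

variable {n : ℕ} {v v' Q Q' : ℝ → ℝ} {σ : ℝ}

lemma volterraFlux_eq (n : ℕ) (v Q : ℝ → ℝ) :
    volterraFlux n v Q = ∫ t in Ioo (0 : ℝ) 1, v t * (t ^ n * (Q t / Q 1)) := by
  rw [volterraFlux, ← integral_div]
  congr 1
  ext t
  ring

lemma abs_ratio_sub_le (h : IsVolterraSol n v Q) (h' : IsVolterraSol n v' Q') {S : ℝ}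
    (hS : ∀ τ ∈ Icc (0 : ℝ) 1, |Q τ - Q' τ| ≤ S) {t : ℝ} (ht : t ∈ Ioo (0 : ℝ) 1) :
    |t ^ n * (Q t / Q 1) - t ^ n * (Q' t / Q' 1)| ≤ 8 * S := by
  have ht' := Ioo_subset_Icc_self ht
  have h1 := h.half_le_one
  have h1' := h'.half_le_one
  have hq := h'.abs_le ht'
  have s1 := hS 1 ⟨zero_le_one, le_rfl⟩
  have s2 := hS t ht'
  have hS0 : 0 ≤ S := (abs_nonneg _).trans s1
  have p1 : 0 < Q 1 := by linarith
  have p1' : 0 < Q' 1 := by linarith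
  have e : t ^ n * (Q t / Q 1) - t ^ n * (Q' t / Q' 1)
      = t ^ n * ((Q t - Q' t) / Q 1 + Q' t * ((Q' 1 - Q 1) / (Q 1 * Q' 1))) := by
    field_simp
    ring
  rw [e, abs_mul, abs_of_nonneg (pow_nonneg ht.1.le n)]
  have b1 : |(Q t - Q' t) / Q 1| ≤ S / (1 / 2) := by
    rw [abs_div, abs_of_pos p1]
    gcongr
  have b2 : |Q' t * ((Q' 1 - Q 1) / (Q 1 * Q' 1))| ≤ 3 / 2 * (S / (1 / 2 * (1 / 2))) := by
    rw [abs_mul, abs_div, abs_of_pos (by positivity : 0 < Q 1 * Q' 1), abs_sub_comm]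
    gcongr
  have b3 : t ^ n ≤ 1 := pow_le_one₀ ht.1.le ht.2.le
  calc _ ≤ 1 * (S / (1 / 2) + 3 / 2 * (S / (1 / 2 * (1 / 2)))) := by
        gcongr
        exact (abs_add_le _ _).trans (add_le_add b1 b2)
    _ = 8 * S := by ring

lemma abs_ratio_le (h : IsVolterraSol n v Q) {t : ℝ} (ht : t ∈ Ioo (0 : ℝ) 1) :
    |t ^ n * (Q t / Q 1)| ≤ 3 := by
  have h1 := h.half_le_one
  have hq := h.abs_le (Ioo_subset_Icc_self ht)
  have b3 : t ^ n ≤ 1 := pow_le_one₀ ht.1.le ht.2.le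
  rw [abs_mul, abs_div, abs_of_nonneg (pow_nonneg ht.1.le n), abs_of_pos (by linarith : 0 < Q 1)]
  calc t ^ n * (|Q t| / Q 1) ≤ 1 * (3 / 2 / (1 / 2)) := by gcongr
    _ = 3 := by norm_num

lemma measurable_ratio (h : IsVolterraSol n v Q) : Measurable fun t => t ^ n * (Q t / Q 1) := by
  have := h.cont.measurable
  fun_prop

lemma integrableOn_mul_ratio (hv : IntegrableOn v (Ioo 0 1)) (h : IsVolterraSol n v' Q) :
    IntegrableOn (fun t => v t * (t ^ n * (Q t / Q 1))) (Ioo 0 1) := by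
  apply hv.mul_bdd (c := 3) (measurable_ratio h).aestronglyMeasurable
  filter_upwards [ae_restrict_mem measurableSet_Ioo] with t ht
  exact abs_ratio_le h ht

/-- The modulus of continuity of Q at 1 handles the quotient and Bernoulli's inequality handles t^n.
The resulting factor 1 - t cancels the singularity of the weight, so that `fluxConstant` converges.
-/
lemma abs_ratio_sub_one_le (hn : 1 ≤ n) (hv : IsSmallWeight n v) (h : IsVolterraSol n v Q) {C : ℝ}
    (hC : ∀ t ∈ Ioo (0 : ℝ) 1, |v t| ≤ C / (1 - t)) {t : ℝ} (ht : t ∈ Ioo (0 : ℝ) 1) :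
    |t ^ n * (Q t / Q 1) - 1| ≤ (2 * C + n) * ((1 - t) * (1 - log (1 - t))) := by
  have h1 := h.half_le_one
  have p1 : 0 < Q 1 := by linarith
  have hz : 0 < 1 - t := by linarith [ht.2]
  have hlog : log (1 - t) ≤ 0 := log_nonpos hz.le (by linarith [ht.1])
  have hmod := h.abs_one_sub_le hn hv hC ht
  have b3 : t ^ n ≤ 1 := pow_le_one₀ ht.1.le ht.2.le
  have b4 : 1 - t ^ n ≤ n * (1 - t) := by
    have := one_add_mul_le_pow (by linarith [ht.1] : (-2 : ℝ) ≤ t - 1) n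
    rw [add_sub_cancel] at this
    linarith
  have e : t ^ n * (Q t / Q 1) - 1 = -(t ^ n * ((Q 1 - Q t) / Q 1)) - (1 - t ^ n) := by
    field_simp
    ring
  rw [e]
  refine (abs_sub _ _).trans ?_
  rw [abs_neg, abs_mul, abs_div, abs_of_nonneg (pow_nonneg ht.1.le n), abs_of_pos p1,
    abs_of_nonneg (by linarith : 0 ≤ 1 - t ^ n), add_mul]
  apply add_le_add
  · have hnn := (abs_nonneg _).trans hmod
    calc t ^ n * (|Q 1 - Q t| / Q 1)
        ≤ 1 * (C * ((1 - t) * (1 - log (1 - t))) / (1 / 2)) := by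
          gcongr
      _ = _ := by ring
  · refine b4.trans ?_
    have : 1 - t ≤ (1 - t) * (1 - log (1 - t)) := by nlinarith
    gcongr

lemma isSmallWeight_const_mul (hσ : |σ| = 1) (hv : IsSmallWeight n v) :
    IsSmallWeight n fun t => σ * v t := by
  refine ⟨hv.meas.const_mul σ, ?_, ?_⟩
  · simpa [abs_mul, hσ] using hv.integrable
  · simpa [abs_mul, hσ] using hv.small

variable {D : ℝ → ℝ} {b C K η δ ζ P R : ℝ}

lemma isSmallWeight_limitWeight (hD : IsSideProfile D b C)
    (hs : ∫ t in Ioo (0 : ℝ) 1, (1 - t ^ n) / (2 * n) * |limitWeight D t| ≤ 1 / 4) :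
    IsSmallWeight n (limitWeight D) :=
  ⟨measurable_limitWeight hD.meas, integrableOn_one_sub_mul_limitWeight hD, by linarith⟩

/-- The limit weight uses 1/4 of the contraction constant and the perturbation at most 1/12, which
adds up to 1/3. -/
lemma isSmallWeight_sideWeight (hn : 1 ≤ n) (hD : IsSideProfile D b C)
    (hs : ∫ t in Ioo (0 : ℝ) 1, (1 - t ^ n) / (2 * n) * |limitWeight D t| ≤ 1 / 4)
    (h : IsAdmissible b K η δ ζ P R)
    (hsmall : (2 * K ^ 2 / (η * b) + K / b) * (δ * (1 - log δ)) ≤ 1 / 12) :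
    IsSmallWeight n (sideWeight D ζ P R) := by
  have hm := measurable_sideWeight hD.meas ζ P R
  have hm' := measurable_limitWeight hD.meas
  have i1 := integrableOn_one_sub_mul_sideWeight hD h
  have i2 := integrableOn_one_sub_mul_limitWeight hD
  have i3 : IntegrableOn (fun t => (1 - t) * |sideWeight D ζ P R t - limitWeight D t|) (Ioo 0 1) := by
    apply Integrable.mono' (i1.add i2) (by fun_prop)
    filter_upwards [ae_restrict_mem measurableSet_Ioo] with t ht
    have h0 : 0 ≤ 1 - t := by linarith [ht.2]
    rw [Real.norm_of_nonneg (by positivity)]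
    simp only [Pi.add_apply]
    rw [← mul_add]
    gcongr
    exact abs_sub _ _
  refine ⟨hm, i1, ?_⟩
  have b1 := integral_one_sub_mul_abs_sub_le hD h
  have i4 := integrableOn_one_sub_pow_mul hn hm' i2
  calc ∫ t in Ioo (0 : ℝ) 1, (1 - t ^ n) / (2 * n) * |sideWeight D ζ P R t|
      ≤ ∫ t in Ioo (0 : ℝ) 1, ((1 - t ^ n) / (2 * n) * |limitWeight D t|
          + (1 - t) * |sideWeight D ζ P R t - limitWeight D t|) := by
        apply setIntegral_mono_on (integrableOn_one_sub_pow_mul hn hm i1) (i4.add i3)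
          measurableSet_Ioo
        intro t ht
        have h1 := one_sub_pow_div_nonneg n ht.1.le ht.2.le
        have h2 := one_sub_pow_div_le hn ht.1.le
        have h3 : (1 - t ^ n) / (2 * n) ≤ 1 - t := by linarith [ht.2]
        have h4 : |sideWeight D ζ P R t| ≤ |limitWeight D t|
            + |sideWeight D ζ P R t - limitWeight D t| := by
          have := abs_add_le (limitWeight D t) (sideWeight D ζ P R t - limitWeight D t)
          rwa [add_sub_cancel] at this
        calc _ ≤ (1 - t ^ n) / (2 * n) * (|limitWeight D t|
            + |sideWeight D ζ P R t - limitWeight D t|) := by gcongr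
          _ ≤ _ := by
            rw [mul_add]
            exact add_le_add le_rfl (mul_le_mul_of_nonneg_right h3 (abs_nonneg _))
    _ ≤ _ := by
        rw [integral_add i4 i3]
        linarith

/-- The limit of the flux after removal of the integral of the weight. -/
noncomputable def fluxConstant (n : ℕ) (v Q : ℝ → ℝ) : ℝ :=
  ∫ t in Ioo (0 : ℝ) 1, v t * (t ^ n * (Q t / Q 1) - 1)

lemma integrableOn_limitWeight_mul (hσ : |σ| = 1) (hD : IsSideProfile D b C) (hn : 1 ≤ n)
    (hw : IsSmallWeight n fun t => σ * limitWeight D t)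
    (hQ : IsVolterraSol n (fun t => σ * limitWeight D t) Q) :
    IntegrableOn (fun t => σ * limitWeight D t * (t ^ n * (Q t / Q 1) - 1)) (Ioo 0 1) := by
  have hb := hD.b_pos
  have hm := measurable_limitWeight hD.meas
  have hi := (integrableOn_Ioo_comp_one_sub integrableOn_one_sub_log).const_mul
    (1 / b * (2 * (1 / b) + n))
  apply Integrable.mono' hi
    (((hm.const_mul σ).mul ((measurable_ratio hQ).sub_const 1)).aestronglyMeasurable)
  filter_upwards [ae_restrict_mem measurableSet_Ioo] with t ht
  have hz : 0 < 1 - t := by linarith [ht.2]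
  have hl : ∀ t ∈ Ioo (0 : ℝ) 1, |σ * limitWeight D t| ≤ 1 / b / (1 - t) := by
    intro t ht
    rw [abs_mul, hσ, one_mul, div_div]
    exact abs_limitWeight_le hD ht
  have h1 := hl t ht
  have h2 := abs_ratio_sub_one_le hn hw hQ hl ht
  change ‖σ * limitWeight D t * (t ^ n * (Q t / Q 1) - 1)‖ ≤ _
  rw [norm_mul]
  calc _ ≤ 1 / b / (1 - t) * ((2 * (1 / b) + n) * ((1 - t) * (1 - log (1 - t)))) := by
        gcongr <;> assumption
    _ = _ := by field_simp

/-- The asymptotics of the flux up to errors of size `δ (log δ)²`. -/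
theorem exists_flux_bound (hn : 1 ≤ n) (hσ : |σ| = 1) (hD : IsSideProfile D b C)
    (hs : ∫ t in Ioo (0 : ℝ) 1, (1 - t ^ n) / (2 * n) * |limitWeight D t| ≤ 1 / 4)
    {Q₀ : ℝ → ℝ} (hQ₀ : IsVolterraSol n (fun t => σ * limitWeight D t) Q₀) (K η : ℝ) :
    ∃ A : ℝ, ∀ δ ζ P R, IsAdmissible b K η δ ζ P R →
      IsSmallWeight n (sideWeight D ζ P R) →
      ∀ Q, IsVolterraSol n (fun t => σ * sideWeight D ζ P R t) Q →
      |volterraFlux n (fun t => σ * sideWeight D ζ P R t) Q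
        - (σ * (weightConstant D b - log (b * ζ + P) / (4 * b))
          + fluxConstant n (fun t => σ * limitWeight D t) Q₀)| ≤ A * (δ * (1 - log δ) ^ 2) := by
  obtain ⟨A₁, hA₁⟩ := exists_integral_sideWeight_bound hD K η
  set C₁ := 2 * K ^ 2 / (η * b) + K / b with hC₁
  set C₅ := 2 * (1 / b) + (n : ℝ) with hC₅
  refine ⟨|A₁| + C₁ * C₅ * 2 + 16 * C₁ * ((|log K| + 1) / η), fun δ ζ P R h hw Q hQ => ?_⟩
  have hb := hD.b_pos
  have hη := h.η_pos
  have hδ := h.δ_pos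
  have hK : 0 < K := by linarith [h.K_ge]
  have hlogδ : log δ ≤ 0 := log_nonpos hδ.le h.δ_lt.le
  have hC₁0 : 0 ≤ C₁ := by positivity
  have hC₅0 : 0 ≤ C₅ := by positivity
  have hw0 := isSmallWeight_limitWeight hD hs
  have hwσ := isSmallWeight_const_mul hσ hw
  have hw0σ := isSmallWeight_const_mul hσ hw0
  have hVi := integrableOn_sideWeight hD h
  have hl : ∀ t ∈ Ioo (0 : ℝ) 1, |σ * limitWeight D t| ≤ 1 / b / (1 - t) := by
    intro t ht
    rw [abs_mul, hσ, one_mul, div_div]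
    exact abs_limitWeight_le hD ht
  have hstab : ∀ τ ∈ Icc (0 : ℝ) 1, |Q τ - Q₀ τ| ≤ 2 * (C₁ * (δ * (1 - log δ))) := by
    intro τ hτ
    refine (hQ.abs_sub_le hn hwσ hw0σ hQ₀ hτ).trans ?_
    have := integral_one_sub_mul_abs_sub_le hD h
    simp_rw [← mul_sub, abs_mul, hσ, one_mul]
    linarith
  have i0 := integrableOn_limitWeight_mul hσ hD hn hw0σ hQ₀
  have i1 : IntegrableOn (fun t => σ * sideWeight D ζ P R t * (t ^ n * (Q t / Q 1))) (Ioo 0 1) :=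
    integrableOn_mul_ratio (hVi.const_mul σ) hQ
  have i1' : IntegrableOn (fun t => σ * sideWeight D ζ P R t * (t ^ n * (Q₀ t / Q₀ 1)))
      (Ioo 0 1) := integrableOn_mul_ratio (hVi.const_mul σ) hQ₀
  have i2 : IntegrableOn (fun t => σ * sideWeight D ζ P R t) (Ioo 0 1) := hVi.const_mul σ
  have i3 : IntegrableOn (fun t => σ * sideWeight D ζ P R t * (t ^ n * (Q₀ t / Q₀ 1) - 1))
      (Ioo 0 1) := by
    simp_rw [mul_sub, mul_one]
    exact i1'.sub i2
  -- The integral of the weight alone carries the divergence and is subtracted first. What is left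
  -- compares with the limit in two moves: the weight changes while Q₀ is kept, and then Q₀ changes
  -- to Q under the perturbed weight.
  have e1 : volterraFlux n (fun t => σ * sideWeight D ζ P R t) Q
      - σ * (∫ t in Ioo (0 : ℝ) 1, sideWeight D ζ P R t)
      - fluxConstant n (fun t => σ * limitWeight D t) Q₀
      = (∫ t in Ioo (0 : ℝ) 1, σ * (sideWeight D ζ P R t - limitWeight D t)
          * (t ^ n * (Q₀ t / Q₀ 1) - 1))
        + ∫ t in Ioo (0 : ℝ) 1, σ * sideWeight D ζ P R t
          * (t ^ n * (Q t / Q 1) - t ^ n * (Q₀ t / Q₀ 1)) := by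
    have a1 : ∫ t in Ioo (0 : ℝ) 1, σ * (sideWeight D ζ P R t - limitWeight D t)
          * (t ^ n * (Q₀ t / Q₀ 1) - 1)
        = (∫ t in Ioo (0 : ℝ) 1, σ * sideWeight D ζ P R t * (t ^ n * (Q₀ t / Q₀ 1) - 1))
          - ∫ t in Ioo (0 : ℝ) 1, σ * limitWeight D t * (t ^ n * (Q₀ t / Q₀ 1) - 1) := by
      rw [← integral_sub i3 i0]
      congr 1
      ext t
      ring
    have a2 : ∫ t in Ioo (0 : ℝ) 1, σ * sideWeight D ζ P R t * (t ^ n * (Q₀ t / Q₀ 1) - 1)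
        = (∫ t in Ioo (0 : ℝ) 1, σ * sideWeight D ζ P R t * (t ^ n * (Q₀ t / Q₀ 1)))
          - σ * ∫ t in Ioo (0 : ℝ) 1, sideWeight D ζ P R t := by
      rw [← integral_const_mul, ← integral_sub i1' i2]
      congr 1
      ext t
      ring
    have a3 : ∫ t in Ioo (0 : ℝ) 1, σ * sideWeight D ζ P R t
          * (t ^ n * (Q t / Q 1) - t ^ n * (Q₀ t / Q₀ 1))
        = (∫ t in Ioo (0 : ℝ) 1, σ * sideWeight D ζ P R t * (t ^ n * (Q t / Q 1)))
          - ∫ t in Ioo (0 : ℝ) 1, σ * sideWeight D ζ P R t * (t ^ n * (Q₀ t / Q₀ 1)) := by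
      rw [← integral_sub i1 i1']
      congr 1
      ext t
      ring
    rw [a1, a2, a3, volterraFlux_eq, fluxConstant]
    ring
  have b1 : |∫ t in Ioo (0 : ℝ) 1, σ * (sideWeight D ζ P R t - limitWeight D t)
          * (t ^ n * (Q₀ t / Q₀ 1) - 1)| ≤ C₁ * C₅ * 2 * (δ * (1 - log δ) ^ 2) := by
    have hi := (integrableOn_Ioo_comp_one_sub
      (integrableOn_min_one_div_mul_log hδ.le)).const_mul (C₁ * C₅)
    rw [← Real.norm_eq_abs]
    refine (norm_integral_le_of_norm_le hi ?_).trans ?_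
    · filter_upwards [ae_restrict_mem measurableSet_Ioo] with t ht
      have hz : 0 < 1 - t := by linarith [ht.2]
      have h1 := abs_sideWeight_sub_limitWeight_le hD h ht
      have h2 := abs_ratio_sub_one_le hn hw0σ hQ₀ hl ht
      have hm : 0 ≤ min 1 (δ / (1 - t)) := le_min zero_le_one (by positivity)
      rw [norm_mul, norm_mul, Real.norm_eq_abs, hσ, one_mul]
      calc _ ≤ C₁ * (min 1 (δ / (1 - t)) / (1 - t)) * (C₅ * ((1 - t) * (1 - log (1 - t)))) := by
            gcongr <;> assumption
        _ = _ := by field_simp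
    · rw [integral_const_mul,
        integral_Ioo_comp_one_sub (fun z => min 1 (δ / z) * (1 - log z)), mul_assoc (C₁ * C₅)]
      gcongr
      exact integral_min_one_div_mul_log_le hδ h.δ_lt
  have b2 : |∫ t in Ioo (0 : ℝ) 1, σ * sideWeight D ζ P R t
          * (t ^ n * (Q t / Q 1) - t ^ n * (Q₀ t / Q₀ 1))|
      ≤ 16 * C₁ * ((|log K| + 1) / η) * (δ * (1 - log δ) ^ 2) := by
    have hi := hVi.abs.mul_const (8 * (2 * (C₁ * (δ * (1 - log δ)))))
    rw [← Real.norm_eq_abs]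
    refine (norm_integral_le_of_norm_le hi ?_).trans ?_
    · filter_upwards [ae_restrict_mem measurableSet_Ioo] with t ht
      rw [norm_mul, norm_mul, Real.norm_eq_abs, hσ, one_mul]
      gcongr
      · exact le_rfl
      · exact abs_ratio_sub_le hQ hQ₀ hstab ht
    · rw [integral_mul_const]
      have h1 := integral_abs_sideWeight_le hD h
      have h2 : (log K - log δ) / η ≤ (|log K| + 1) / η * (1 - log δ) := by
        rw [div_mul_eq_mul_div]
        gcongr
        nlinarith [le_abs_self (log K), abs_nonneg (log K)]
      have h3 : 0 ≤ 8 * (2 * (C₁ * (δ * (1 - log δ)))) := by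
        have : 0 ≤ 1 - log δ := by linarith
        positivity
      calc _ ≤ (|log K| + 1) / η * (1 - log δ) * (8 * (2 * (C₁ * (δ * (1 - log δ))))) :=
            mul_le_mul_of_nonneg_right (h1.trans h2) h3
        _ = _ := by ring
  have b3 : |σ * ((∫ t in Ioo (0 : ℝ) 1, sideWeight D ζ P R t)
      - (weightConstant D b - log (b * ζ + P) / (4 * b)))| ≤ |A₁| * (δ * (1 - log δ) ^ 2) := by
    rw [abs_mul, hσ, one_mul]
    refine (hA₁ δ ζ P R h).trans ?_
    have h1 : δ * (1 - log δ) ≤ δ * (1 - log δ) ^ 2 := by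
      gcongr
      nlinarith
    have h2 : 0 ≤ δ * (1 - log δ) := mul_nonneg hδ.le (by linarith)
    calc A₁ * (δ * (1 - log δ)) ≤ |A₁| * (δ * (1 - log δ)) :=
          mul_le_mul_of_nonneg_right (le_abs_self _) h2
      _ ≤ _ := by gcongr
  have e2 : volterraFlux n (fun t => σ * sideWeight D ζ P R t) Q
        - (σ * (weightConstant D b - log (b * ζ + P) / (4 * b))
          + fluxConstant n (fun t => σ * limitWeight D t) Q₀)
      = (volterraFlux n (fun t => σ * sideWeight D ζ P R t) Q
      - σ * (∫ t in Ioo (0 : ℝ) 1, sideWeight D ζ P R t)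
      - fluxConstant n (fun t => σ * limitWeight D t) Q₀)
      + σ * ((∫ t in Ioo (0 : ℝ) 1, sideWeight D ζ P R t)
      - (weightConstant D b - log (b * ζ + P) / (4 * b))) := by ring
  rw [e2, e1]
  refine (abs_add_le _ _).trans ?_
  have := abs_add_le (∫ t in Ioo (0 : ℝ) 1, σ * (sideWeight D ζ P R t - limitWeight D t)
          * (t ^ n * (Q₀ t / Q₀ 1) - 1)) (∫ t in Ioo (0 : ℝ) 1, σ * sideWeight D ζ P R t
          * (t ^ n * (Q t / Q 1) - t ^ n * (Q₀ t / Q₀ 1)))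
  linarith

/-- For a fixed cut-off the flux depends on the shift `P` in a Lipschitz way. -/
theorem abs_flux_sub_le (hn : 1 ≤ n) (hσ : |σ| = 1) (hD : IsSideProfile D b C) {P' : ℝ}
    (h : IsAdmissible b K η δ ζ P R) (h' : IsAdmissible b K η δ ζ P' R)
    (hw : IsSmallWeight n (sideWeight D ζ P R)) (hw' : IsSmallWeight n (sideWeight D ζ P' R))
    (hQ : IsVolterraSol n (fun t => σ * sideWeight D ζ P R t) Q)
    (hQ' : IsVolterraSol n (fun t => σ * sideWeight D ζ P' R t) Q') :
    |volterraFlux n (fun t => σ * sideWeight D ζ P R t) Q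
      - volterraFlux n (fun t => σ * sideWeight D ζ P' R t) Q'|
      ≤ (3 / (η * ζ) ^ 2 + 16 / (η * ζ) ^ 3) * |P - P'| := by
  have hη := h.η_pos
  have hζ := h.ζ_pos
  have hwσ := isSmallWeight_const_mul hσ hw
  have hwσ' := isSmallWeight_const_mul hσ hw'
  have hVi := integrableOn_sideWeight hD h
  have hVi' := integrableOn_sideWeight hD h'
  have hvol : volume.real (Ioo (0 : ℝ) 1) = 1 := by simp
  -- With the cut fixed, all weights are bounded by 1/(ηζ). The constants degenerate as ζ → 0, but
  -- the estimate only has to give continuity in P.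
  have hdiff : ∀ t ∈ Ioo (0 : ℝ) 1, |sideWeight D ζ P R t - sideWeight D ζ P' R t|
      ≤ |P - P'| / (η * ζ) ^ 2 := by
    intro t ht
    unfold sideWeight
    split_ifs with hc
    · have hz : ζ ≤ 1 - t := by linarith
      refine (abs_inv_sub_inv_le (one_le_one_add_sq ht.1) (by positivity : 0 < η * ζ)
        (by positivity : 0 < η * ζ) ?_ ?_).trans (le_of_eq ?_)
      · exact le_trans (by gcongr) (h.le_denom hD ht hc)
      · exact le_trans (by gcongr) (h'.le_denom hD ht hc)
      · rw [sq]
        congr 2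
        ring
    · rw [sub_self, abs_zero]
      positivity
  have hE : ∫ t in Ioo (0 : ℝ) 1, (1 - t) * |σ * sideWeight D ζ P R t - σ * sideWeight D ζ P' R t|
      ≤ |P - P'| / (η * ζ) ^ 2 := by
    have := norm_setIntegral_le_of_norm_le_const (μ := volume) (s := Ioo (0 : ℝ) 1)
      (f := fun t => (1 - t) * |σ * sideWeight D ζ P R t - σ * sideWeight D ζ P' R t|)
      (C := |P - P'| / (η * ζ) ^ 2) (by simp) (fun t ht => by
        have h0 : 0 ≤ 1 - t := by linarith [ht.2]
        rw [← mul_sub, abs_mul, hσ, one_mul, Real.norm_of_nonneg (by positivity)]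
        exact (mul_le_of_le_one_left (abs_nonneg _) (by linarith [ht.1])).trans (hdiff t ht))
    rw [hvol, mul_one] at this
    exact (le_abs_self _).trans this
  have hstab : ∀ τ ∈ Icc (0 : ℝ) 1, |Q τ - Q' τ| ≤ 2 * (|P - P'| / (η * ζ) ^ 2) := fun τ hτ =>
    (hQ.abs_sub_le hn hwσ hwσ' hQ' hτ).trans (by linarith)
  have i1 : IntegrableOn (fun t => σ * sideWeight D ζ P R t * (t ^ n * (Q t / Q 1))) (Ioo 0 1) :=
    integrableOn_mul_ratio (hVi.const_mul σ) hQ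
  have i2 : IntegrableOn (fun t => σ * sideWeight D ζ P' R t * (t ^ n * (Q' t / Q' 1)))
      (Ioo 0 1) := integrableOn_mul_ratio (hVi'.const_mul σ) hQ'
  rw [volterraFlux_eq, volterraFlux_eq, ← integral_sub i1 i2]
  have := norm_setIntegral_le_of_norm_le_const (μ := volume) (s := Ioo (0 : ℝ) 1)
    (f := fun t => σ * sideWeight D ζ P R t * (t ^ n * (Q t / Q 1))
      - σ * sideWeight D ζ P' R t * (t ^ n * (Q' t / Q' 1)))
    (C := (3 / (η * ζ) ^ 2 + 16 / (η * ζ) ^ 3) * |P - P'|) (by simp) (fun t ht => by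
      have e : σ * sideWeight D ζ P R t * (t ^ n * (Q t / Q 1))
          - σ * sideWeight D ζ P' R t * (t ^ n * (Q' t / Q' 1))
          = σ * ((sideWeight D ζ P R t - sideWeight D ζ P' R t) * (t ^ n * (Q t / Q 1))
            + sideWeight D ζ P' R t * (t ^ n * (Q t / Q 1) - t ^ n * (Q' t / Q' 1))) := by ring
      rw [e, norm_mul, Real.norm_eq_abs, hσ, one_mul]
      refine (norm_add_le _ _).trans ?_
      rw [norm_mul, norm_mul (sideWeight D ζ P' R t)]
      have a1 := hdiff t ht
      have a2 := abs_ratio_le hQ ht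
      have a3 := abs_sideWeight_le' hD h' ht
      have a4 := abs_ratio_sub_le hQ hQ' hstab ht
      calc _ ≤ |P - P'| / (η * ζ) ^ 2 * 3 + 1 / (η * ζ) * (8 * (2 * (|P - P'| / (η * ζ) ^ 2))) := by
            gcongr <;> assumption
        _ = _ := by
            field_simp
            ring)
  rwa [hvol, mul_one] at this

end

/-! ### The inner and the outer profile -/

/-- The slope at the critical radius of the limit profiles. -/
noncomputable def criticalSlope : ℝ := (log 2 - 1 / 2) / 2

/-- The angular velocity at radius `√t` relative to the one at radius `1`. -/
noncomputable def innerProfile (t : ℝ) : ℝ := (logSlope t - log 2) / 2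

/-- The angular velocity at radius `1` relative to the one at radius `1/√t`. -/
noncomputable def outerProfile (t : ℝ) : ℝ := (log 2 - t * (log (1 + t) - log t)) / 2

lemma criticalSlope_pos : 0 < criticalSlope := by
  unfold criticalSlope
  linarith [log_two_gt_d9]

lemma criticalSlope_lt : criticalSlope < 1 / 10 := by
  unfold criticalSlope
  linarith [log_two_lt_d9]

lemma measurable_logSlope : Measurable logSlope := by
  have : logSlope = fun t => if t = 0 then 1 else log (1 + t) / t := by
    ext t
    split_ifs with h
    · rw [h, logSlope_zero]
    · exact logSlope_of_ne h
  rw [this]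
  exact Measurable.ite (measurableSet_singleton 0) measurable_const (by fun_prop)

/-- The inequality x ≤ sinh x at x = log y. It agrees with the logarithm to second order at y = 1,
which the inner profile needs near t = 1: the quadratic error of log y ≤ y - 1 would be too large
there. -/
lemma log_le_half_sub_inv {y : ℝ} (hy : 1 ≤ y) : log y ≤ (y - y⁻¹) / 2 := by
  have h0 : 0 < y := by linarith
  rw [← sinh_log h0]
  exact self_le_sinh_iff.2 (log_nonneg hy)

/-- The line with slope -b is the tangent at t = 1, so the lower bound has to be sharp to first
order there. For t ≤ 1/2 the rational bound log(1+t) ≥ 2t/(t+2) has enough room; for t ≥ 1/2 the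
hyperbolic sine bound at 2/(1+t) is precise enough. -/
lemma isSideProfile_innerProfile : IsSideProfile innerProfile criticalSlope 4 := by
  have hlow : ∀ t ∈ Ioo (0 : ℝ) 1, criticalSlope * (1 - t) ≤ innerProfile t := by
    intro t ht
    have h0 : 0 < t := ht.1
    rw [innerProfile, logSlope_of_ne h0.ne', criticalSlope]
    have l1 := log_two_gt_d9
    have l2 := log_two_lt_d9
    suffices h : t * (log 2 + (log 2 - 1 / 2) * (1 - t)) ≤ log (1 + t) by
      have := (le_div_iff₀' h0).2 h
      linarith
    rcases le_total t (1 / 2) with h | h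
    · have h1 := le_log_one_add_of_nonneg h0.le
      refine le_trans ?_ h1
      rw [mul_comm 2 t, mul_div_assoc]
      gcongr
      rw [le_div_iff₀ (by linarith)]
      have h2 : (log 2 + (log 2 - 1 / 2) * (1 - t)) * (t + 2)
          ≤ (0.6931471808 + (0.6931471808 - 1 / 2) * (1 - t)) * (t + 2) := by
        gcongr
        linarith
      refine h2.trans ?_
      nlinarith
    · have h1 := log_le_half_sub_inv (y := 2 / (1 + t)) (by rw [le_div_iff₀ (by linarith)]; linarith [ht.2])
      rw [log_div two_ne_zero (by linarith), inv_div] at h1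
      have h2 : (2 / (1 + t) - (1 + t) / 2) / 2 = (1 - t) * (3 + t) / (4 * (1 + t)) := by
        field_simp
        ring
      rw [h2] at h1
      have h3 : (1 - t) * (3 + t) / (4 * (1 + t))
          ≤ log 2 - t * (log 2 + (log 2 - 1 / 2) * (1 - t)) := by
        rw [div_le_iff₀ (by linarith)]
        have h4 : 0 ≤ (1 - t) ^ 2 * (log 2 * (4 * (1 + t)) - (3 + 2 * t)) := by
          apply mul_nonneg (sq_nonneg _)
          nlinarith
        nlinarith
      linarith
  refine ⟨criticalSlope_pos, by norm_num, ?_, hlow, ?_⟩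
  · unfold innerProfile
    exact (measurable_logSlope.sub_const _).div_const _
  · intro t ht
    have h0 : 0 < t := ht.1
    have hl := hlow t ht
    rw [abs_of_nonneg (by linarith)]
    rw [innerProfile, logSlope_of_ne h0.ne', criticalSlope] at *
    have l1 := log_two_gt_d9
    have l2 := log_two_lt_d9
    have hz : 0 < 1 - t := by linarith [ht.2]
    rcases le_total t (1 / 2) with h | h
    · have h1 : log (1 + t) / t ≤ 1 := by
        rw [div_le_one h0]
        have := log_le_sub_one_of_pos (by linarith : 0 < 1 + t)
        linarith
      nlinarith
    · have h1 := log_le_sub_one_of_pos (by linarith : 0 < (1 + t) / 2)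
      rw [log_div (by linarith) two_ne_zero] at h1
      have h2 : log (1 + t) / t - log 2 ≤ (log 2 - 1 / 2) * (1 - t) / t := by
        rw [le_div_iff₀ h0, sub_mul, div_mul_cancel₀ _ h0.ne']
        linarith
      have h3 : (log 2 - 1 / 2) * (1 - t) / t
          = (log 2 - 1 / 2) * (1 - t) + (log 2 - 1 / 2) * (1 - t) ^ 2 / t := by
        field_simp
        ring
      have h4 : (log 2 - 1 / 2) * (1 - t) ^ 2 / t ≤ 2 * (1 - t) ^ 2 := by
        rw [div_le_iff₀ h0]
        nlinarith [sq_nonneg (1 - t)]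
      nlinarith [sq_nonneg (1 - t)]

/-- The two standard bounds 1 - 1/x ≤ log x ≤ x - 1 at x = (1+t)/(2t) give the two estimates. The
slope is the inner one because r² and r⁻² have opposite derivatives at r = 1 and the sign of the
profile is reversed as well; the cancellation of log δ depends on this equality. -/
lemma isSideProfile_outerProfile : IsSideProfile outerProfile criticalSlope 4 := by
  have hq : ∀ t ∈ Ioo (0 : ℝ) 1, log ((1 + t) / (2 * t)) = log (1 + t) - log 2 - log t := by
    intro t ht
    have h0 : 0 < t := ht.1
    rw [log_div (by linarith) (by linarith), log_mul two_ne_zero h0.ne']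
    ring
  have hlow : ∀ t ∈ Ioo (0 : ℝ) 1, criticalSlope * (1 - t) ≤ outerProfile t := by
    intro t ht
    have h0 : 0 < t := ht.1
    have h1 := log_le_sub_one_of_pos (by positivity : 0 < (1 + t) / (2 * t))
    rw [hq t ht] at h1
    have h2 := mul_le_mul_of_nonneg_left h1 h0.le
    have h3 : t * ((1 + t) / (2 * t) - 1) = (1 - t) / 2 := by
      field_simp
      ring
    rw [h3] at h2
    unfold criticalSlope outerProfile
    nlinarith
  refine ⟨criticalSlope_pos, by norm_num, ?_, hlow, ?_⟩
  · unfold outerProfile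
    fun_prop
  · intro t ht
    have h0 : 0 < t := ht.1
    have hz : 0 < 1 - t := by linarith [ht.2]
    have hl := hlow t ht
    rw [abs_of_nonneg (by linarith)]
    have h1 := one_sub_inv_le_log_of_pos (by positivity : 0 < (1 + t) / (2 * t))
    rw [hq t ht, inv_div] at h1
    have h2 := mul_le_mul_of_nonneg_left h1 h0.le
    have h3 : t * (1 - 2 * t / (1 + t)) = (1 - t) / 2 - (1 - t) ^ 2 / (2 * (1 + t)) := by
      field_simp
      ring
    have h4 : (1 - t) ^ 2 / (2 * (1 + t)) ≤ (1 - t) ^ 2 := by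
      apply div_le_self (sq_nonneg _)
      linarith
    rw [h3] at h2
    unfold criticalSlope outerProfile
    nlinarith

/-- Dominated convergence: the factor is at most 1/(2n), and Bernoulli's inequality bounds it by a
multiple of 1 - t uniformly in n. This is the only place where n has to be large. -/
lemma eventually_limitWeight_small {D : ℝ → ℝ} {b C : ℝ} (hD : IsSideProfile D b C) :
    ∀ᶠ n : ℕ in Filter.atTop,
      ∫ t in Ioo (0 : ℝ) 1, (1 - t ^ n) / (2 * n) * |limitWeight D t| ≤ 1 / 4 := by
  have hm := measurable_limitWeight hD.meas
  have hlim : Filter.Tendsto (fun n : ℕ => ∫ t in Ioo (0 : ℝ) 1,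
      (1 - t ^ n) / (2 * n) * |limitWeight D t|) Filter.atTop
      (nhds (∫ _ in Ioo (0 : ℝ) 1, (0 : ℝ))) := by
    apply tendsto_integral_filter_of_dominated_convergence
      (fun t => (1 - t) * |limitWeight D t|)
    · exact Filter.Eventually.of_forall fun n => by fun_prop
    · filter_upwards [Filter.eventually_ge_atTop 1] with n hn
      filter_upwards [ae_restrict_mem measurableSet_Ioo] with t ht
      have h1 := one_sub_pow_div_nonneg n ht.1.le ht.2.le
      have h2 := one_sub_pow_div_le hn ht.1.le
      rw [Real.norm_of_nonneg (by positivity)]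
      have : (1 - t ^ n) / (2 * n) ≤ 1 - t := by linarith [ht.2]
      gcongr
    · exact integrableOn_one_sub_mul_limitWeight hD
    · filter_upwards [ae_restrict_mem measurableSet_Ioo] with t ht
      have h3 : Filter.Tendsto (fun n : ℕ => (n : ℝ)⁻¹ * |limitWeight D t|) Filter.atTop
          (nhds (0 * |limitWeight D t|)) := tendsto_inv_atTop_nhds_zero_nat.mul_const _
      rw [zero_mul] at h3
      apply squeeze_zero (fun n => ?_) (fun n => ?_) h3
      · have h1 := one_sub_pow_div_nonneg n ht.1.le ht.2.le
        positivity
      · gcongr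
        rcases Nat.eq_zero_or_pos n with rfl | hn
        · simp
        have hn' : (0 : ℝ) < n := by exact_mod_cast hn
        rw [div_le_iff₀ (by positivity)]
        have : 0 ≤ t ^ n := pow_nonneg ht.1.le n
        field_simp
        linarith
  rw [integral_zero] at hlim
  filter_upwards [hlim.eventually (gt_mem_nhds (by norm_num : (0 : ℝ) < 1 / 4))] with n hn
  exact hn.le

/-! ### Expansion of the shifts -/

/-- The product of the two denominators is exactly 4 + δ⁴/16, without lower powers of δ. -/
lemma innerShift_eq (δ : ℝ) : innerShift δ = -δ / (4 + δ ^ 4 / 16) := by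
  have h1 : (1 + (1 + δ / 2) ^ 2) ≠ 0 := by positivity
  have h2 : (1 + (1 - δ / 2) ^ 2) ≠ 0 := by positivity
  have h3 : (4 + δ ^ 4 / 16) ≠ 0 := by positivity
  have h4 : (4 + δ ^ 4 / 16) = (1 + (1 + δ / 2) ^ 2) * (1 + (1 - δ / 2) ^ 2) := by ring
  unfold innerShift vortex
  rw [inv_sub_inv h1 h2, h4, div_div, div_eq_div_iff (by positivity) (by positivity)]
  ring

lemma abs_innerShift_add_le {δ : ℝ} (hδ : 0 < δ) (hδ1 : δ < 1) :
    |innerShift δ + δ / 4| ≤ δ ^ 2 := by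
  have h3 : 0 < (4 + δ ^ 4 / 16) := by positivity
  have e : innerShift δ + δ / 4 = δ ^ 5 / 64 / (4 + δ ^ 4 / 16) := by
    rw [innerShift_eq]
    field_simp
    ring
  rw [e, abs_of_nonneg (by positivity), div_le_iff₀ h3]
  have h5 : δ ^ 5 ≤ δ ^ 2 := pow_le_pow_of_le_one hδ.le hδ1.le (by norm_num)
  have h6 : 0 ≤ δ ^ 2 * (δ ^ 4 / 16) := by positivity
  nlinarith

/-- To first order the three terms of `outerShift` are -δ/4, δ/2 and -δ/2: the flattening leaves the
circulation of the annulus unchanged and only the lowering of the inner disc counts. -/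
lemma abs_outerShift_add_le {δ : ℝ} (hδ : 0 < δ) (hδ1 : δ < 1) :
    |outerShift δ + δ / 4| ≤ 8 * δ ^ 2 := by
  have h1 : 0 < 1 + (1 + δ / 2) ^ 2 := by positivity
  have h2 : 0 < 1 + (1 - δ / 2) ^ 2 := by positivity
  have hi := abs_le.1 (abs_innerShift_add_le hδ hδ1)
  have hik : |innerShift δ * (1 - δ / 2) ^ 2 + δ / 4| ≤ 2 * δ ^ 2 := by
    have e : innerShift δ * (1 - δ / 2) ^ 2 + δ / 4
        = (innerShift δ + δ / 4) * (1 - δ / 2) ^ 2 + δ ^ 2 / 4 * (1 - δ / 4) := by ring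
    rw [e]
    refine (abs_add_le _ _).trans ?_
    have a1 : |(innerShift δ + δ / 4) * (1 - δ / 2) ^ 2| ≤ δ ^ 2 * 1 := by
      rw [abs_mul, abs_of_nonneg (sq_nonneg (1 - δ / 2))]
      gcongr
      · exact abs_innerShift_add_le hδ hδ1
      · nlinarith
    have a2 : |δ ^ 2 / 4 * (1 - δ / 4)| ≤ δ ^ 2 := by
      rw [abs_of_nonneg (mul_nonneg (by positivity) (by linarith))]
      nlinarith [sq_nonneg δ]
    linarith
  have hv : |δ * vortex (1 + δ / 2) - δ / 2| ≤ δ ^ 2 := by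
    have e : δ * vortex (1 + δ / 2) - δ / 2 = -(δ ^ 2 * (1 + δ / 4)) / (2 * (1 + (1 + δ / 2) ^ 2)) := by
      unfold vortex
      field_simp
      ring
    rw [e, abs_div, abs_neg, abs_of_nonneg (by positivity), abs_of_pos (by positivity),
      div_le_iff₀ (by positivity)]
    nlinarith [sq_nonneg δ]
  have hlog : |log (1 + (1 + δ / 2) ^ 2) - log (1 + (1 - δ / 2) ^ 2) - δ| ≤ 4 * δ ^ 2 := by
    rw [← log_div h1.ne' h2.ne']
    set x := (1 + (1 + δ / 2) ^ 2) / (1 + (1 - δ / 2) ^ 2) with hx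
    have hx0 : 0 < x := by positivity
    have u := log_le_sub_one_of_pos hx0
    have l := one_sub_inv_le_log_of_pos hx0
    have e1 : x - 1 = 2 * δ / (1 + (1 - δ / 2) ^ 2) := by
      rw [hx]
      field_simp
      ring
    have e2 : 1 - x⁻¹ = 2 * δ / (1 + (1 + δ / 2) ^ 2) := by
      rw [hx]
      field_simp
      ring
    rw [e1] at u
    rw [e2] at l
    have u' : 2 * δ / (1 + (1 - δ / 2) ^ 2) ≤ δ + 4 * δ ^ 2 := by
      rw [div_le_iff₀ h2]
      nlinarith [sq_nonneg δ, mul_pos hδ hδ, mul_pos (mul_pos hδ hδ) hδ,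
        mul_nonneg (mul_pos hδ hδ).le (sub_nonneg.2 hδ1.le)]
    have l' : δ - 4 * δ ^ 2 ≤ 2 * δ / (1 + (1 + δ / 2) ^ 2) := by
      rw [le_div_iff₀ h1]
      nlinarith [sq_nonneg δ, mul_pos hδ hδ, mul_pos (mul_pos hδ hδ) hδ,
        mul_pos (mul_pos (mul_pos hδ hδ) hδ) hδ]
    rw [abs_le]
    constructor <;> linarith
  have e : outerShift δ + δ / 4 = (innerShift δ * (1 - δ / 2) ^ 2 + δ / 4)
      + (δ * vortex (1 + δ / 2) - δ / 2)
      - (log (1 + (1 + δ / 2) ^ 2) - log (1 + (1 - δ / 2) ^ 2) - δ) / 2 := by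
    unfold outerShift
    ring
  rw [e]
  rw [abs_le] at hik hv hlog ⊢
  constructor <;> linarith [hik.1, hik.2, hv.1, hv.2, hlog.1, hlog.2, sq_nonneg δ]

/-! ### Matching the inner and the outer solution -/

/-- Width of the gap in the inner coordinate `t = r²`. -/
noncomputable def innerCut (δ : ℝ) : ℝ := 1 - (1 - δ / 2) ^ 2

/-- Width of the gap in the outer coordinate `t = r⁻²`. -/
noncomputable def outerCut (δ : ℝ) : ℝ := 1 - ((1 + δ / 2) ^ 2)⁻¹

/-- The weight of the inner Volterra equation for the angular velocity `log 2 / 2 + μ`. -/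
noncomputable def innerWeight (δ μ : ℝ) : ℝ → ℝ :=
  sideWeight innerProfile (innerCut δ) (innerShift δ - μ) 0

/-- The weight (up to the sign) of the outer Volterra equation for the angular velocity
`log 2 / 2 + μ`. -/
noncomputable def outerWeight (δ μ : ℝ) : ℝ → ℝ :=
  sideWeight outerProfile (outerCut δ) (μ - outerShift δ) (-outerShift δ)

/-- Solutions of the inner and of the outer equation whose fluxes add up to an eigenfunction of
the problem with the angular velocity `log 2 / 2 + μ`. -/
structure IsMatched (n : ℕ) (δ μ η : ℝ) (Q₁ Q₂ : ℝ → ℝ) : Prop where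
  inner_adm : IsAdmissible criticalSlope 4 η δ (innerCut δ) (innerShift δ - μ) 0
  outer_adm : IsAdmissible criticalSlope 4 η δ (outerCut δ) (μ - outerShift δ) (-outerShift δ)
  inner_sol : IsVolterraSol n (fun t => 1 * innerWeight δ μ t) Q₁
  outer_sol : IsVolterraSol n (fun t => -1 * outerWeight δ μ t) Q₂
  flux : volterraFlux n (fun t => 1 * innerWeight δ μ t) Q₁
    + volterraFlux n (fun t => -1 * outerWeight δ μ t) Q₂ = 2 * n

lemma abs_log_sub_log_le {m x y : ℝ} (hm : 0 < m) (hx : m ≤ x) (hy : m ≤ y) :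
    |log x - log y| ≤ |x - y| / m := by
  have key : ∀ x y : ℝ, m ≤ x → m ≤ y → log x - log y ≤ |x - y| / m := by
    intro x y hx hy
    have hx0 : 0 < x := by linarith
    have hy0 : 0 < y := by linarith
    rw [← log_div hx0.ne' hy0.ne']
    refine (log_le_sub_one_of_pos (div_pos hx0 hy0)).trans ?_
    have e : x / y - 1 = (x - y) / y := by field_simp
    rw [e]
    calc (x - y) / y ≤ |x - y| / y := by gcongr; exact le_abs_self _
      _ ≤ _ := by gcongr
  rw [abs_le]
  constructor
  · have := key y x hy hx
    rw [abs_sub_comm] at this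
    linarith
  · exact key x y hx hy

/-! ### Admissible parameters and the size of the profiles at the edges of the annulus. -/

section

variable {δ ℓ ρ : ℝ}

lemma innerCut_eq (δ : ℝ) : innerCut δ = δ - δ ^ 2 / 4 := by
  unfold innerCut
  ring

lemma outerCut_bounds (hδ : 0 < δ) (hδ1 : δ < 1) :
    δ - δ ^ 2 ≤ outerCut δ ∧ δ / 4 ≤ outerCut δ ∧ outerCut δ ≤ δ := by
  have h : 0 < (1 + δ / 2) ^ 2 := by positivity
  have e : outerCut δ = (δ + δ ^ 2 / 4) / (1 + δ / 2) ^ 2 := by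
    unfold outerCut
    field_simp
    ring
  rw [e, le_div_iff₀ h, le_div_iff₀ h, div_le_iff₀ h]
  refine ⟨?_, ?_, ?_⟩ <;> nlinarith [mul_pos hδ hδ, mul_pos (mul_pos hδ hδ) hδ,
    mul_pos (mul_pos (mul_pos hδ hδ) hδ) hδ, mul_nonneg (mul_pos hδ hδ).le (sub_nonneg.2 hδ1.le)]

/-- Both shifts are -δ/4 to first order, so the linearised denominator at the inner edge is δ (b -
1/4 - ℓ), and at the outer edge δ (b + 1/4 + ℓ). Inserting b gives the two endpoints of the interval
for lam₁. -/
lemma inner_gap_bound (hδ : 0 < δ) (hδ1 : δ < 1) (ℓ : ℝ) :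
    |criticalSlope * innerCut δ + (innerShift δ - δ * ℓ) - δ * (-((1 - log 2) / 2) - ℓ)|
      ≤ 9 * δ ^ 2 := by
  have h1 := abs_le.1 (abs_innerShift_add_le hδ hδ1)
  have h2 := criticalSlope_pos
  have h3 := criticalSlope_lt
  have e : criticalSlope * innerCut δ + (innerShift δ - δ * ℓ) - δ * (-((1 - log 2) / 2) - ℓ)
      = (innerShift δ + δ / 4) - criticalSlope * (δ ^ 2 / 4) := by
    rw [innerCut_eq, criticalSlope]
    ring
  rw [e, abs_le]
  constructor <;> nlinarith [sq_nonneg δ, h1.1, h1.2]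

lemma outer_gap_bound (hδ : 0 < δ) (hδ1 : δ < 1) (ℓ : ℝ) :
    |criticalSlope * outerCut δ + (δ * ℓ - outerShift δ) - δ * (ℓ + log 2 / 2)| ≤ 9 * δ ^ 2 := by
  have h1 := abs_le.1 (abs_outerShift_add_le hδ hδ1)
  have h2 := criticalSlope_pos
  have h3 := criticalSlope_lt
  obtain ⟨h4, -, h5⟩ := outerCut_bounds hδ hδ1
  have e : criticalSlope * outerCut δ + (δ * ℓ - outerShift δ) - δ * (ℓ + log 2 / 2)
      = criticalSlope * (outerCut δ - δ) - (outerShift δ + δ / 4) := by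
    rw [criticalSlope]
    ring
  rw [e, abs_le]
  constructor <;> nlinarith [sq_nonneg δ, h1.1, h1.2]

/-- Since δ ≤ ρ/64, the error 9δ² is at most (9/64) ρδ. The linearised denominator at the edge is
thus well above ρδ/4, which is at least 2ηζ for η = ρ/8 because ζ ≤ δ. -/
lemma isAdmissible_inner (hρ : 0 < ρ) (hρb : ρ ≤ criticalSlope) (hδ : 0 < δ) (hδρ : δ ≤ ρ / 64)
    (h₁ : ρ ≤ -((1 - log 2) / 2) - ℓ) (h₂ : ρ ≤ ℓ + log 2 / 2) :
    IsAdmissible criticalSlope 4 (ρ / 8) δ (innerCut δ) (innerShift δ - δ * ℓ) 0 := by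
  have h3 := criticalSlope_lt
  have hδ1 : δ < 1 / 640 := by linarith
  have l1 := log_two_gt_d9
  have l2 := log_two_lt_d9
  have hs := abs_le.1 (abs_innerShift_add_le hδ (by linarith))
  have hg := abs_le.1 (inner_gap_bound hδ (by linarith) ℓ)
  have hc := innerCut_eq δ
  have hδ2 : δ ^ 2 ≤ δ / 640 := by nlinarith
  have hm : δ * ρ ≤ δ * (-((1 - log 2) / 2) - ℓ) := by gcongr
  have hm' : δ ^ 2 ≤ δ * (ρ / 64) := by rw [sq]; gcongr
  have hl1 : δ * ℓ ≤ δ * 1 := by gcongr; linarith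
  have hl2 : δ * (-1) ≤ δ * ℓ := by gcongr; linarith
  refine ⟨hδ, by linarith, by norm_num, by positivity, by linarith, ?_, ?_, ?_, ?_, ?_, ?_, ?_⟩
  · rw [abs_le]; constructor <;> linarith [hs.1, hs.2]
  · rw [abs_zero]; positivity
  · rw [abs_zero]; positivity
  · linarith
  · linarith [sq_nonneg δ]
  · linarith [sq_nonneg δ]
  · have : ρ * innerCut δ ≤ ρ * δ := by gcongr; linarith [sq_nonneg δ]
    nlinarith [hg.1, mul_pos hδ hρ]

lemma isAdmissible_outer (hρ : 0 < ρ) (hρb : ρ ≤ criticalSlope) (hδ : 0 < δ) (hδρ : δ ≤ ρ / 64)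
    (h₁ : ρ ≤ -((1 - log 2) / 2) - ℓ) (h₂ : ρ ≤ ℓ + log 2 / 2) :
    IsAdmissible criticalSlope 4 (ρ / 8) δ (outerCut δ) (δ * ℓ - outerShift δ)
      (-outerShift δ) := by
  have h3 := criticalSlope_lt
  have hδ1 : δ < 1 / 640 := by linarith
  have l1 := log_two_gt_d9
  have l2 := log_two_lt_d9
  have hs := abs_le.1 (abs_outerShift_add_le hδ (by linarith))
  have hg := abs_le.1 (outer_gap_bound hδ (by linarith) ℓ)
  obtain ⟨-, hc1, hc2⟩ := outerCut_bounds hδ (by linarith)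
  have hδ2 : δ ^ 2 ≤ δ / 640 := by nlinarith
  have hm : δ * ρ ≤ δ * (ℓ + log 2 / 2) := by gcongr
  have hm' : δ ^ 2 ≤ δ * (ρ / 64) := by rw [sq]; gcongr
  have hl1 : δ * ℓ ≤ δ * 1 := by gcongr; linarith
  have hl2 : δ * (-1) ≤ δ * ℓ := by gcongr; linarith
  refine ⟨hδ, by linarith, by norm_num, by positivity, by linarith, ?_, ?_, ?_, ?_, ?_, ?_, ?_⟩
  · rw [abs_le]; constructor <;> linarith [hs.1, hs.2]
  · rw [abs_neg, abs_le]; constructor <;> linarith [hs.1, hs.2]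
  · rw [abs_neg, abs_le]; constructor <;> linarith [hs.1, hs.2]
  · linarith
  · linarith
  · linarith
  · have : ρ * outerCut δ ≤ ρ * δ := by gcongr
    nlinarith [hg.1, mul_pos hδ hρ]

lemma abs_log_gap_sub_le {x a : ℝ} (hρ : 0 < ρ) (hδ : 0 < δ) (hδρ : δ ≤ ρ / 64) (ha : ρ ≤ a)
    (hx : |x - δ * a| ≤ 9 * δ ^ 2) : |log x - (log δ + log a)| ≤ 18 / ρ * δ := by
  have h1 : δ * ρ ≤ δ * a := by gcongr
  have h2 : δ ^ 2 ≤ δ * (ρ / 64) := by rw [sq]; gcongr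
  have h3 := (abs_le.1 hx).1
  have h4 : 0 < δ * ρ := by positivity
  rw [← log_mul hδ.ne' (by linarith)]
  refine (abs_log_sub_log_le (m := δ * ρ / 2) (by positivity) (by linarith) (by linarith)).trans ?_
  calc |x - δ * a| / (δ * ρ / 2) ≤ 9 * δ ^ 2 / (δ * ρ / 2) := by gcongr
    _ = 18 / ρ * δ := by field_simp; norm_num

end

lemma tendsto_mul_log_sq : Filter.Tendsto (fun δ : ℝ => δ * log δ ^ 2) (nhdsWithin 0 (Ioi 0))
    (nhds 0) := by
  have h := (tendsto_log_mul_rpow_nhdsGT_zero (by norm_num : (0 : ℝ) < 1 / 2)).pow 2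
  rw [zero_pow two_ne_zero] at h
  apply h.congr'
  filter_upwards [self_mem_nhdsWithin] with δ hδ
  have hδ : 0 < δ := hδ
  rw [mul_pow, ← rpow_natCast (δ ^ (1 / 2 : ℝ)), ← rpow_mul hδ.le]
  norm_num
  ring

lemma tendsto_mul_one_sub_log : Filter.Tendsto (fun δ : ℝ => δ * (1 - log δ))
    (nhdsWithin 0 (Ioi 0)) (nhds 0) := by
  have h := tendsto_log_mul_rpow_nhdsGT_zero (by norm_num : (0 : ℝ) < 1)
  have h' : Filter.Tendsto (fun δ : ℝ => δ) (nhdsWithin 0 (Ioi 0)) (nhds 0) :=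
    tendsto_nhdsWithin_of_tendsto_nhds Filter.tendsto_id
  have := h'.sub h
  rw [sub_zero] at this
  apply this.congr
  intro δ
  rw [rpow_one]
  ring

/-- On (0, 1] the logarithm has slope at least 1, so a displacement of ℓ moves the limiting flux at
a definite rate. -/
lemma log_add_sub_log_ge {a m : ℝ} (ha : 0 < a) (hm : 0 ≤ m) (h1 : a + m ≤ 1) :
    m ≤ log (a + m) - log a := by
  have hp : 0 < a + m := by linarith
  rw [← log_div hp.ne' ha.ne']
  refine le_trans ?_ (one_sub_inv_le_log_of_pos (div_pos hp ha))
  have e : 1 - ((a + m) / a)⁻¹ = m / (a + m) := by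
    field_simp
    ring
  rw [e, le_div_iff₀ hp]
  nlinarith

/-- For every angular wave number `n` and every admissible range of parameters the fluxes are
given by an explicit logarithm up to errors of size `δ (log δ)²`. -/
theorem exists_flux_sum_bound {n : ℕ} (hn : 1 ≤ n)
    (hs₁ : ∫ t in Ioo (0 : ℝ) 1, (1 - t ^ n) / (2 * n) * |limitWeight innerProfile t| ≤ 1 / 4)
    (hs₂ : ∫ t in Ioo (0 : ℝ) 1, (1 - t ^ n) / (2 * n) * |limitWeight outerProfile t| ≤ 1 / 4) :
    ∃ E : ℝ, ∀ ρ, 0 < ρ → ρ ≤ criticalSlope → ∃ B : ℝ, 0 ≤ B ∧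
      ∀ δ ℓ, 0 < δ → δ ≤ ρ / 64 → δ < exp (-1) →
      ρ ≤ -((1 - log 2) / 2) - ℓ → ρ ≤ ℓ + log 2 / 2 →
      IsSmallWeight n (innerWeight δ (δ * ℓ)) → IsSmallWeight n (outerWeight δ (δ * ℓ)) →
      ∀ Q₁ Q₂, IsVolterraSol n (fun t => 1 * innerWeight δ (δ * ℓ) t) Q₁ →
      IsVolterraSol n (fun t => -1 * outerWeight δ (δ * ℓ) t) Q₂ →
      |volterraFlux n (fun t => 1 * innerWeight δ (δ * ℓ) t) Q₁
        + volterraFlux n (fun t => -1 * outerWeight δ (δ * ℓ) t) Q₂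
        - (E + (log (ℓ + log 2 / 2) - log (-((1 - log 2) / 2) - ℓ)) / (4 * criticalSlope))|
        ≤ B * (δ * log δ ^ 2) := by
  have hD₁ := isSideProfile_innerProfile
  have hD₂ := isSideProfile_outerProfile
  have a1 : |(1 : ℝ)| = 1 := abs_one
  have a2 : |(-1 : ℝ)| = 1 := by simp
  obtain ⟨Q₀₁, h₀₁⟩ := exists_isVolterraSol hn
    (isSmallWeight_const_mul a1 (isSmallWeight_limitWeight hD₁ hs₁))
  obtain ⟨Q₀₂, h₀₂⟩ := exists_isVolterraSol hn
    (isSmallWeight_const_mul a2 (isSmallWeight_limitWeight hD₂ hs₂))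
  set b := criticalSlope with hb
  have hb0 : 0 < b := criticalSlope_pos
  -- The constant is built from the limit weights only and precedes ρ: it determines lam₁, and ρ is
  -- then chosen in terms of lam₁.
  refine ⟨(weightConstant innerProfile b + fluxConstant n (fun t => 1 * limitWeight innerProfile t) Q₀₁)
    + (-weightConstant outerProfile b + fluxConstant n (fun t => -1 * limitWeight outerProfile t) Q₀₂),
    fun ρ hρ hρb => ?_⟩
  obtain ⟨A₁, hA₁⟩ := exists_flux_bound hn a1 hD₁ hs₁ h₀₁ 4 (ρ / 8)
  obtain ⟨A₂, hA₂⟩ := exists_flux_bound hn a2 hD₂ hs₂ h₀₂ 4 (ρ / 8)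
  refine ⟨4 * (|A₁| + |A₂|) + 9 / (ρ * b), by positivity, ?_⟩
  intro δ ℓ hδ hδρ hδe h₁ h₂ w₁ w₂ Q₁ Q₂ hQ₁ hQ₂
  have hb1 := criticalSlope_lt
  have hδ1 : δ < 1 := by linarith
  have f1 := hA₁ _ _ _ _ (isAdmissible_inner hρ hρb hδ hδρ h₁ h₂) w₁ Q₁ hQ₁
  have f2 := hA₂ _ _ _ _ (isAdmissible_outer hρ hρb hδ hδρ h₁ h₂) w₂ Q₂ hQ₂
  have g1 := abs_log_gap_sub_le hρ hδ hδρ h₁ (inner_gap_bound hδ hδ1 ℓ)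
  have g2 := abs_log_gap_sub_le hρ hδ hδρ h₂ (outer_gap_bound hδ hδ1 ℓ)
  -- Because |log δ| > 1, both δ and δ (1 - log δ)² are absorbed into multiples of δ log² δ.
  have hlog : log δ < -1 := by
    have := log_lt_log hδ hδe
    rwa [log_exp] at this
  have hL1 : δ * (1 - log δ) ^ 2 ≤ 4 * (δ * log δ ^ 2) := by
    have h : (1 - log δ) ^ 2 ≤ 4 * log δ ^ 2 := by nlinarith
    linarith [mul_le_mul_of_nonneg_left h hδ.le]
  have hL2 : δ ≤ δ * log δ ^ 2 := by nlinarith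
  have hL0 : 0 ≤ δ * log δ ^ 2 := by positivity
  have e1 : ∀ A : ℝ, A * (δ * (1 - log δ) ^ 2) ≤ |A| * (4 * (δ * log δ ^ 2)) := fun A =>
    (mul_le_mul_of_nonneg_right (le_abs_self A) (by positivity)).trans (by gcongr)
  replace f1 := f1.trans (e1 A₁)
  replace f2 := f2.trans (e1 A₂)
  have e2 : 18 / ρ * δ ≤ 18 / ρ * (δ * log δ ^ 2) := by gcongr
  replace g1 := g1.trans e2
  replace g2 := g2.trans e2
  set L := δ * log δ ^ 2
  set X₁ := log (b * innerCut δ + (innerShift δ - δ * ℓ))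
  set X₂ := log (b * outerCut δ + (δ * ℓ - outerShift δ))
  change |volterraFlux n (fun t => 1 * innerWeight δ (δ * ℓ) t) Q₁ - _| ≤ _ at f1
  change |volterraFlux n (fun t => -1 * outerWeight δ (δ * ℓ) t) Q₂ - _| ≤ _ at f2
  have k1 : |(X₁ - (log δ + log (-((1 - log 2) / 2) - ℓ))) / (4 * b)| ≤ 18 / ρ * L / (4 * b) := by
    rw [abs_div, abs_of_pos (by positivity : 0 < 4 * b)]
    gcongr
  have k2 : |(X₂ - (log δ + log (ℓ + log 2 / 2))) / (4 * b)| ≤ 18 / ρ * L / (4 * b) := by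
    rw [abs_div, abs_of_pos (by positivity : 0 < 4 * b)]
    gcongr
  have k3 : 18 / ρ * L / (4 * b) = 9 / (ρ * b) * L / 2 := by
    field_simp
    ring
  rw [k3] at k1 k2
  -- Both gaps contain log δ with the same factor 1/(4b) and opposite signs, so it drops out of the
  -- sum.
  have e3 : ∀ x y z w W₁ F₁ W₂ F₂ lr ll : ℝ, x + y - (W₁ + F₁ + (-W₂ + F₂) + (lr - ll) / (4 * b))
      = (x - (1 * (W₁ - z / (4 * b)) + F₁)) + (y - (-1 * (W₂ - w / (4 * b)) + F₂))
        - (z - (log δ + ll)) / (4 * b) + (w - (log δ + lr)) / (4 * b) := by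
    intros
    ring
  rw [e3 _ _ X₁ X₂]
  rw [abs_le] at *
  constructor <;> linarith [f1.1, f1.2, f2.1, f2.2, k1.1, k1.2, k2.1, k2.2]

/-- Existence of matched solutions, with the leading term `lam₁` of the angular velocity. -/
theorem exists_isMatched : ∃ N : ℕ, 2 ≤ N ∧ ∀ n : ℕ, N ≤ n →
    ∃ lam₁ ∈ Ioo (-(log 2 / 2)) (-((1 - log 2) / 2)), ∃ M δ₀ : ℝ, 0 < δ₀ ∧ δ₀ ≤ 1 ∧
      ∀ δ ∈ Ioo (0 : ℝ) δ₀, ∃ ℓ : ℝ, |ℓ - lam₁| ≤ M * (δ * log δ ^ 2) ∧ -(log 2 / 2) < ℓ ∧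
        ∃ η Q₁ Q₂, IsMatched n δ (δ * ℓ) η Q₁ Q₂ := by
  have hD₁ := isSideProfile_innerProfile
  have hD₂ := isSideProfile_outerProfile
  have a1 : |(1 : ℝ)| = 1 := abs_one
  have a2 : |(-1 : ℝ)| = 1 := by simp
  obtain ⟨N, hN⟩ := Filter.eventually_atTop.1
    ((eventually_limitWeight_small hD₁).and (eventually_limitWeight_small hD₂))
  refine ⟨max N 2, le_max_right _ _, fun n hNn => ?_⟩
  obtain ⟨hs₁, hs₂⟩ := hN n ((le_max_left _ _).trans hNn)
  have hn : 1 ≤ n := by have := (le_max_right N 2).trans hNn; omega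
  obtain ⟨E, hE⟩ := exists_flux_sum_bound hn hs₁ hs₂
  have hb0 := criticalSlope_pos
  have hb1 := criticalSlope_lt
  -- The limiting equation prescribes the ratio X of the distances of lam₁ to the left and to the
  -- right end of the interval. The length of the interval is 2b, so the distances are a₂ =
  -- 2bX/(1+X) and a₁ = 2b/(1+X).
  set X := exp ((2 * n - E) * (4 * criticalSlope)) with hX
  have hX0 : 0 < X := exp_pos _
  set a₁ := 2 * criticalSlope / (1 + X) with ha₁
  set a₂ := 2 * criticalSlope * X / (1 + X) with ha₂
  have ha₁0 : 0 < a₁ := by positivity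
  have ha₂0 : 0 < a₂ := by positivity
  have hsum : a₁ + a₂ = log 2 - 1 / 2 := by
    rw [ha₁, ha₂, criticalSlope]
    field_simp
  have hsum' : a₁ + a₂ = 2 * criticalSlope := by
    rw [hsum, criticalSlope]
    ring
  have hlogX : log a₂ - log a₁ = (2 * n - E) * (4 * criticalSlope) := by
    rw [← log_div ha₂0.ne' ha₁0.ne']
    have : a₂ / a₁ = X := by
      rw [ha₁, ha₂]
      field_simp
    rw [this, hX, log_exp]
  set lam₁ := -((1 - log 2) / 2) - a₁ with hlam₁
  have hl1 : ∀ ℓ, -((1 - log 2) / 2) - ℓ = a₁ - (ℓ - lam₁) := fun ℓ => by rw [hlam₁]; ring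
  have hl2 : ∀ ℓ, ℓ + log 2 / 2 = a₂ + (ℓ - lam₁) := fun ℓ => by
    rw [hlam₁]
    linear_combination -hsum
  refine ⟨lam₁, ⟨?_, by rw [hlam₁]; linarith⟩, ?_⟩
  · have := hl2 lam₁
    rw [sub_self, add_zero] at this
    linarith
  -- Half of the distance to the endpoints; the other half is room for displacements of ℓ by at most
  -- ρ.
  set ρ := min a₁ a₂ / 2 with hρdef
  have hρ0 : 0 < ρ := by
    have : 0 < min a₁ a₂ := lt_min ha₁0 ha₂0
    positivity
  have hρ1 : 2 * ρ ≤ a₁ := by rw [hρdef]; linarith [min_le_left a₁ a₂]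
  have hρ2 : 2 * ρ ≤ a₂ := by rw [hρdef]; linarith [min_le_right a₁ a₂]
  have hρb : ρ ≤ criticalSlope := by linarith
  obtain ⟨B, hB0, hB⟩ := hE ρ hρ0 hρb
  -- Since a₁ and a₂ are below 1, moving ℓ by m changes the limiting flux by at least m/(4b). With
  -- this M the change beats the error B δ log² δ, which yields the two signs for the intermediate
  -- value theorem.
  set M := 4 * criticalSlope * B with hM
  have hM0 : 0 ≤ M := by positivity
  set C₁ := 2 * (4 : ℝ) ^ 2 / (ρ / 8 * criticalSlope) + 4 / criticalSlope with hC₁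
  have ev : ∀ᶠ δ : ℝ in nhdsWithin 0 (Ioi 0), δ < 1 ∧ δ ≤ ρ / 64 ∧ δ < exp (-1) ∧
      C₁ * (δ * (1 - log δ)) ≤ 1 / 12 ∧ M * (δ * log δ ^ 2) ≤ ρ := by
    have t0 : Filter.Tendsto (fun δ : ℝ => δ) (nhdsWithin 0 (Ioi 0)) (nhds 0) :=
      tendsto_nhdsWithin_of_tendsto_nhds Filter.tendsto_id
    have t1 := tendsto_mul_one_sub_log.const_mul C₁
    have t2 := tendsto_mul_log_sq.const_mul M
    rw [mul_zero] at t1 t2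
    filter_upwards [t0.eventually (gt_mem_nhds one_pos),
      t0.eventually (gt_mem_nhds (by positivity : 0 < ρ / 64)),
      t0.eventually (gt_mem_nhds (exp_pos (-1))),
      t1.eventually (gt_mem_nhds (by norm_num : (0 : ℝ) < 1 / 12)),
      t2.eventually (gt_mem_nhds hρ0)] with δ c1 c2 c3 c4 c5
    exact ⟨c1, c2.le, c3, c4.le, c5.le⟩
  obtain ⟨u, hu0, hu⟩ := mem_nhdsGT_iff_exists_Ioo_subset.1 ev
  refine ⟨M, min u 1, lt_min hu0 one_pos, min_le_right _ _, fun δ hδ => ?_⟩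
  obtain ⟨hδ1, hδρ, hδe, hδs, hδm⟩ := hu ⟨hδ.1, hδ.2.trans_le (min_le_left _ _)⟩
  have hδ0 : 0 < δ := hδ.1
  set m := M * (δ * log δ ^ 2) with hm
  have hm0 : 0 ≤ m := by positivity
  have hI : ∀ ℓ ∈ Icc (lam₁ - m) (lam₁ + m),
      ρ ≤ -((1 - log 2) / 2) - ℓ ∧ ρ ≤ ℓ + log 2 / 2 := by
    intro ℓ hℓ
    rw [hl1, hl2]
    constructor <;> linarith [hℓ.1, hℓ.2]
  have adm₁ := fun ℓ hℓ => isAdmissible_inner hρ0 hρb hδ0 hδρ (hI ℓ hℓ).1 (hI ℓ hℓ).2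
  have adm₂ := fun ℓ hℓ => isAdmissible_outer hρ0 hρb hδ0 hδρ (hI ℓ hℓ).1 (hI ℓ hℓ).2
  have small₁ : ∀ ℓ ∈ Icc (lam₁ - m) (lam₁ + m), IsSmallWeight n (innerWeight δ (δ * ℓ)) :=
    fun ℓ hℓ => isSmallWeight_sideWeight hn hD₁ hs₁ (adm₁ ℓ hℓ) hδs
  have small₂ : ∀ ℓ ∈ Icc (lam₁ - m) (lam₁ + m), IsSmallWeight n (outerWeight δ (δ * ℓ)) :=
    fun ℓ hℓ => isSmallWeight_sideWeight hn hD₂ hs₂ (adm₂ ℓ hℓ) hδs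
  have ex₁ : ∀ ℓ ∈ Icc (lam₁ - m) (lam₁ + m), ∃ Q,
      IsVolterraSol n (fun t => 1 * innerWeight δ (δ * ℓ) t) Q :=
    fun ℓ hℓ => exists_isVolterraSol hn (isSmallWeight_const_mul a1 (small₁ ℓ hℓ))
  have ex₂ : ∀ ℓ ∈ Icc (lam₁ - m) (lam₁ + m), ∃ Q,
      IsVolterraSol n (fun t => -1 * outerWeight δ (δ * ℓ) t) Q :=
    fun ℓ hℓ => exists_isVolterraSol hn (isSmallWeight_const_mul a2 (small₂ ℓ hℓ))
  -- Any selection of solutions will do: the Lipschitz estimate for the flux holds for arbitrary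
  -- solutions, so the selected flux is automatically continuous in ℓ.
  choose! Q₁ hQ₁ using ex₁
  choose! Q₂ hQ₂ using ex₂
  set F : ℝ → ℝ := fun ℓ => volterraFlux n (fun t => 1 * innerWeight δ (δ * ℓ) t) (Q₁ ℓ)
        + volterraFlux n (fun t => -1 * outerWeight δ (δ * ℓ) t) (Q₂ ℓ) with hF
  have hcont : ContinuousOn F (Icc (lam₁ - m) (lam₁ + m)) := by
    have hη : 0 < ρ / 8 := by positivity
    set k : ℝ → ℝ := fun ζ => 3 / (ρ / 8 * ζ) ^ 2 + 16 / (ρ / 8 * ζ) ^ 3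
    have hlip : LipschitzOnWith (Real.toNNReal ((k (innerCut δ) + k (outerCut δ)) * δ)) F
        (Icc (lam₁ - m) (lam₁ + m)) := by
      apply LipschitzOnWith.of_dist_le_mul
      intro x hx y hy
      have c1 := abs_flux_sub_le hn a1 hD₁ (adm₁ x hx) (adm₁ y hy) (small₁ x hx) (small₁ y hy)
        (hQ₁ x hx) (hQ₁ y hy)
      have c2 := abs_flux_sub_le hn a2 hD₂ (adm₂ x hx) (adm₂ y hy) (small₂ x hx) (small₂ y hy)
        (hQ₂ x hx) (hQ₂ y hy)
      have z1 := (adm₁ x hx).ζ_pos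
      have z2 := (adm₂ x hx).ζ_pos
      have d1 : |innerShift δ - δ * x - (innerShift δ - δ * y)| = δ * |x - y| := by
        rw [← abs_of_pos hδ0, ← abs_mul, abs_of_pos hδ0, ← abs_neg]
        congr 1
        ring
      have d2 : |δ * x - outerShift δ - (δ * y - outerShift δ)| = δ * |x - y| := by
        rw [← abs_of_pos hδ0, ← abs_mul, abs_of_pos hδ0]
        congr 1
        ring
      rw [d1] at c1
      rw [d2] at c2
      have k0 : 0 ≤ (k (innerCut δ) + k (outerCut δ)) * δ := by positivity
      rw [Real.coe_toNNReal _ k0, Real.dist_eq, Real.dist_eq]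
      calc |F x - F y| ≤ k (innerCut δ) * (δ * |x - y|) + k (outerCut δ) * (δ * |x - y|) := by
            refine le_trans ?_ (add_le_add c1 c2)
            refine le_trans (le_of_eq ?_) (abs_add_le _ _)
            congr 1
            simp only [hF, innerWeight, outerWeight]
            ring
        _ = _ := by ring
    exact hlip.continuousOn
  have hF' : ∀ ℓ ∈ Icc (lam₁ - m) (lam₁ + m),
      |F ℓ - (E + (log (a₂ + (ℓ - lam₁)) - log (a₁ - (ℓ - lam₁))) / (4 * criticalSlope))|
        ≤ B * (δ * log δ ^ 2) := by
    intro ℓ hℓ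
    have := hB δ ℓ hδ0 hδρ hδe (hI ℓ hℓ).1 (hI ℓ hℓ).2 (small₁ ℓ hℓ) (small₂ ℓ hℓ) _ _
      (hQ₁ ℓ hℓ) (hQ₂ ℓ hℓ)
    rwa [hl1, hl2] at this
  have hBm : B * (δ * log δ ^ 2) = m / (4 * criticalSlope) := by
    rw [hm, hM]
    field_simp
  have hE2 : E + (log a₂ - log a₁) / (4 * criticalSlope) = 2 * n := by
    rw [hlogX]
    field_simp
    ring
  have hup : 2 * (n : ℝ) ≤ F (lam₁ + m) := by
    have h := (abs_le.1 (hF' (lam₁ + m) ⟨by linarith, le_rfl⟩)).1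
    rw [add_sub_cancel_left, hBm] at h
    have c1 := log_add_sub_log_ge ha₂0 hm0 (by linarith)
    have c2 : log (a₁ - m) ≤ log a₁ := log_le_log (by linarith) (by linarith)
    have c3 : (log a₂ - log a₁) / (4 * criticalSlope) + m / (4 * criticalSlope)
        ≤ (log (a₂ + m) - log (a₁ - m)) / (4 * criticalSlope) := by
      rw [← add_div]
      have := criticalSlope_pos
      exact div_le_div_of_nonneg_right (by linarith) (by positivity)
    linarith
  have hlo : F (lam₁ - m) ≤ 2 * (n : ℝ) := by
    have h := (abs_le.1 (hF' (lam₁ - m) ⟨le_rfl, by linarith⟩)).2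
    rw [sub_sub_cancel_left, hBm, sub_neg_eq_add, ← sub_eq_add_neg] at h
    have c1 := log_add_sub_log_ge ha₁0 hm0 (by linarith)
    have c2 : log (a₂ - m) ≤ log a₂ := log_le_log (by linarith) (by linarith)
    have c3 : (log (a₂ - m) - log (a₁ + m)) / (4 * criticalSlope)
        ≤ (log a₂ - log a₁) / (4 * criticalSlope) - m / (4 * criticalSlope) := by
      rw [← sub_div]
      have := criticalSlope_pos
      exact div_le_div_of_nonneg_right (by linarith) (by positivity)
    linarith
  obtain ⟨ℓ, hℓ, hFℓ⟩ := intermediate_value_Icc (by linarith : lam₁ - m ≤ lam₁ + m) hcont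
    ⟨hlo, hup⟩
  refine ⟨ℓ, ?_, by linarith [(hI ℓ hℓ).2], ρ / 8, Q₁ ℓ, Q₂ ℓ, adm₁ ℓ hℓ, adm₂ ℓ hℓ, hQ₁ ℓ hℓ, hQ₂ ℓ hℓ, hFℓ⟩
  rw [abs_le]
  constructor <;> linarith [hℓ.1, hℓ.2]

/-! ### Smoothness of the solutions -/

/-- The weighted mean `∫₀¹ σⁿ f(tσ) dσ`. -/
noncomputable def scaledMean (n : ℕ) (f : ℝ → ℝ) (t : ℝ) : ℝ :=
  ∫ σ in (0 : ℝ)..1, σ ^ n * f (t * σ)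

lemma pow_succ_mul_scaledMean (n : ℕ) (f : ℝ → ℝ) (t : ℝ) :
    t ^ (n + 1) * scaledMean n f t = ∫ s in (0 : ℝ)..t, s ^ n * f s := by
  have h := intervalIntegral.smul_integral_comp_mul_left (a := 0) (b := 1)
    (fun s => s ^ n * f s) t
  rw [mul_zero, mul_one] at h
  rw [← h, scaledMean, pow_succ', mul_assoc, ← intervalIntegral.integral_const_mul, smul_eq_mul]
  congr 2
  ext σ
  rw [mul_pow]
  ring

section

variable {A : ℝ} {f g F : ℝ → ℝ}

lemma scaledMean_congr (n : ℕ) (hfg : EqOn f g (Icc 0 A)) :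
    EqOn (scaledMean n f) (scaledMean n g) (Icc 0 A) := by
  intro t ht
  apply intervalIntegral.integral_congr
  intro σ hσ
  rw [uIcc_of_le zero_le_one] at hσ
  simp only
  rw [hfg ⟨mul_nonneg ht.1 hσ.1, (mul_le_of_le_one_right ht.1 hσ.2).trans ht.2⟩]

lemma exists_continuous_eqOn (hA : 0 ≤ A) (hf : ContinuousOn f (Icc 0 A)) :
    ∃ g : ℝ → ℝ, Continuous g ∧ EqOn f g (Icc 0 A) :=
  ⟨IccExtend hA ((Icc 0 A).domRestrict f), (continuousOn_iff_continuous_domRestrict.1 hf).Icc_extend',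
    fun t ht => by rw [IccExtend_of_mem _ _ ht]; rfl⟩

lemma continuousOn_scaledMean (n : ℕ) (hA : 0 ≤ A) (hf : ContinuousOn f (Icc 0 A)) :
    ContinuousOn (scaledMean n f) (Icc 0 A) := by
  obtain ⟨g, hg, hfg⟩ := exists_continuous_eqOn hA hf
  refine ContinuousOn.congr (f := scaledMean n g) ?_ (scaledMean_congr n hfg)
  apply Continuous.continuousOn
  apply intervalIntegral.continuous_parametric_intervalIntegral_of_continuous'
  fun_prop

/-- A derivative in the interior that extends continuously is the derivative up to the boundary. -/
lemma hasDerivWithinAt_Icc_of_continuousOn (hA : 0 < A) (hF : ContinuousOn F (Icc 0 A))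
    (hg : ContinuousOn g (Icc 0 A)) (h : ∀ t ∈ Ioo 0 A, HasDerivAt F (g t) t) {t : ℝ}
    (ht : t ∈ Icc 0 A) : HasDerivWithinAt F (g t) (Icc 0 A) t := by
  obtain ⟨k, hk, hgk⟩ := exists_continuous_eqOn hA.le hg
  have e : ∀ x ∈ Icc 0 A, F x = F 0 + ∫ u in (0 : ℝ)..x, k u := by
    intro x hx
    have := intervalIntegral.integral_eq_sub_of_hasDerivAt_of_le hx.1
      (hF.mono (Icc_subset_Icc_right hx.2)) (f' := k)
      (fun y hy => by
        rw [← hgk ⟨hy.1.le, hy.2.le.trans hx.2⟩]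
        exact h y ⟨hy.1, hy.2.trans_le hx.2⟩) (hk.intervalIntegrable _ _)
    rw [this]
    ring
  have hd : HasDerivAt (fun x => F 0 + ∫ u in (0 : ℝ)..x, k u) (k t) t :=
    (intervalIntegral.integral_hasDerivAt_right (hk.intervalIntegrable _ _)
      (hk.stronglyMeasurableAtFilter _ _) hk.continuousAt).const_add _
  rw [hgk ht]
  exact hd.hasDerivWithinAt.congr e (e t ht)

lemma hasDerivAt_integral_pow_mul (n : ℕ) (hA : 0 ≤ A) (hf : ContinuousOn f (Icc 0 A)) {t : ℝ}
    (ht : t ∈ Ioo 0 A) :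
    HasDerivAt (fun x => ∫ s in (0 : ℝ)..x, s ^ n * f s) (t ^ n * f t) t := by
  obtain ⟨g, hg, hfg⟩ := exists_continuous_eqOn hA hf
  have hc : Continuous fun s => s ^ n * g s := by fun_prop
  have h := intervalIntegral.integral_hasDerivAt_right (hc.intervalIntegrable 0 t)
    (hc.stronglyMeasurableAtFilter _ _) hc.continuousAt
  rw [hfg (Ioo_subset_Icc_self ht)]
  refine h.congr_of_eventuallyEq ?_
  filter_upwards [isOpen_Ioo.mem_nhds ht] with x hx
  apply intervalIntegral.integral_congr
  intro s hs
  rw [uIcc_of_le hx.1.le] at hs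
  simp only
  rw [hfg ⟨hs.1, hs.2.trans hx.2.le⟩]

lemma hasDerivAt_scaledMean (n : ℕ) (hA : 0 ≤ A) (hf : ContinuousOn f (Icc 0 A)) {t : ℝ}
    (ht : t ∈ Ioo 0 A) :
    HasDerivAt (scaledMean n f) ((f t - (n + 1) * scaledMean n f t) / t) t := by
  have ht0 : t ≠ 0 := ht.1.ne'
  have h := (hasDerivAt_integral_pow_mul n hA hf ht).div (hasDerivAt_pow (n + 1) t)
    (pow_ne_zero _ ht0)
  have e : scaledMean n f =ᶠ[nhds t]
      (fun x => ∫ s in (0 : ℝ)..x, s ^ n * f s) / fun x => x ^ (n + 1) := by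
    filter_upwards [isOpen_Ioo.mem_nhds ht] with x hx
    have hx0 : x ≠ 0 := hx.1.ne'
    rw [Pi.div_apply, ← pow_succ_mul_scaledMean]
    field_simp
  refine (h.congr_of_eventuallyEq e).congr_deriv ?_
  rw [← pow_succ_mul_scaledMean]
  push_cast
  field_simp
  ring

/-- Integration by parts. Compared with `hasDerivAt_scaledMean`, it shows that the derivative of the
n-th mean of f is the (n+1)-st mean of f', which removes the division by t at 0. -/
lemma mul_scaledMean_succ_deriv (n : ℕ) (hf : ContinuousOn f (Icc 0 A))
    (hg : ContinuousOn g (Icc 0 A)) (h : ∀ t ∈ Ioo 0 A, HasDerivAt f (g t) t) {t : ℝ}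
    (ht : t ∈ Ioo 0 A) :
    scaledMean (n + 1) g t = (f t - (n + 1) * scaledMean n f t) / t := by
  have ht0 : t ≠ 0 := ht.1.ne'
  have hs : uIcc 0 t ⊆ Icc 0 A := by
    rw [uIcc_of_le ht.1.le]
    exact Icc_subset_Icc_right ht.2.le
  have hm : ∀ x, min 0 t < x ∧ x < max 0 t → x ∈ Ioo 0 A := by
    intro x hx
    rw [min_eq_left ht.1.le, max_eq_right ht.1.le] at hx
    exact ⟨hx.1, hx.2.trans ht.2⟩
  have hp := intervalIntegral.integral_mul_deriv_eq_deriv_mul_of_hasDerivAt (a := 0) (b := t)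
    (u := fun s => s ^ (n + 1)) (u' := fun s => (n + 1) * s ^ n) (v := f) (v' := g)
    (by fun_prop) (hf.mono hs)
    (fun x hx => by
      have := hasDerivAt_pow (n + 1) x
      push_cast at this
      exact this)
    (fun x hx => h x (hm x hx))
    (Continuous.intervalIntegrable (by fun_prop) _ _)
    (hg.mono hs).intervalIntegrable
  have e : ∫ x in (0 : ℝ)..t, (n + 1) * x ^ n * f x = (n + 1) * ∫ x in (0 : ℝ)..t, x ^ n * f x := by
    rw [← intervalIntegral.integral_const_mul]
    simp only [mul_assoc]
  rw [e, ← pow_succ_mul_scaledMean, ← pow_succ_mul_scaledMean] at hp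
  rw [eq_div_iff ht0]
  apply mul_left_cancel₀ (pow_ne_zero (n + 1) ht0)
  rw [zero_pow (Nat.succ_ne_zero n)] at hp
  linear_combination hp

lemma contDiffOn_succ_of_hasDerivWithinAt {s : Set ℝ} (hs : UniqueDiffOn ℝ s) {k : ℕ}
    (h : ∀ t ∈ s, HasDerivWithinAt F (g t) s t) (hg : ContDiffOn ℝ k g s) :
    ContDiffOn ℝ (k + 1 : ℕ) F s := by
  push_cast
  rw [contDiffOn_succ_iff_derivWithin hs]
  refine ⟨fun t ht => (h t ht).differentiableWithinAt, by simp, ?_⟩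
  exact hg.congr fun t ht => (h t ht).derivWithin (hs t ht)

/-- Each derivative raises the exponent of the mean by one, so the induction runs over all exponents
at once. -/
lemma contDiffOn_scaledMean_Icc (hA : 0 < A) {k : ℕ} :
    ∀ {f : ℝ → ℝ} (n : ℕ), ContDiffOn ℝ k f (Icc 0 A) → ContDiffOn ℝ k (scaledMean n f) (Icc 0 A) := by
  induction k with
  | zero =>
    intro f n hf
    rw [Nat.cast_zero, contDiffOn_zero] at hf ⊢
    exact continuousOn_scaledMean n hA.le hf
  | succ k ih =>
    intro f n hf
    have hu : UniqueDiffOn ℝ (Icc 0 A) := uniqueDiffOn_Icc hA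
    have hf' := hf
    push_cast at hf'
    rw [contDiffOn_succ_iff_derivWithin hu] at hf'
    have hd : ∀ t ∈ Ioo 0 A, HasDerivAt f (derivWithin f (Icc 0 A) t) t := fun t ht =>
      (hf'.1 t (Ioo_subset_Icc_self ht)).hasDerivWithinAt.hasDerivAt (Icc_mem_nhds ht.1 ht.2)
    refine contDiffOn_succ_of_hasDerivWithinAt hu (fun t ht =>
      hasDerivWithinAt_Icc_of_continuousOn hA (continuousOn_scaledMean n hA.le hf.continuousOn)
        (continuousOn_scaledMean (n + 1) hA.le hf'.2.2.continuousOn) (fun x hx => ?_) ht)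
      (ih (n + 1) hf'.2.2)
    rw [mul_scaledMean_succ_deriv n hf.continuousOn hf'.2.2.continuousOn hd hx]
    exact hasDerivAt_scaledMean n hA.le hf.continuousOn hx

lemma hasDerivWithinAt_integral_pow_mul (n : ℕ) (hA : 0 < A) (hf : ContinuousOn f (Icc 0 A)) {t : ℝ}
    (ht : t ∈ Icc 0 A) :
    HasDerivWithinAt (fun x => ∫ s in (0 : ℝ)..x, s ^ n * f s) (t ^ n * f t) (Icc 0 A) t := by
  refine hasDerivWithinAt_Icc_of_continuousOn hA (g := fun t => t ^ n * f t) ?_ (by fun_prop)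
    (fun x hx => hasDerivAt_integral_pow_mul n hA.le hf hx) ht
  refine ContinuousOn.congr (f := fun x => x ^ (n + 1) * scaledMean n f x) ?_
    fun x _ => (pow_succ_mul_scaledMean n f x).symm
  exact (by fun_prop : Continuous fun x : ℝ => x ^ (n + 1)).continuousOn.mul
    (continuousOn_scaledMean n hA.le hf)

/-- For the outer side, where the profile contains t log t and is smooth only away from t = 0, that
is, r = ∞. There the explicit division by x^(n+1) is harmless. -/
lemma contDiffOn_scaledMean_Ioc (hA : 0 < A) (n : ℕ) {k : ℕ} (hf : ContinuousOn f (Icc 0 A))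
    (hk : ContDiffOn ℝ k f (Ioc 0 A)) : ContDiffOn ℝ k (scaledMean n f) (Ioc 0 A) := by
  have h : ContDiffOn ℝ (k + 1 : ℕ) (fun x => ∫ s in (0 : ℝ)..x, s ^ n * f s) (Ioc 0 A) :=
    contDiffOn_succ_of_hasDerivWithinAt (uniqueDiffOn_Ioc 0 A)
      (fun t ht => (hasDerivWithinAt_integral_pow_mul n hA hf (Ioc_subset_Icc_self ht)).mono
        Ioc_subset_Icc_self) (ContDiffOn.mul (by fun_prop) hk)
  have h' : ContDiffOn ℝ k (fun x => (∫ s in (0 : ℝ)..x, s ^ n * f s) / x ^ (n + 1)) (Ioc 0 A) :=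
    (h.of_le (by exact_mod_cast Nat.le_succ k)).div (by fun_prop) fun x hx =>
      pow_ne_zero _ hx.1.ne'
  refine h'.congr fun x hx => ?_
  have hx0 : x ≠ 0 := hx.1.ne'
  rw [← pow_succ_mul_scaledMean]
  field_simp

/-- Integrating 1/(1 + tσ) over σ in (0, 1) removes the apparent singularity at t = 0. -/
lemma logSlope_eq_scaledMean {t : ℝ} (ht : 0 ≤ t) : logSlope t = scaledMean 0 (fun u => (1 + u)⁻¹) t := by
  rcases ht.eq_or_lt with rfl | ht
  · rw [logSlope_zero]
    simp [scaledMean]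
  · rw [logSlope_of_ne ht.ne']
    have h := pow_succ_mul_scaledMean 0 (fun u => (1 + u)⁻¹) t
    have hi : ∫ s in (0 : ℝ)..t, (1 + s)⁻¹ = log (1 + t) - log (1 + 0) := by
      apply intervalIntegral.integral_eq_sub_of_hasDerivAt
      · intro x hx
        rw [uIcc_of_le ht.le] at hx
        have := ((hasDerivAt_id x).const_add 1).log (by simp only [id]; linarith [hx.1])
        simpa using this
      · apply ContinuousOn.intervalIntegrable
        rw [uIcc_of_le ht.le]
        exact ContinuousOn.inv₀ (by fun_prop) fun x hx => by linarith [hx.1]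
    simp only [pow_zero, one_mul, zero_add, pow_one] at h
    rw [hi] at h
    rw [div_eq_iff ht.ne', mul_comm, h]
    simp

lemma contDiffOn_logSlope (hA : 0 < A) : ContDiffOn ℝ ∞ logSlope (Icc 0 A) := by
  rw [contDiffOn_infty]
  intro k
  refine (contDiffOn_scaledMean_Icc hA (f := fun u => (1 + u)⁻¹) 0 ?_).congr
    fun t ht => logSlope_eq_scaledMean ht.1
  exact ContDiffOn.inv (by fun_prop) fun x hx => by linarith [hx.1]

end

section

variable {n : ℕ} {v Q W : ℝ → ℝ} {A : ℝ}

lemma IsVolterraSol.integrableOn (h : IsVolterraSol n v Q) (hv : IntegrableOn v (Ioo 0 1)) :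
    IntegrableOn (fun t => v t * Q t) (Ioo 0 1) := by
  refine Integrable.mono' (hv.norm.mul_const (3 / 2))
    (hv.aestronglyMeasurable.mul h.cont.aestronglyMeasurable) ?_
  filter_upwards [ae_restrict_mem measurableSet_Ioo] with t ht
  change ‖v t * Q t‖ ≤ _
  rw [norm_mul]
  exact mul_le_mul_of_nonneg_left (h.abs_le (Ioo_subset_Icc_self ht)) (norm_nonneg _)

lemma div_max_pow_le_one (n : ℕ) (τ : ℝ) {t : ℝ} (ht : 0 < t) :
    0 ≤ (t / max τ t) ^ n ∧ (t / max τ t) ^ n ≤ 1 := by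
  have : 0 < max τ t := lt_max_of_lt_right ht
  exact ⟨by positivity, pow_le_one₀ (by positivity) ((div_le_one this).2 (le_max_right _ _))⟩

lemma IsVolterraSol.integrableOn_div_max (h : IsVolterraSol n v Q)
    (hv : IntegrableOn v (Ioo 0 1)) (τ : ℝ) :
    IntegrableOn (fun t => (t / max τ t) ^ n * (v t * Q t)) (Ioo 0 1) := by
  refine Integrable.mono' (h.integrableOn hv).norm
    (AEStronglyMeasurable.mul (Measurable.aestronglyMeasurable (by fun_prop))
      (h.integrableOn hv).aestronglyMeasurable) ?_
  filter_upwards [ae_restrict_mem measurableSet_Ioo] with t ht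
  change ‖(t / max τ t) ^ n * (v t * Q t)‖ ≤ _
  obtain ⟨h0, h1⟩ := div_max_pow_le_one n τ ht.1
  rw [norm_mul, norm_of_nonneg h0]
  exact mul_le_of_le_one_left (norm_nonneg _) h1

lemma IsVolterraSol.integral_div_max_add (hn : 1 ≤ n) (h : IsVolterraSol n v Q)
    (hv : IntegrableOn v (Ioo 0 1)) {τ : ℝ} (hτ : τ ∈ Icc (0 : ℝ) 1) :
    ∫ t in Ioo (0 : ℝ) 1, (t / max τ t) ^ n * (v t * Q t)
      = (∫ t in Ioo (0 : ℝ) 1, v t * Q t) - 2 * n * (1 - Q τ) := by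
  have hn0 : (n : ℝ) ≠ 0 := by positivity
  have e : ∀ t, volterraKernel n τ t * v t * Q t
      = (2 * (n : ℝ))⁻¹ * (v t * Q t - (t / max τ t) ^ n * (v t * Q t)) := by
    intro t
    rw [volterraKernel]
    ring
  have h1 := h.eq τ hτ
  simp only [e] at h1
  rw [integral_const_mul, integral_sub (h.integrableOn hv) (h.integrableOn_div_max hv τ)] at h1
  rw [h1]
  field_simp
  ring

/-- The integral against `(t / max τ t)ⁿ` is expressed by the flux and the solution. -/
lemma IsVolterraSol.integral_div_max (hn : 1 ≤ n) (h : IsVolterraSol n v Q)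
    (hv : IntegrableOn v (Ioo 0 1)) {τ : ℝ} (hτ : τ ∈ Icc (0 : ℝ) 1) :
    ∫ t in Ioo (0 : ℝ) 1, (t / max τ t) ^ n * (v t * Q t)
      = Q 1 * volterraFlux n v Q + 2 * n * (Q τ - Q 1) := by
  have h1 := h.integral_div_max_add hn hv hτ
  have h2 := h.integral_div_max_add hn hv (τ := 1) ⟨zero_le_one, le_rfl⟩
  have hQ : Q 1 ≠ 0 := by linarith [h.half_le_one]
  have e : Q 1 * volterraFlux n v Q = ∫ t in Ioo (0 : ℝ) 1, (t / max 1 t) ^ n * (v t * Q t) := by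
    rw [volterraFlux, mul_div_cancel₀ _ hQ]
    apply setIntegral_congr_fun measurableSet_Ioo
    intro t ht
    simp only
    rw [max_eq_left ht.2.le, div_one, mul_assoc]
  rw [e, h1, h2]
  ring

/-- The part of the integrals over t > τ cancels, since there t / max τ t = 1. This leaves Q = 1 +
(τ S - ∫ WQ)/(2n) with S the n-th mean of WQ, and differentiation of the bracket gives -nS. -/
lemma IsVolterraSol.hasDerivAt (hn : 1 ≤ n) (h : IsVolterraSol n v Q)
    (hv : IntegrableOn v (Ioo 0 1)) (hA1 : A < 1) (hW : ContinuousOn W (Icc 0 A))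
    (hvW : EqOn v W (Ioo 0 A)) {τ : ℝ} (hτ : τ ∈ Ioo 0 A) :
    HasDerivAt Q (-(1 / 2) * scaledMean n (fun t => W t * Q t) τ) τ := by
  have hn0 : (n : ℝ) ≠ 0 := by positivity
  have hA0 : 0 ≤ A := hτ.1.le.trans hτ.2.le
  have hf : ContinuousOn (fun t => W t * Q t) (Icc 0 A) := hW.mul h.cont.continuousOn
  have hi := h.integrableOn hv
  have key : ∀ x ∈ Ioo 0 A, Q x = 1 + (2 * (n : ℝ))⁻¹ *
      (x * scaledMean n (fun t => W t * Q t) x - ∫ s in (0 : ℝ)..x, s ^ 0 * (W s * Q s)) := by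
    intro x hx
    have hx1 : x < 1 := hx.2.trans hA1
    have h1 := h.integral_div_max_add hn hv (τ := x) ⟨hx.1.le, hx1.le⟩
    have hs : Ioo (0 : ℝ) 1 = Ioo 0 x ∪ Ico x 1 := (Ioo_union_Ico_eq_Ioo hx.1 hx1.le).symm
    have hd : Disjoint (Ioo 0 x) (Ico x 1) :=
      Set.disjoint_left.2 fun y hy hy' => (hy.2.trans_le hy'.1).false
    have e1 : ∫ t in Ioo (0 : ℝ) 1, v t * Q t
        = (∫ t in Ioo 0 x, v t * Q t) + ∫ t in Ico x 1, v t * Q t := by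
      rw [← setIntegral_union hd measurableSet_Ico (hi.mono_set (by rw [hs]; exact subset_union_left))
        (hi.mono_set (by rw [hs]; exact subset_union_right)), ← hs]
    have hi' := h.integrableOn_div_max hv x
    have e2 : ∫ t in Ioo (0 : ℝ) 1, (t / max x t) ^ n * (v t * Q t)
        = (∫ t in Ioo 0 x, (t / max x t) ^ n * (v t * Q t))
          + ∫ t in Ico x 1, (t / max x t) ^ n * (v t * Q t) := by
      rw [← setIntegral_union hd measurableSet_Ico (hi'.mono_set (by rw [hs]; exact subset_union_left))
        (hi'.mono_set (by rw [hs]; exact subset_union_right)), ← hs]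
    have e3 : ∫ t in Ico x 1, (t / max x t) ^ n * (v t * Q t) = ∫ t in Ico x 1, v t * Q t := by
      apply setIntegral_congr_fun measurableSet_Ico
      intro t ht
      have : t ≠ 0 := (hx.1.trans_le ht.1).ne'
      simp only
      rw [max_eq_right ht.1, div_self this, one_pow, one_mul]
    have e4 : ∫ t in Ioo 0 x, v t * Q t = ∫ s in (0 : ℝ)..x, s ^ 0 * (W s * Q s) := by
      rw [intervalIntegral.integral_of_le hx.1.le, integral_Ioc_eq_integral_Ioo]
      apply setIntegral_congr_fun measurableSet_Ioo
      intro t ht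
      simp only
      rw [hvW ⟨ht.1, ht.2.trans hx.2⟩, pow_zero, one_mul]
    have e5 : ∫ t in Ioo 0 x, (t / max x t) ^ n * (v t * Q t)
        = x * scaledMean n (fun t => W t * Q t) x := by
      have hx0 : x ≠ 0 := hx.1.ne'
      have hp := pow_succ_mul_scaledMean n (fun t => W t * Q t) x
      rw [intervalIntegral.integral_of_le hx.1.le, integral_Ioc_eq_integral_Ioo] at hp
      apply mul_left_cancel₀ (pow_ne_zero n hx0)
      rw [← mul_assoc, ← pow_succ, hp, ← integral_const_mul]
      apply setIntegral_congr_fun measurableSet_Ioo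
      intro t ht
      simp only
      rw [max_eq_left ht.2.le, hvW ⟨ht.1, ht.2.trans hx.2⟩, div_pow]
      field_simp
    rw [e1, e2, e3, e5] at h1
    rw [← e4]
    have e6 : x * scaledMean n (fun t => W t * Q t) x - ∫ t in Ioo 0 x, v t * Q t
        = -(2 * n * (1 - Q x)) := by linarith
    rw [e6]
    field_simp
    ring
  have hτ0 : τ ≠ 0 := hτ.1.ne'
  have hd := ((((hasDerivAt_id τ).mul (hasDerivAt_scaledMean n hA0 hf hτ)).sub
    (hasDerivAt_integral_pow_mul 0 hA0 hf hτ)).const_mul (2 * (n : ℝ))⁻¹).const_add 1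
  refine (hd.congr_of_eventuallyEq ?_).congr_deriv ?_
  · filter_upwards [isOpen_Ioo.mem_nhds hτ] with x hx using key x hx
  · simp only [id]
    field_simp
    ring

/-- Bootstrap: Q' is a mean of WQ, so each step gains a derivative. Smoothness of means on s is a
hypothesis because it holds for different reasons on the two sides. -/
lemma IsVolterraSol.contDiffOn (hn : 1 ≤ n) (h : IsVolterraSol n v Q)
    (hv : IntegrableOn v (Ioo 0 1)) (hA : 0 < A) (hA1 : A < 1) (hW : ContinuousOn W (Icc 0 A))
    (hvW : EqOn v W (Ioo 0 A)) {s : Set ℝ} (hs : UniqueDiffOn ℝ s) (hsA : s ⊆ Icc 0 A)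
    (hWs : ContDiffOn ℝ ∞ W s)
    (hmean : ∀ (f : ℝ → ℝ) (k : ℕ), ContinuousOn f (Icc 0 A) → ContDiffOn ℝ k f s →
      ContDiffOn ℝ k (scaledMean n f) s) : ContDiffOn ℝ ∞ Q s := by
  have hf : ContinuousOn (fun t => W t * Q t) (Icc 0 A) := hW.mul h.cont.continuousOn
  rw [contDiffOn_infty] at hWs ⊢
  intro k
  induction k with
  | zero => rw [Nat.cast_zero, contDiffOn_zero]; exact h.cont.continuousOn
  | succ k ih =>
    refine contDiffOn_succ_of_hasDerivWithinAt hs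
      (g := fun τ => -(1 / 2) * scaledMean n (fun t => W t * Q t) τ) (fun t ht => ?_) ?_
    · exact (hasDerivWithinAt_Icc_of_continuousOn hA h.cont.continuousOn
        (continuousOn_const.mul (continuousOn_scaledMean n hA.le hf))
        (fun x hx => h.hasDerivAt hn hv hA1 hW hvW hx) (hsA ht)).mono hsA
    · exact contDiffOn_const.mul (hmean _ k hf ((hWs k).mul ih))

end

/-! ### The eigenfunction -/

/-- The perturbed profile `D + P - R (1 - t)`. -/
noncomputable def sideDenom (D : ℝ → ℝ) (P R t : ℝ) : ℝ := D t + P - R * (1 - t)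

lemma sideWeight_of_lt {D : ℝ → ℝ} {ζ P R t : ℝ} (h : t < 1 - ζ) :
    sideWeight D ζ P R t = ((1 + t) ^ 2 * sideDenom D P R t)⁻¹ := if_pos h

lemma sideWeight_of_ge {D : ℝ → ℝ} {ζ P R t : ℝ} (h : 1 - ζ ≤ t) : sideWeight D ζ P R t = 0 :=
  if_neg h.not_gt

lemma continuousOn_sideDenom {D : ℝ → ℝ} {s : Set ℝ} (hD : ContinuousOn D s) (P R : ℝ) :
    ContinuousOn (sideDenom D P R) s := by
  unfold sideDenom
  fun_prop

lemma contDiffOn_sideDenom {D : ℝ → ℝ} {s : Set ℝ} (hD : ContDiffOn ℝ ∞ D s) (P R : ℝ) :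
    ContDiffOn ℝ ∞ (sideDenom D P R) s := by
  unfold sideDenom
  fun_prop

section

variable {D : ℝ → ℝ} {b C K η δ ζ P R t : ℝ}

/-- The edge of the annulus and the point t = 0 belong to the domain on which h must be smooth; the
estimate for the open interval extends to them by continuity. -/
lemma IsAdmissible.sideDenom_ge (hD : IsSideProfile D b C) (h : IsAdmissible b K η δ ζ P R)
    (hDc : ContinuousOn D (Icc 0 1)) (ht : t ∈ Icc 0 (1 - ζ)) : η * ζ ≤ sideDenom D P R t := by
  have hζ := h.ζ_pos
  have hζ1 := h.ζ_lt
  have hne : (0 : ℝ) ≠ 1 - ζ := by linarith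
  have hcl : closure (Ioo 0 (1 - ζ)) = Icc 0 (1 - ζ) := closure_Ioo hne
  refine le_on_closure (f := fun _ => η * ζ) (s := Ioo 0 (1 - ζ)) (fun x hx => ?_)
    continuousOn_const ?_ (hcl ▸ ht)
  · refine le_trans ?_ (h.le_denom hD ⟨hx.1, by linarith [hx.2]⟩ hx.2)
    exact mul_le_mul_of_nonneg_left (by linarith [hx.2]) h.η_pos.le
  · rw [hcl]
    exact continuousOn_sideDenom (hDc.mono (Icc_subset_Icc_right (by linarith))) P R

lemma IsAdmissible.sideDenom_pos (hD : IsSideProfile D b C) (h : IsAdmissible b K η δ ζ P R)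
    (hDc : ContinuousOn D (Icc 0 1)) (ht : t ∈ Icc 0 (1 - ζ)) : 0 < sideDenom D P R t :=
  (mul_pos h.η_pos h.ζ_pos).trans_le (h.sideDenom_ge hD hDc ht)

lemma contDiffOn_div_sideDenom (hD : IsSideProfile D b C) (h : IsAdmissible b K η δ ζ P R)
    (hDc : ContinuousOn D (Icc 0 1)) {n : ℕ} (hn : 1 ≤ n) {c : ℝ} {Q : ℝ → ℝ}
    (hQ : IsVolterraSol n (fun t => c * sideWeight D ζ P R t) Q) {s : Set ℝ}
    (hs : UniqueDiffOn ℝ s) (hsA : s ⊆ Icc 0 (1 - ζ)) (hDs : ContDiffOn ℝ ∞ D s)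
    (hmean : ∀ (f : ℝ → ℝ) (k : ℕ), ContinuousOn f (Icc 0 (1 - ζ)) → ContDiffOn ℝ k f s →
      ContDiffOn ℝ k (scaledMean n f) s) :
    ContDiffOn ℝ ∞ (fun t => Q t / sideDenom D P R t) s := by
  have hζ := h.ζ_pos
  have hpos : ∀ t ∈ Icc 0 (1 - ζ), (1 + t) ^ 2 * sideDenom D P R t ≠ 0 := fun t ht => by
    have := h.sideDenom_pos hD hDc ht
    have := ht.1
    positivity
  have hDd := contDiffOn_sideDenom hDs P R
  refine ContDiffOn.div ?_ hDd fun t ht => (h.sideDenom_pos hD hDc (hsA ht)).ne'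
  refine hQ.contDiffOn hn ((integrableOn_sideWeight hD h).const_mul c) (A := 1 - ζ)
    (W := fun t => c * ((1 + t) ^ 2 * sideDenom D P R t)⁻¹) (by linarith [h.ζ_lt]) (by linarith)
    ?_ ?_ hs hsA ?_ hmean
  · refine continuousOn_const.mul (ContinuousOn.inv₀ ?_ hpos)
    have := continuousOn_sideDenom (hDc.mono (Icc_subset_Icc_right (by linarith : 1 - ζ ≤ 1))) P R
    fun_prop
  · intro t ht
    simp only
    rw [sideWeight_of_lt ht.2]
  · exact contDiffOn_const.mul (ContDiffOn.inv (by fun_prop) fun t ht => hpos t (hsA ht))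

end

lemma continuousOn_innerProfile : ContinuousOn innerProfile (Icc 0 1) := by
  have := (contDiffOn_logSlope one_pos).continuousOn
  unfold innerProfile
  fun_prop

lemma contDiffOn_innerProfile {A : ℝ} (hA : 0 < A) : ContDiffOn ℝ ∞ innerProfile (Icc 0 A) := by
  have := contDiffOn_logSlope hA
  unfold innerProfile
  fun_prop

lemma continuousOn_outerProfile : ContinuousOn outerProfile (Icc 0 1) := by
  have h1 := continuous_mul_log
  have h2 : ContinuousOn (fun t : ℝ => log (1 + t)) (Icc 0 1) :=
    ContinuousOn.log (by fun_prop) fun t ht => by linarith [ht.1]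
  have h3 : ContinuousOn (fun t : ℝ => (log 2 - (t * log (1 + t) - t * log t)) / 2) (Icc 0 1) :=
    (continuousOn_const.sub ((continuousOn_id.mul h2).sub h1.continuousOn)).div_const _
  refine h3.congr fun t _ => ?_
  rw [outerProfile]
  ring

lemma contDiffOn_outerProfile : ContDiffOn ℝ ∞ outerProfile (Ioi 0) := by
  have h1 : ContDiffOn ℝ ∞ (fun t : ℝ => log (1 + t)) (Ioi 0) :=
    ContDiffOn.log (by fun_prop) fun t ht => by linarith [mem_Ioi.1 ht]
  have h2 : ContDiffOn ℝ ∞ (fun t : ℝ => log t) (Ioi 0) :=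
    ContDiffOn.log (by fun_prop) fun t ht => (mem_Ioi.1 ht).ne'
  unfold outerProfile
  fun_prop

/-- The inner denominator, which is `-(λ + c)` in the coordinate `t = r²`. -/
noncomputable def innerDenom (δ μ : ℝ) : ℝ → ℝ := sideDenom innerProfile (innerShift δ - μ) 0

/-- The outer denominator, which is `λ + c` in the coordinate `t = r⁻²`. -/
noncomputable def outerDenom (δ μ : ℝ) : ℝ → ℝ :=
  sideDenom outerProfile (μ - outerShift δ) (-outerShift δ)

/-- The eigenfunction made of the solutions of the inner and of the outer equation. -/
noncomputable def eigenfunction (n : ℕ) (δ μ : ℝ) (Q₁ Q₂ : ℝ → ℝ) (r : ℝ) : ℝ :=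
  if r ≤ 1 - δ / 2 then -(r ^ (n - 1) * (Q₁ (r ^ 2) / innerDenom δ μ (r ^ 2)) / Q₁ 1)
  else if 1 + δ / 2 ≤ r then
    (r ^ (n + 1))⁻¹ * (Q₂ (r ^ 2)⁻¹ / outerDenom δ μ (r ^ 2)⁻¹) / Q₂ 1
  else 0

lemma one_sub_innerCut (δ : ℝ) : 1 - innerCut δ = (1 - δ / 2) ^ 2 := by rw [innerCut]; ring

lemma one_sub_outerCut (δ : ℝ) : 1 - outerCut δ = ((1 + δ / 2) ^ 2)⁻¹ := by rw [outerCut]; ring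

section

variable {n : ℕ} {δ μ η r : ℝ} {Q₁ Q₂ : ℝ → ℝ}

lemma eigenfunction_of_le (h : r ≤ 1 - δ / 2) : eigenfunction n δ μ Q₁ Q₂ r
    = -(r ^ (n - 1) * (Q₁ (r ^ 2) / innerDenom δ μ (r ^ 2)) / Q₁ 1) := if_pos h

lemma eigenfunction_of_ge (hδ : 0 < δ) (h : 1 + δ / 2 ≤ r) : eigenfunction n δ μ Q₁ Q₂ r
    = (r ^ (n + 1))⁻¹ * (Q₂ (r ^ 2)⁻¹ / outerDenom δ μ (r ^ 2)⁻¹) / Q₂ 1 := by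
  rw [eigenfunction, if_neg (by linarith), if_pos h]

lemma add_cFun_of_le (hδ : 0 < δ) (hδ1 : δ < 1) (hr : 0 ≤ r) (h : r ≤ 1 - δ / 2) :
    log 2 / 2 + μ + cFun (profile δ) r = -innerDenom δ μ (r ^ 2) := by
  rw [cFun_profile_of_le hδ hδ1 hr h, innerDenom, sideDenom, innerProfile]
  ring

/-- Outside, the circulation shift is divided by r², so it contributes -t · `outerShift`. Writing t
= 1 - (1 - t) splits this into the shift P and the slope R, which inside is zero. -/
lemma add_cFun_of_ge (hδ : 0 < δ) (hδ1 : δ < 1) (h : 1 + δ / 2 ≤ r) :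
    log 2 / 2 + μ + cFun (profile δ) r = outerDenom δ μ (r ^ 2)⁻¹ := by
  have hr : 0 < r := by linarith
  have e : log (1 + (r ^ 2)⁻¹) = log (1 + r ^ 2) - log (r ^ 2) := by
    rw [← log_div (by positivity) (by positivity)]
    congr 1
    field_simp
    ring
  rw [cFun_profile_of_ge hδ hδ1 h, outerDenom, sideDenom, outerProfile, e, log_inv]
  field_simp
  ring

lemma inner_mem (hr : 0 ≤ r) (h : r ≤ 1 - δ / 2) :
    r ^ 2 ∈ Icc 0 (1 - innerCut δ) := by
  rw [one_sub_innerCut]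
  exact ⟨by positivity, by gcongr⟩

lemma outer_mem (hδ : 0 < δ) (h : 1 + δ / 2 ≤ r) : (r ^ 2)⁻¹ ∈ Ioc 0 (1 - outerCut δ) := by
  rw [one_sub_outerCut]
  have : 0 < r := by linarith
  exact ⟨by positivity, by gcongr⟩

namespace IsMatched

lemma δ_pos (hm : IsMatched n δ μ η Q₁ Q₂) : 0 < δ := hm.inner_adm.δ_pos

lemma δ_lt (hm : IsMatched n δ μ η Q₁ Q₂) : δ < 1 := hm.inner_adm.δ_lt

lemma innerDenom_ge (hm : IsMatched n δ μ η Q₁ Q₂)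
    (hr : 0 ≤ r) (h : r ≤ 1 - δ / 2) : η * innerCut δ ≤ innerDenom δ μ (r ^ 2) :=
  hm.inner_adm.sideDenom_ge isSideProfile_innerProfile continuousOn_innerProfile
    (inner_mem hr h)

lemma innerDenom_pos (hm : IsMatched n δ μ η Q₁ Q₂)
    (hr : 0 ≤ r) (h : r ≤ 1 - δ / 2) : 0 < innerDenom δ μ (r ^ 2) :=
  (mul_pos hm.inner_adm.η_pos hm.inner_adm.ζ_pos).trans_le (hm.innerDenom_ge hr h)

lemma outerDenom_ge (hm : IsMatched n δ μ η Q₁ Q₂)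
    (h : 1 + δ / 2 ≤ r) : η * outerCut δ ≤ outerDenom δ μ (r ^ 2)⁻¹ :=
  hm.outer_adm.sideDenom_ge isSideProfile_outerProfile continuousOn_outerProfile
    (Ioc_subset_Icc_self (outer_mem hm.δ_pos h))

lemma outerDenom_pos (hm : IsMatched n δ μ η Q₁ Q₂)
    (h : 1 + δ / 2 ≤ r) : 0 < outerDenom δ μ (r ^ 2)⁻¹ :=
  (mul_pos hm.outer_adm.η_pos hm.outer_adm.ζ_pos).trans_le (hm.outerDenom_ge h)

lemma contDiffOn_eigenfunction (hm : IsMatched n δ μ η Q₁ Q₂) (hn : 1 ≤ n) :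
    ContDiffOn ℝ ∞ (eigenfunction n δ μ Q₁ Q₂) (derivSupport (profile δ)) := by
  have hδ := hm.δ_pos
  have hδ1 := hm.δ_lt
  have hi : ContDiffOn ℝ ∞ (eigenfunction n δ μ Q₁ Q₂) (Icc 0 (1 - δ / 2)) := by
    have hA : 0 < 1 - innerCut δ := by linarith [hm.inner_adm.ζ_lt]
    have h := contDiffOn_div_sideDenom isSideProfile_innerProfile hm.inner_adm
      continuousOn_innerProfile hn hm.inner_sol (uniqueDiffOn_Icc hA) le_rfl
      (contDiffOn_innerProfile hA) fun f k _ hf => contDiffOn_scaledMean_Icc hA n hf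
    have h2 : ContDiffOn ℝ ∞ (fun r : ℝ => Q₁ (r ^ 2) / innerDenom δ μ (r ^ 2))
        (Icc 0 (1 - δ / 2)) :=
      h.comp (g := fun t => Q₁ t / innerDenom δ μ t) (f := fun r : ℝ => r ^ 2) (by fun_prop)
        fun r hr => inner_mem hr.1 hr.2
    have h3 : ContDiffOn ℝ ∞ (fun r : ℝ =>
        -(r ^ (n - 1) * (Q₁ (r ^ 2) / innerDenom δ μ (r ^ 2)) / Q₁ 1)) (Icc 0 (1 - δ / 2)) :=
      ((ContDiffOn.mul (by fun_prop) h2).div_const _).neg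
    exact h3.congr fun r hr => eigenfunction_of_le hr.2
  have ho : ContDiffOn ℝ ∞ (eigenfunction n δ μ Q₁ Q₂) (Ici (1 + δ / 2)) := by
    have hA : 0 < 1 - outerCut δ := by linarith [hm.outer_adm.ζ_lt]
    have h := contDiffOn_div_sideDenom isSideProfile_outerProfile hm.outer_adm
      continuousOn_outerProfile hn hm.outer_sol (uniqueDiffOn_Ioc 0 (1 - outerCut δ))
      Ioc_subset_Icc_self (contDiffOn_outerProfile.mono Ioc_subset_Ioi_self)
      fun f k hc hf => contDiffOn_scaledMean_Ioc hA n hc hf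
    have hr0 : ∀ r ∈ Ici (1 + δ / 2), r ≠ 0 := fun r hr => by linarith [mem_Ici.1 hr]
    have h2 : ContDiffOn ℝ ∞ (fun r : ℝ => Q₂ (r ^ 2)⁻¹ / outerDenom δ μ (r ^ 2)⁻¹)
        (Ici (1 + δ / 2)) :=
      h.comp (g := fun t => Q₂ t / outerDenom δ μ t) (f := fun r : ℝ => (r ^ 2)⁻¹)
        (ContDiffOn.inv (by fun_prop) fun r hr => pow_ne_zero _ (hr0 r hr))
        fun r hr => outer_mem hδ hr
    have h3 : ContDiffOn ℝ ∞ (fun r : ℝ =>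
        (r ^ (n + 1))⁻¹ * (Q₂ (r ^ 2)⁻¹ / outerDenom δ μ (r ^ 2)⁻¹) / Q₂ 1)
        (Ici (1 + δ / 2)) :=
      (ContDiffOn.mul (ContDiffOn.inv (by fun_prop) fun r hr => pow_ne_zero _ (hr0 r hr))
        h2).div_const _
    exact h3.congr fun r hr => eigenfunction_of_ge hδ hr
  -- The two pieces of the support lie on different sides of r = 1, so smoothness may be checked on
  -- each of them.
  rw [derivSupport_profile hδ hδ1]
  rintro r (hr | hr)
  · refine (hi r hr).mono_of_mem_nhdsWithin ?_
    rw [mem_nhdsWithin_iff_exists_mem_nhds_inter]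
    refine ⟨Iio 1, Iio_mem_nhds (by linarith [hr.2]), ?_⟩
    rintro x ⟨hx, h | h⟩
    · exact h
    · exact absurd (mem_Iio.1 hx) (by linarith [mem_Ici.1 h])
  · refine (ho r hr).mono_of_mem_nhdsWithin ?_
    rw [mem_nhdsWithin_iff_exists_mem_nhds_inter]
    refine ⟨Ioi 1, Ioi_mem_nhds (by linarith [mem_Ici.1 hr]), ?_⟩
    rintro x ⟨hx, h | h⟩
    · exact absurd (mem_Ioi.1 hx) (by linarith [h.2])
    · exact h

lemma eigenfunction_half_ne_zero (hm : IsMatched n δ μ η Q₁ Q₂)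
    : eigenfunction n δ μ Q₁ Q₂ (1 / 2) ≠ 0 := by
  have hδ1 := hm.δ_lt
  have h1 := hm.innerDenom_pos (r := 1 / 2) (by norm_num) (by linarith)
  have h2 : 1 / 2 ≤ Q₁ ((1 / 2) ^ 2) := hm.inner_sol.half_le ⟨by norm_num, by norm_num⟩
  have h3 := hm.inner_sol.half_le_one
  rw [eigenfunction_of_le (by linarith)]
  have h4 : 0 < Q₁ ((1 / 2) ^ 2) := by linarith
  have h5 : 0 < Q₁ 1 := by linarith
  exact neg_ne_zero.2 (by positivity)

lemma measurable_eigenfunction (hm : IsMatched n δ μ η Q₁ Q₂)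
    : Measurable (eigenfunction n δ μ Q₁ Q₂) := by
  have h1 := hm.inner_sol.cont.measurable
  have h2 := hm.outer_sol.cont.measurable
  have h3 := isSideProfile_innerProfile.meas
  have h4 := isSideProfile_outerProfile.meas
  have h5 : Measurable (innerDenom δ μ) := by
    unfold innerDenom sideDenom
    fun_prop
  have h6 : Measurable (outerDenom δ μ) := by
    unfold outerDenom sideDenom
    fun_prop
  unfold eigenfunction
  refine Measurable.ite measurableSet_Iic (by fun_prop) (Measurable.ite measurableSet_Ici
    (by fun_prop) measurable_const)

lemma exists_abs_eigenfunction_le (hm : IsMatched n δ μ η Q₁ Q₂)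
    : ∃ H, ∀ s, 0 ≤ s → |eigenfunction n δ μ Q₁ Q₂ s| ≤ H := by
  have hδ := hm.δ_pos
  have hδ1 := hm.δ_lt
  have hη := hm.inner_adm.η_pos
  have c1 : 0 < η * innerCut δ := mul_pos hη hm.inner_adm.ζ_pos
  have c2 : 0 < η * outerCut δ := mul_pos hη hm.outer_adm.ζ_pos
  have key : ∀ x q e q' c : ℝ, 0 ≤ x → x ≤ 1 → |q| ≤ 3 / 2 → 0 < c → c ≤ e → 1 / 2 ≤ q' →
      |x * (q / e) / q'| ≤ 3 / c := by
    intro x q e q' c hx hx1 hq hc he hq'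
    have he0 : 0 < e := hc.trans_le he
    have hq0 : 0 < q' := by linarith
    rw [abs_div, abs_mul, abs_div, abs_of_nonneg hx, abs_of_pos he0, abs_of_pos hq0,
      div_le_iff₀ hq0]
    calc x * (|q| / e) ≤ 1 * ((3 / 2) / c) := by gcongr
      _ = 3 / c * (1 / 2) := by ring
      _ ≤ 3 / c * q' := by gcongr
  refine ⟨3 / (η * innerCut δ) + 3 / (η * outerCut δ), fun s hs => ?_⟩
  have p1 : 0 ≤ 3 / (η * innerCut δ) := by positivity
  have p2 : 0 ≤ 3 / (η * outerCut δ) := by positivity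
  by_cases h : s ≤ 1 - δ / 2
  · rw [eigenfunction_of_le h, abs_neg]
    have := key (s ^ (n - 1)) _ _ _ _ (by positivity) (pow_le_one₀ hs (by linarith))
      (hm.inner_sol.abs_le (τ := s ^ 2) ⟨by positivity, pow_le_one₀ hs (by linarith)⟩) c1
      (hm.innerDenom_ge hs h) hm.inner_sol.half_le_one
    linarith
  by_cases h' : 1 + δ / 2 ≤ s
  · have h1 : 1 ≤ s := by linarith
    rw [eigenfunction_of_ge hδ h']
    have := key (s ^ (n + 1))⁻¹ _ _ _ _ (by positivity) (inv_le_one_of_one_le₀ (one_le_pow₀ h1))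
      (hm.outer_sol.abs_le (τ := (s ^ 2)⁻¹) ⟨by positivity, inv_le_one_of_one_le₀ (one_le_pow₀ h1)⟩)
      c2 (hm.outerDenom_ge h') hm.outer_sol.half_le_one
    linarith
  · rw [eigenfunction, if_neg h, if_neg h', abs_zero]
    positivity

end IsMatched

end

/-! ### The eigenvalue equation -/

lemma image_sq_Ioo {a : ℝ} (ha : 0 < a) : (fun s : ℝ => s ^ 2) '' Ioo 0 a = Ioo 0 (a ^ 2) := by
  ext t
  constructor
  · rintro ⟨s, hs, rfl⟩
    have := hs.1
    exact ⟨by positivity, pow_lt_pow_left₀ hs.2 hs.1.le two_ne_zero⟩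
  · intro ht
    exact ⟨√t, ⟨sqrt_pos.2 ht.1, (sqrt_lt' ha).2 ht.2⟩, sq_sqrt ht.1.le⟩

lemma injOn_sq_Ioi : InjOn (fun s : ℝ => s ^ 2) (Ioi 0) := fun _ hx _ hy h =>
  (pow_left_inj₀ (le_of_lt hx) (le_of_lt hy) two_ne_zero).1 h

lemma image_inv_sq_Ioi {b : ℝ} (hb : 0 < b) :
    (fun s : ℝ => (s ^ 2)⁻¹) '' Ioi b = Ioo 0 (b ^ 2)⁻¹ := by
  ext t
  constructor
  · rintro ⟨s, hs, rfl⟩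
    have hs' : b < s := hs
    have : 0 < s := hb.trans hs'
    exact ⟨by positivity, inv_strictAnti₀ (by positivity) (pow_lt_pow_left₀ hs' hb.le two_ne_zero)⟩
  · intro ht
    have ht0 := ht.1
    refine ⟨(√t)⁻¹, ?_, ?_⟩
    · rw [mem_Ioi, lt_inv_comm₀ hb (sqrt_pos.2 ht0), sqrt_lt' (by positivity), inv_pow]
      exact ht.2
    · simp only [inv_pow, inv_inv, sq_sqrt ht0.le]

lemma integral_comp_sq {a : ℝ} (ha : 0 < a) {G : ℝ → ℝ} (hG : IntegrableOn G (Ioo 0 (a ^ 2))) :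
    IntegrableOn (fun s => 2 * s * G (s ^ 2)) (Ioo 0 a) ∧
      ∫ s in Ioo 0 a, 2 * s * G (s ^ 2) = ∫ t in Ioo 0 (a ^ 2), G t := by
  have hd : ∀ s ∈ Ioo 0 a, HasDerivWithinAt (fun s : ℝ => s ^ 2) (2 * s) (Ioo 0 a) s := fun s _ => by
    simpa using (hasDerivAt_pow 2 s).hasDerivWithinAt
  have hinj : InjOn (fun s : ℝ => s ^ 2) (Ioo 0 a) := injOn_sq_Ioi.mono Ioo_subset_Ioi_self
  have e : EqOn (fun s => |2 * s| • G (s ^ 2)) (fun s => 2 * s * G (s ^ 2)) (Ioo 0 a) := fun s hs => by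
    have := hs.1
    simp only [smul_eq_mul, abs_of_pos (by positivity : 0 < 2 * s)]
  rw [← image_sq_Ioo ha] at hG ⊢
  rw [integrableOn_image_iff_integrableOn_abs_deriv_smul measurableSet_Ioo hd hinj] at hG
  rw [integral_image_eq_integral_abs_deriv_smul measurableSet_Ioo hd hinj]
  exact ⟨hG.congr_fun e measurableSet_Ioo, (setIntegral_congr_fun measurableSet_Ioo e).symm⟩

lemma integral_comp_inv_sq {b : ℝ} (hb : 0 < b) {G : ℝ → ℝ}
    (hG : IntegrableOn G (Ioo 0 (b ^ 2)⁻¹)) :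
    IntegrableOn (fun s => 2 / s ^ 3 * G (s ^ 2)⁻¹) (Ioi b) ∧
      ∫ s in Ioi b, 2 / s ^ 3 * G (s ^ 2)⁻¹ = ∫ t in Ioo 0 (b ^ 2)⁻¹, G t := by
  have hd : ∀ s ∈ Ioi b, HasDerivWithinAt (fun s : ℝ => (s ^ 2)⁻¹) (-(2 / s ^ 3)) (Ioi b) s := by
    intro s hs
    have hs0 : s ≠ 0 := (hb.trans hs).ne'
    refine ((hasDerivAt_pow 2 s).fun_inv (pow_ne_zero 2 hs0)).hasDerivWithinAt.congr_deriv ?_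
    field_simp
    simp
    ring
  have hinj : InjOn (fun s : ℝ => (s ^ 2)⁻¹) (Ioi b) := fun x hx y hy h =>
    injOn_sq_Ioi (hb.trans hx) (hb.trans hy) (inv_injective h)
  have e : EqOn (fun s => |-(2 / s ^ 3)| • G (s ^ 2)⁻¹) (fun s => 2 / s ^ 3 * G (s ^ 2)⁻¹)
      (Ioi b) := fun s hs => by
    have : 0 < s := hb.trans hs
    simp only [smul_eq_mul, abs_neg, abs_of_pos (by positivity : 0 < 2 / s ^ 3)]
  rw [← image_inv_sq_Ioi hb] at hG ⊢
  rw [integrableOn_image_iff_integrableOn_abs_deriv_smul measurableSet_Ioi hd hinj] at hG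
  rw [integral_image_eq_integral_abs_deriv_smul measurableSet_Ioi hd hinj]
  exact ⟨hG.congr_fun e measurableSet_Ioi, (setIntegral_congr_fun measurableSet_Ioi e).symm⟩

section

variable {n : ℕ} {r s : ℝ}

/-- The power s^(n-1) of the inner eigenfunction turns K_n into the Volterra factor in t = s², with
a prefactor that depends on r only. -/
lemma pow_mul_kernelK (hn : 1 ≤ n) (hr : 0 ≤ r) (hs : 0 < s) :
    s ^ (n - 1) * kernelK n (r / s) = r ^ (n - 1) / 2 * (s ^ 2 / max (r ^ 2) (s ^ 2)) ^ n := by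
  obtain ⟨k, rfl⟩ : ∃ k, n = k + 1 := ⟨n - 1, by omega⟩
  rw [Nat.add_sub_cancel, kernelK, Nat.add_sub_cancel]
  split_ifs with h
  · rw [div_le_one hs] at h
    rw [max_eq_right (by gcongr), div_self (by positivity), one_pow, div_pow]
    field_simp
  · rw [div_le_one hs, not_le] at h
    have hr0 : 0 < r := hs.trans h
    rw [max_eq_left (by gcongr), div_pow, div_pow]
    field_simp
    ring

/-- The kernel separates when r lies beyond s: all r of the outer side see the same inner integral,
up to the factor r^(-n-1). The counterpart with the sides exchanged is `inv_pow_mul_kernelK_of_le`.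
-/
lemma pow_mul_kernelK_of_le (hn : 1 ≤ n) (hs : 0 < s) (h : s < r) :
    s ^ (n - 1) * kernelK n (r / s) = (r ^ (n + 1))⁻¹ / 2 * (s ^ 2) ^ n := by
  have hr : 0 < r := hs.trans h
  obtain ⟨k, rfl⟩ : ∃ k, n = k + 1 := ⟨n - 1, by omega⟩
  rw [pow_mul_kernelK hn hr.le hs, max_eq_left (by gcongr), Nat.add_sub_cancel, div_pow]
  field_simp
  ring

lemma inv_pow_mul_kernelK_of_le (hn : 1 ≤ n) (hs : 0 < s) (h : r ≤ s) :
    (s ^ (n + 1))⁻¹ * kernelK n (r / s) = r ^ (n - 1) / 2 * ((s ^ 2)⁻¹) ^ n := by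
  obtain ⟨k, rfl⟩ : ∃ k, n = k + 1 := ⟨n - 1, by omega⟩
  rw [kernelK, if_pos ((div_le_one hs).2 h), Nat.add_sub_cancel, div_pow, inv_pow]
  field_simp
  ring

lemma inv_pow_mul_kernelK (hn : 1 ≤ n) (hr : 0 < r) (hs : 0 < s) :
    (s ^ (n + 1))⁻¹ * kernelK n (r / s)
      = (r ^ (n + 1))⁻¹ / 2 * ((s ^ 2)⁻¹ / max (r ^ 2)⁻¹ (s ^ 2)⁻¹) ^ n := by
  rcases le_or_gt r s with h | h
  · rw [inv_pow_mul_kernelK_of_le hn hs h, max_eq_left (by gcongr)]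
    obtain ⟨k, rfl⟩ : ∃ k, n = k + 1 := ⟨n - 1, by omega⟩
    rw [Nat.add_sub_cancel, div_pow, inv_pow, inv_pow]
    field_simp
    ring
  · rw [max_eq_right (by gcongr), div_self (by positivity), one_pow, kernelK,
      if_neg (by rw [div_le_one hs]; linarith), div_pow]
    field_simp

end

namespace IsMatched

variable {n : ℕ} {δ μ η r A τ : ℝ} {Q₁ Q₂ : ℝ → ℝ}

/-- The hypothesis on the kernel covers both positions of r. For r inside, τ = r²; for r outside, τ
= 1, the solution term vanishes and only the flux is left. -/
lemma inner_integral (hm : IsMatched n δ μ η Q₁ Q₂) (hn : 1 ≤ n) (hτ : τ ∈ Icc (0 : ℝ) 1)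
    (hk : ∀ s ∈ Ioo 0 (1 - δ / 2),
      s ^ (n - 1) * kernelK n (r / s) = A * (s ^ 2 / max τ (s ^ 2)) ^ n) :
    IntegrableOn (fun s => deriv (profile δ) s * kernelK n (r / s) * eigenfunction n δ μ Q₁ Q₂ s)
        (Ioo 0 (1 - δ / 2)) ∧
      ∫ s in Ioo 0 (1 - δ / 2), deriv (profile δ) s * kernelK n (r / s)
          * eigenfunction n δ μ Q₁ Q₂ s
        = A * (volterraFlux n (fun t => 1 * innerWeight δ μ t) Q₁
          + 2 * n * (Q₁ τ / Q₁ 1 - 1)) := by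
  have hδ := hm.δ_pos
  have hδ1 := hm.δ_lt
  have ha : 0 < 1 - δ / 2 := by linarith
  have hQ : Q₁ 1 ≠ 0 := by linarith [hm.inner_sol.half_le_one]
  have hv : IntegrableOn (fun t => 1 * innerWeight δ μ t) (Ioo 0 1) :=
    (integrableOn_sideWeight isSideProfile_innerProfile hm.inner_adm).const_mul 1
  set G : ℝ → ℝ := fun t => A / Q₁ 1 * ((t / max τ t) ^ n * (1 * innerWeight δ μ t * Q₁ t)) with hG
  have hGi : IntegrableOn G (Ioo 0 1) := (hm.inner_sol.integrableOn_div_max hv τ).const_mul _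
  have hsub : Ioo 0 ((1 - δ / 2) ^ 2) ⊆ Ioo 0 1 := Ioo_subset_Ioo_right (by nlinarith)
  obtain ⟨h1, h2⟩ := integral_comp_sq ha (hGi.mono_set hsub)
  have e : EqOn (fun s => 2 * s * G (s ^ 2)) (fun s => deriv (profile δ) s * kernelK n (r / s)
      * eigenfunction n δ μ Q₁ Q₂ s) (Ioo 0 (1 - δ / 2)) := by
    intro s hs
    have hd := hm.innerDenom_pos hs.1.le hs.2.le
    have hw : innerWeight δ μ (s ^ 2) = ((1 + s ^ 2) ^ 2 * innerDenom δ μ (s ^ 2))⁻¹ :=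
      sideWeight_of_lt (by rw [one_sub_innerCut]; exact pow_lt_pow_left₀ hs.2 hs.1.le two_ne_zero)
    have hk' := hk s hs
    simp only [hG]
    rw [deriv_profile_of_lt hs.2, eigenfunction_of_le hs.2.le, hw, vortexDeriv]
    calc _ = 2 * s / (1 + s ^ 2) ^ 2 * (Q₁ (s ^ 2) / innerDenom δ μ (s ^ 2)) / Q₁ 1
          * (A * (s ^ 2 / max τ (s ^ 2)) ^ n) := by
            rw [mul_inv]
            ring
      _ = _ := by
            rw [← hk']
            ring
  refine ⟨h1.congr_fun e measurableSet_Ioo, ?_⟩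
  -- The weight is zero beyond the cut, so the integral extends to (0, 1), where the Volterra
  -- equation lives.
  rw [← setIntegral_congr_fun measurableSet_Ioo e, h2,
    ← setIntegral_eq_of_subset_of_forall_sdiff_eq_zero measurableSet_Ioo hsub, hG,
    integral_const_mul, hm.inner_sol.integral_div_max hn hv hτ]
  · field_simp
  · intro t ht
    have : innerWeight δ μ t = 0 := by
      apply sideWeight_of_ge
      rw [one_sub_innerCut]
      by_contra h
      exact ht.2 ⟨ht.1.1, not_le.1 h⟩
    simp only [hG, this, mul_zero, zero_mul]

lemma outer_integral (hm : IsMatched n δ μ η Q₁ Q₂) (hn : 1 ≤ n) (hτ : τ ∈ Icc (0 : ℝ) 1)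
    (hk : ∀ s ∈ Ioi (1 + δ / 2),
      (s ^ (n + 1))⁻¹ * kernelK n (r / s) = A * ((s ^ 2)⁻¹ / max τ (s ^ 2)⁻¹) ^ n) :
    IntegrableOn (fun s => deriv (profile δ) s * kernelK n (r / s) * eigenfunction n δ μ Q₁ Q₂ s)
        (Ioi (1 + δ / 2)) ∧
      ∫ s in Ioi (1 + δ / 2), deriv (profile δ) s * kernelK n (r / s)
          * eigenfunction n δ μ Q₁ Q₂ s
        = A * (volterraFlux n (fun t => -1 * outerWeight δ μ t) Q₂
          + 2 * n * (Q₂ τ / Q₂ 1 - 1)) := by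
  have hδ := hm.δ_pos
  have hδ1 := hm.δ_lt
  have hb : 0 < 1 + δ / 2 := by linarith
  have hQ : Q₂ 1 ≠ 0 := by linarith [hm.outer_sol.half_le_one]
  have hv : IntegrableOn (fun t => -1 * outerWeight δ μ t) (Ioo 0 1) :=
    (integrableOn_sideWeight isSideProfile_outerProfile hm.outer_adm).const_mul (-1)
  set G : ℝ → ℝ := fun t => A / Q₂ 1 * ((t / max τ t) ^ n * (-1 * outerWeight δ μ t * Q₂ t)) with hG
  have hGi : IntegrableOn G (Ioo 0 1) := (hm.outer_sol.integrableOn_div_max hv τ).const_mul _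
  have hsub : Ioo 0 ((1 + δ / 2) ^ 2)⁻¹ ⊆ Ioo 0 1 :=
    Ioo_subset_Ioo_right (inv_le_one_of_one_le₀ (one_le_pow₀ (by linarith)))
  obtain ⟨h1, h2⟩ := integral_comp_inv_sq hb (hGi.mono_set hsub)
  have e : EqOn (fun s => 2 / s ^ 3 * G (s ^ 2)⁻¹) (fun s => deriv (profile δ) s
      * kernelK n (r / s) * eigenfunction n δ μ Q₁ Q₂ s) (Ioi (1 + δ / 2)) := by
    intro s hs
    have hs' : 1 + δ / 2 < s := hs
    have hs0 : 0 < s := hb.trans hs'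
    have hd := hm.outerDenom_pos hs'.le
    have hw : outerWeight δ μ (s ^ 2)⁻¹
        = ((1 + (s ^ 2)⁻¹) ^ 2 * outerDenom δ μ (s ^ 2)⁻¹)⁻¹ :=
      sideWeight_of_lt (by rw [one_sub_outerCut]; gcongr)
    have hk' := hk s hs
    simp only [hG]
    rw [deriv_profile_of_gt hδ hs', eigenfunction_of_ge hδ hs'.le, hw]
    -- Outside, λ + c > 0 and the negative sign of ϖ' persists; inside, λ + c < 0 reverses it. This
    -- is the reason for the factors -1 and 1 of the two weights.
    have hvd : vortexDeriv s = -(2 / s ^ 3) * ((1 + (s ^ 2)⁻¹) ^ 2)⁻¹ := by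
      rw [vortexDeriv]
      field_simp
      ring
    rw [hvd]
    calc _ = -(2 / s ^ 3) * ((1 + (s ^ 2)⁻¹) ^ 2)⁻¹
          * (Q₂ (s ^ 2)⁻¹ / outerDenom δ μ (s ^ 2)⁻¹) / Q₂ 1
          * (A * ((s ^ 2)⁻¹ / max τ (s ^ 2)⁻¹) ^ n) := by
            rw [mul_inv ((1 + (s ^ 2)⁻¹) ^ 2)]
            ring
      _ = _ := by
            rw [← hk']
            ring
  refine ⟨h1.congr_fun e measurableSet_Ioi, ?_⟩
  rw [← setIntegral_congr_fun measurableSet_Ioi e, h2,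
    ← setIntegral_eq_of_subset_of_forall_sdiff_eq_zero measurableSet_Ioo hsub, hG,
    integral_const_mul, hm.outer_sol.integral_div_max hn hv hτ]
  · field_simp
  · intro t ht
    have : outerWeight δ μ t = 0 := by
      apply sideWeight_of_ge
      rw [one_sub_outerCut]
      by_contra h
      exact ht.2 ⟨ht.1.1, not_le.1 h⟩
    simp only [hG, this, mul_zero, zero_mul]

lemma integral_Ioi (hm : IsMatched n δ μ η Q₁ Q₂) {F : ℝ → ℝ} {x y : ℝ}
    (h₁ : IntegrableOn (fun s => deriv (profile δ) s * F s) (Ioo 0 (1 - δ / 2)) ∧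
      ∫ s in Ioo 0 (1 - δ / 2), deriv (profile δ) s * F s = x)
    (h₂ : IntegrableOn (fun s => deriv (profile δ) s * F s) (Ioi (1 + δ / 2)) ∧
      ∫ s in Ioi (1 + δ / 2), deriv (profile δ) s * F s = y) :
    IntegrableOn (fun s => deriv (profile δ) s * F s) (Ioi 0) ∧
      ∫ s in Ioi (0 : ℝ), deriv (profile δ) s * F s = x + y := by
  have hδ := hm.δ_pos
  have hδ1 := hm.δ_lt
  have hsub : Ioo 0 (1 - δ / 2) ∪ Ioi (1 + δ / 2) ⊆ Ioi 0 :=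
    union_subset Ioo_subset_Ioi_self (Ioi_subset_Ioi (by linarith))
  have hdisj : Disjoint (Ioo 0 (1 - δ / 2)) (Ioi (1 + δ / 2)) :=
    Set.disjoint_left.2 fun s hs hs' => by linarith [hs.2, mem_Ioi.1 hs']
  have h0 : ∀ᵐ s : ℝ, s ∈ Ioi 0 \ (Ioo 0 (1 - δ / 2) ∪ Ioi (1 + δ / 2)) →
      deriv (profile δ) s * F s = 0 := by
    have e1 : ∀ᵐ s : ℝ, s ≠ 1 - δ / 2 := by simp [ae_iff, measure_singleton]
    have e2 : ∀ᵐ s : ℝ, s ≠ 1 + δ / 2 := by simp [ae_iff, measure_singleton]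
    filter_upwards [e1, e2] with s hs1 hs2 hs
    have h3 : 1 - δ / 2 ≤ s := not_lt.1 fun h => hs.2 (Or.inl ⟨hs.1, h⟩)
    have h4 : s ≤ 1 + δ / 2 := not_lt.1 fun h => hs.2 (Or.inr h)
    rw [deriv_profile_of_mem (lt_of_le_of_ne h3 hs1.symm) (lt_of_le_of_ne h4 hs2), zero_mul]
  refine ⟨(h₁.1.union h₂.1).of_ae_sdiff_eq_zero measurableSet_Ioi.nullMeasurableSet h0, ?_⟩
  rw [setIntegral_eq_of_subset_of_ae_sdiff_eq_zero measurableSet_Ioi.nullMeasurableSet hsub h0,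
    setIntegral_union hdisj measurableSet_Ioi h₁.1 h₂.1, h₁.2, h₂.2]

/-- Matched solutions give an eigenfunction. -/
theorem solvesEigenEq (hm : IsMatched n δ μ η Q₁ Q₂) (hn : 1 ≤ n) :
    SolvesEigenEq n (profile δ) (log 2 / 2 + μ) (eigenfunction n δ μ Q₁ Q₂) := by
  have hδ := hm.δ_pos
  have hδ1 := hm.δ_lt
  have hn0 : (n : ℝ) ≠ 0 := by positivity
  have hQ₁ : Q₁ 1 ≠ 0 := by linarith [hm.inner_sol.half_le_one]
  have hQ₂ : Q₂ 1 ≠ 0 := by linarith [hm.outer_sol.half_le_one]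
  have hflux := hm.flux
  have h1m : (1 : ℝ) ∈ Icc (0 : ℝ) 1 := ⟨zero_le_one, le_rfl⟩
  intro r hr
  rw [derivSupport_profile hδ hδ1] at hr
  have hr0 : 0 ≤ r := by
    rcases hr with hr | hr
    · exact hr.1
    · linarith [mem_Ici.1 hr]
  refine ⟨integrableOn_deriv_profile_mul_kernelK hδ 1 hr0, ?_⟩
  simp only [mul_assoc (deriv (profile δ) _)]
  rcases hr with hr | hr
  · have i1 := hm.inner_integral hn (r := r) (A := r ^ (n - 1) / 2) (τ := r ^ 2)
      ⟨by positivity, pow_le_one₀ hr0 (by linarith [hr.2])⟩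
      fun s hs => pow_mul_kernelK hn hr0 hs.1
    have i2 := hm.outer_integral hn (r := r) (A := r ^ (n - 1) / 2) (τ := 1) h1m
      fun s hs => by
        have hs' : 1 + δ / 2 < s := hs
        rw [inv_pow_mul_kernelK_of_le hn (by linarith) (by linarith [hr.2]),
          max_eq_left (inv_le_one_of_one_le₀ (one_le_pow₀ (by linarith))), div_one]
    simp only [mul_assoc (deriv (profile δ) _)] at i1 i2
    obtain ⟨h1, h2⟩ := hm.integral_Ioi i1 i2
    refine ⟨h1, ?_⟩
    have hd := (hm.innerDenom_pos hr0 hr.2).ne'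
    -- The fluxes of the two sides cancel the -2n of the inner integral, and what remains is
    -- r^(n-1)/2 times 2n Q₁(r²)/Q₁(1), which is n (λ + c) h.
    rw [h2, add_cFun_of_le hδ hδ1 hr0 hr.2, eigenfunction_of_le hr.2, ← mul_add,
      eq_sub_of_add_eq hflux, div_self hQ₂]
    field_simp
    ring
  · have hr' : 1 + δ / 2 ≤ r := hr
    have hrp : 0 < r := by linarith
    have i1 := hm.inner_integral hn (r := r) (A := (r ^ (n + 1))⁻¹ / 2) (τ := 1) h1m
      fun s hs => by
        rw [pow_mul_kernelK_of_le hn hs.1 (by linarith [hs.2]),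
          max_eq_left (pow_le_one₀ hs.1.le (by linarith [hs.2])), div_one]
    have i2 := hm.outer_integral hn (r := r) (A := (r ^ (n + 1))⁻¹ / 2) (τ := (r ^ 2)⁻¹)
      ⟨by positivity, inv_le_one_of_one_le₀ (one_le_pow₀ (by linarith))⟩
      fun s hs => inv_pow_mul_kernelK hn hrp (by linarith [mem_Ioi.1 hs])
    simp only [mul_assoc (deriv (profile δ) _)] at i1 i2
    obtain ⟨h1, h2⟩ := hm.integral_Ioi i1 i2
    refine ⟨h1, ?_⟩
    have hd := (hm.outerDenom_pos hr').ne'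
    rw [h2, add_cFun_of_ge hδ hδ1 hr', eigenfunction_of_ge hδ hr', ← mul_add,
      eq_sub_of_add_eq hflux, div_self hQ₁]
    generalize (r ^ 2)⁻¹ = t at hd ⊢
    field_simp
    ring

end IsMatched

/-! ### The rotating wave -/

/-- Up to radius 3/2 the crude bound 2 suffices because 2 (1 + 9/4) ≤ 7; beyond 3/2 > 1 + δ/2 the
profile is the vortex itself. -/
lemma abs_deriv_profile_le_inv {δ : ℝ} (hδ : 0 < δ) (hδ1 : δ < 1) {s : ℝ} (hs : 0 < s) :
    |deriv (profile δ) s| ≤ 7 * (1 + s ^ 2)⁻¹ := by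
  rw [← div_eq_mul_inv]
  rcases le_or_gt s (3 / 2) with h | h
  · refine (abs_deriv_profile_le hδ s).trans ?_
    rw [le_div_iff₀ (by positivity)]
    nlinarith
  · rw [deriv_profile_of_gt hδ (by linarith), vortexDeriv, abs_div, abs_neg,
      abs_of_pos (by positivity : 0 < 2 * s), abs_of_pos (by positivity : 0 < (1 + s ^ 2) ^ 2),
      div_le_div_iff₀ (by positivity) (by positivity)]
    have h1 : 2 * s ≤ 7 * (1 + s ^ 2) := by nlinarith
    have h2 : 0 < 1 + s ^ 2 := by positivity
    nlinarith

lemma abs_profile_le_inv {δ : ℝ} (hδ : 0 < δ) (hδ1 : δ < 1) {s : ℝ} (hs : 0 < s) :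
    |profile δ s| ≤ 7 * (1 + s ^ 2)⁻¹ := by
  rcases le_or_gt s (3 / 2) with h | h
  · refine (abs_profile_le hδ s).trans ?_
    rw [← div_eq_mul_inv, le_div_iff₀ (by positivity)]
    nlinarith
  · rw [profile_of_ge hδ (by linarith), abs_of_pos (vortex_pos s), vortex]
    have : 0 < (1 + s ^ 2)⁻¹ := by positivity
    linarith

/-- A bounded solution of the eigenvalue equation gives a rigidly rotating solution of the
linearized Euler equation. -/
theorem solvesLinearizedEuler_rotatingWave {δ : ℝ} (hδ : 0 < δ) (hδ1 : δ < 1) {n : ℕ} (hn : 1 ≤ n)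
    {lam H : ℝ} {h : ℝ → ℝ} (hm : Measurable h) (hH : ∀ s, 0 ≤ s → |h s| ≤ H)
    (heq : SolvesEigenEq n (profile δ) lam h) :
    SolvesLinearizedEuler (profile δ) (rotatingWave n (profile δ) lam h) := by
  have hn0 : (n : ℝ) ≠ 0 := by positivity
  have hpm : Measurable (profile δ) := (lipschitzWith_profile hδ).continuous.measurable
  have hgm : Measurable fun s => h s * deriv (profile δ) s := hm.mul (measurable_deriv _)
  have hH0 : 0 ≤ H := (abs_nonneg _).trans (hH 0 le_rfl)
  have hgb : ∀ s, 0 < s → |h s * deriv (profile δ) s| ≤ H * 7 * (1 + s ^ 2)⁻¹ := fun s hs => by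
    rw [abs_mul, mul_assoc]
    exact mul_le_mul (hH s hs.le) (abs_deriv_profile_le_inv hδ hδ1 hs) (abs_nonneg _) hH0
  refine ⟨fun t r θ => ?_, fun t r θ hr => ?_⟩
  · unfold rotatingWave
    rw [← cos_add_nat_mul_two_pi (n * (θ - lam * t)) n]
    ring_nf
  have hθ : HasDerivAt (fun x => rotatingWave n (profile δ) lam h t r x)
      (-(h r * deriv (profile δ) r * n * sin (n * (θ - lam * t)))) θ := by
    have := ((((hasDerivAt_id θ).sub_const (lam * t)).const_mul (n : ℝ)).cos).const_mul
      (h r * deriv (profile δ) r)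
    refine this.congr_deriv ?_
    simp only [id]
    ring
  have ht : HasDerivAt (fun x => rotatingWave n (profile δ) lam h x r θ)
      (h r * deriv (profile δ) r * n * lam * sin (n * (θ - lam * t))) t := by
    have := (((((hasDerivAt_id t).const_mul lam).const_sub θ).const_mul (n : ℝ)).cos).const_mul
      (h r * deriv (profile δ) r)
    refine this.congr_deriv ?_
    simp only [id]
    ring
  refine ⟨ht.differentiableAt, hθ.differentiableAt, ?_, ?_, ?_⟩
  · refine integrableOn_radialIntegrand hr θ (H * 7) ?_ fun s β hs => ?_
    · unfold rotatingWave
      have : Measurable fun p : ℝ × ℝ => h p.1 * deriv (profile δ) p.1 := hgm.comp measurable_fst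
      exact this.mul (by fun_prop)
    · rw [rotatingWave, abs_mul]
      exact (mul_le_of_le_one_right (abs_nonneg _) (abs_cos_le_one _)).trans (hgb s hs)
  · exact integrableOn_angularIntegrand hr θ 7 (hpm.comp measurable_fst)
      fun s _ hs => abs_profile_le_inv hδ hδ1 hs
  · have hR : velR (rotatingWave n (profile δ) lam h t) r θ
        = -(sin (n * (θ - lam * t)) * ∫ s in Ioi (0 : ℝ), h s * deriv (profile δ) s
          * kernelK n (r / s)) := velR_fourier_mode hr θ (lam * t) (H * 7) hn hgm hgb
    have hT : velθ (fun s _ => profile δ s) r θ / r = -cFun (profile δ) r := by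
      rw [velθ_radial hr θ 7 hpm fun s hs => abs_profile_le_inv hδ hδ1 hs, cFun_profile hδ hr]
      field_simp
    rw [ht.deriv, hθ.deriv, hR, hT]
    -- The eigenvalue equation is available only on the support; elsewhere every term carries the
    -- factor ϖ'(r).
    by_cases hd : deriv (profile δ) r = 0
    · rw [hd]
      ring
    · obtain ⟨-, -, e⟩ := heq r (subset_closure ⟨hr, hd⟩)
      have e' : ∫ s in Ioi (0 : ℝ), h s * deriv (profile δ) s * kernelK n (r / s)
          = ∫ s in Ioi (0 : ℝ), deriv (profile δ) s * kernelK n (r / s) * h s := by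
        congr 1
        ext s
        ring
      rw [e']
      have e2 : ∫ s in Ioi (0 : ℝ), deriv (profile δ) s * kernelK n (r / s) * h s
          = n * ((lam + cFun (profile δ) r) * h r) := by
        field_simp at e
        linarith
      rw [e2]
      ring

lemma isNonradialRotating_rotatingWave {n : ℕ} (hn : 1 ≤ n) {lam : ℝ} (hlam : 0 < lam)
    {ϖ h : ℝ → ℝ} {r : ℝ} (hr : 0 < r) (hh : h r ≠ 0) (hϖ : deriv ϖ r ≠ 0) :
    IsNonradialRotating n lam (rotatingWave n ϖ lam h) := by
  have hn0 : (0 : ℝ) < n := by positivity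
  refine ⟨fun t r θ => ?_, ⟨2 * π / (n * lam), by positivity, fun t r θ => ?_⟩, fun t r θ => ?_,
    fun t => ⟨r, hr, lam * t, lam * t + π / n, ?_⟩⟩
  · simp [rotatingWave]
  · have e : (n : ℝ) * (θ - lam * (t + 2 * π / (n * lam))) = n * (θ - lam * t) - 2 * π := by
      field_simp
      ring
    rw [rotatingWave, e, cos_sub_two_pi, rotatingWave]
  · have e : (n : ℝ) * (θ + 2 * π / n - lam * t) = n * (θ - lam * t) + 2 * π := by
      field_simp
      ring
    rw [rotatingWave, e, cos_add_two_pi, rotatingWave]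
  · have e : (n : ℝ) * (lam * t + π / n - lam * t) = π := by
      field_simp
      ring
    rw [rotatingWave, rotatingWave, e, sub_self, mul_zero, cos_zero, cos_pi]
    intro hc
    have := mul_left_cancel₀ (mul_ne_zero hh hϖ) hc
    norm_num at this

end LinearizedEuler


/-! ### Assembly of the theorem. -/

theorem theorem1p1 :
    ∃ N : ℕ, ∀ n : ℕ, N ≤ n →
      ∃ lam₁ ∈ Ioo (-(log 2 / 2)) (-((1 - log 2) / 2)), ∃ M : ℝ,
        ∀ α : ℝ≥0, 0 < α → α < 1 → ∀ ε : ℝ, 0 < ε →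
          ∃ δ₁ ∈ Ioc (0 : ℝ) 1, ∀ δ ∈ Ioo (0 : ℝ) δ₁,
            MemW1InftyWith (profile δ) (deriv (profile δ)) ∧
            holderFullNorm α (fun r => (1 + r ^ 2)⁻¹ - profile δ r) ≤ ENNReal.ofReal ε ∧
            AntitoneOn (profile δ) (Ici 0) ∧
            (∀ r ∈ Ioo (1 - δ / 2) (1 + δ / 2), profile δ r = profile δ 1) ∧
            derivSupport (profile δ) = Icc 0 (1 - δ / 2) ∪ Ici (1 + δ / 2) ∧
            ∃ lam lam₂ : ℝ, ∃ h : ℝ → ℝ,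
              lam = log 2 / 2 + δ * lam₁ + δ ^ 2 * log δ ^ 2 * lam₂ ∧
              |lam₂| ≤ M ∧ 0 < lam ∧
              ContDiffOn ℝ ∞ h (derivSupport (profile δ)) ∧
              (∃ r ∈ derivSupport (profile δ), h r ≠ 0) ∧
              SolvesEigenEq n (profile δ) lam h ∧
              SolvesLinearizedEuler (profile δ) (rotatingWave n (profile δ) lam h) ∧
              IsNonradialRotating n lam (rotatingWave n (profile δ) lam h) := by
  obtain ⟨N, hN, hmain⟩ := exists_isMatched
  refine ⟨N, fun n hn => ?_⟩
  obtain ⟨lam₁, hlam₁, M, δ₀, hδ₀, hδ₀1, hδ₀m⟩ := hmain n hn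
  refine ⟨lam₁, hlam₁, M, fun α _ hα1 ε hε => ?_⟩
  have hα1' : (α : ℝ) < 1 := hα1
  have hp : 0 < 1 - (α : ℝ) := by linarith
  -- The second entry solves 2 δ^(1-α) = ε. Only δ₁ depends on α and ε; lam₁ and M are fixed before.
  refine ⟨min δ₀ ((ε / 2) ^ (1 - (α : ℝ))⁻¹), ⟨lt_min hδ₀ (by positivity),
    (min_le_left _ _).trans hδ₀1⟩, fun δ hδ => ?_⟩
  have hδ0 : 0 < δ := hδ.1
  have hδlt : δ < δ₀ := hδ.2.trans_le (min_le_left _ _)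
  have hδ1 : δ < 1 := hδlt.trans_le hδ₀1
  have hδε : 2 * δ ^ (1 - α : ℝ) ≤ ε := by
    have h1 : δ ^ (1 - α : ℝ) ≤ ((ε / 2) ^ (1 - (α : ℝ))⁻¹) ^ (1 - α : ℝ) :=
      rpow_le_rpow hδ0.le (hδ.2.le.trans (min_le_right _ _)) hp.le
    rw [rpow_inv_rpow (by positivity) hp.ne'] at h1
    linarith
  obtain ⟨ℓ, hℓ, hℓ2, η, Q₁, Q₂, hm⟩ := hδ₀m δ ⟨hδ0, hδlt⟩
  have hn1 : 1 ≤ n := by omega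
  have hL : 0 < δ * log δ ^ 2 := by
    have := (log_neg hδ0 hδ1).ne
    positivity
  -- From ℓ > -log 2 / 2 and δ < 1.
  have hlam : 0 < log 2 / 2 + δ * ℓ := by
    have h2 : 0 < log 2 := log_pos one_lt_two
    nlinarith
  have hhalf : (1 / 2 : ℝ) < 1 - δ / 2 := by linarith
  have hd : deriv (profile δ) (1 / 2) ≠ 0 := by
    rw [deriv_profile_of_lt hhalf]
    exact (vortexDeriv_neg (by norm_num)).ne
  obtain ⟨H, hH⟩ := hm.exists_abs_eigenfunction_le
  have heq := hm.solvesEigenEq hn1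
  refine ⟨memW1InftyWith_profile hδ0,
    (holderFullNorm_vortex_sub_profile_le hα1 hδ0 hδ1).trans (ENNReal.ofReal_le_ofReal hδε),
    profile_antitoneOn hδ0 hδ1, fun r hr => ?_, derivSupport_profile hδ0 hδ1,
    log 2 / 2 + δ * ℓ, (ℓ - lam₁) / (δ * log δ ^ 2), eigenfunction n δ (δ * ℓ) Q₁ Q₂, ?_, ?_, hlam,
    hm.contDiffOn_eigenfunction hn1, ⟨1 / 2, subset_closure ⟨by norm_num, hd⟩,
      hm.eigenfunction_half_ne_zero⟩, heq,
    solvesLinearizedEuler_rotatingWave hδ0 hδ1 hn1 hm.measurable_eigenfunction hH heq,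
    isNonradialRotating_rotatingWave hn1 hlam (by norm_num) hm.eigenfunction_half_ne_zero hd⟩
  · rw [profile_of_mem hr.1.le hr.2.le, profile_of_mem (by linarith) (by linarith)]
  · have hl : log δ ≠ 0 := (log_neg hδ0 hδ1).ne
    field_simp
    ring
  · rw [abs_div, abs_of_pos hL, div_le_iff₀ hL]
    exact hℓ
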